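/- Let $p$ be a prime and let $R$ be a binomial $\mathbb{Z}_p$-ring, i.e. a $\mathbb{Z}_p$-algebra which is an integral domain of characteristic $0$ containing $C_\lambda^k=\lambda(\lambda-1)\cdots(\lambda-k+1)/k!$ for all $\lambda\in R$, $k\in\mathbb{N}$. Assume that $R$ is discriminated by $\mathbb{Z}_p$: for every finite $C\subset R$ there is a $\mathbb{Z}_p$-algebra homomorphism $R\to\mathbb{Z}_p$ that is injective on $C$. A Hall $R$-group is a nilpotent group $G$ with powers $g^r$ ($g\in G$, $r\in R$) such that $g^0=1$, $g^1=g$, $g^{r+s}=g^rg^s$, $g^{rs}=(g^r)^s$, $y^{-1}x^ry=(y^{-1}xy)^r$ and $x_1^r\cdots x_k^r=(x_1\cdots x_k)^r\,\tau_2(x)^{C_r^2}\cdots\tau_d(x)^{C_r^d}$, where $d$ is the nilpotency class of $G$ and the Petresco words $\tau_i$ are defined recursively by $x_1^i\cdots x_k^i=\tau_1(x)^{C_i^1}\cdots\tau_i(x)^{C_i^i}$. Let $A=\{a_1,\dots,a_n\}$, let $F(A,R,c)$ be the free Hall $R$-group on $A$ of nilpotency class $c$, and let $\mathbb{F}(A,R)=\varprojlim_c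 F(A,R,c)$. Let $\mathbb{F}=\mathbb{F}(A)$ be the free pro-$p$ group with basis $A$ and $\mathbb{F}(X)$ the free pro-$p$ group with basis $X=\{x_1,\dots,x_m\}$. Let $h_1,\dots,h_m\in\mathbb{F}(A,R)$ and let $H_c\le F(A,R,c)$ be the Hall $\mathbb{Z}_p$-subgroup generated by the images of $h_1,\dots,h_m$, i.e. the smallest subgroup that contains these images and is closed under powers with exponents in $\mathbb{Z}_p$. Let $H=\langle h_1,\dots,h_m\rangle_{\mathbb{F}}=\varprojlim_c H_c\le\mathbb{F}(A,R)$, with the inverse limit topology, where each $H_c$ carries its pro-$p$ topology (given by its normal subgroups of $p$-power index). Then: 1. $H$ is a pro-$p$ group. There is exactly one continuous homomorphism $\theta:\mathbb{F}(X)\to H$ with $\theta(x_i)=h_i$ for all $i$ (the substitution map), and it is surjective. 2. $H$ is fully residually $\mathbb{F}$ by continuous homomorphisms: for every finite $C\subset H$ there is a continuous homomorphism $H\to\mathbb{F}$ that is injective on $C$. 3. $H$ is the coordinate group of an irreducible algebraic set over $\mathbb{F}$: there is a system of equations $S\subset\mathbb{F}(X)$ such that its solution set $V(S)\subset\mathbb{F}^m$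 is irreducible in the Zariski topology (the topology for which the sets $V(T)$, $T\subset\mathbb{F}(X)$, form a pre-basis of closed sets), and there is an isomorphism of topological groups $\mathbb{F}(X)/\mathrm{Rad}(V(S))\cong H$ sending the class of $x_i$ to $h_i$. Here $\mathrm{Rad}(V(S))$ is the set of all $f\in\mathbb{F}(X)$ with $f(g)=1$ for all $g\in V(S)$. 4. If moreover $a_1,\dots,a_n\in H$, then there is an injective continuous homomorphism $\alpha:\mathbb{F}\to H$ with $\alpha(a_j)=a_j$ for all $j$, which makes $H$ an $\mathbb{F}$-group, and 2 and 3 hold for $\mathbb{F}$-groups. That is, for every finite $C\subset H$ there is a continuous homomorphism $\varphi:H\to\mathbb{F}$ that is injective on $C$ and satisfies $\varphi\circ\alpha=\mathrm{id}_{\mathbb{F}}$; and there is a system $S$ of equations with coefficients in $\mathbb{F}$, i.e. a subset of the free pro-$p$ product $\mathbb{F}[[X]]=\mathbb{F}*_p\mathbb{F}(X)$, such that $V(S)\subset\mathbb{F}^m$ is irreducible (for the Zariski topology given by equations with coefficients) and there is an isomorphism of topological groups $\mathbb{F}[[X]]/\mathrm{Rad}(V(S))\cong H$ that equals $\alpha$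 on $\mathbb{F}$ and sends the class of $x_i$ to $h_i$. -/

import Mathlib

universe u v

/-! ### Pro-`p` groups and free pro-`p` groups -/

section ProP

/-- A topological group is pro-`p` if it is profinite and all its open normal subgroups have
`p`-power index, i.e. if it is an inverse limit of discrete finite `p`-groups. -/
structure IsProP (p : ℕ) (G : Type*) [Group G] [TopologicalSpace G] : Prop where
  isTopologicalGroup : IsTopologicalGroup G
  compactSpace : CompactSpace G
  t2Space : T2Space G
  totallyDisconnectedSpace : TotallyDisconnectedSpace G
  index_eq : ∀ N : Subgroup G, N.Normal → IsOpen (N : Set G) → ∃ k : ℕ, N.index = p ^ k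

/-- The normal subgroups of (finite) `p`-power index of an abstract group. -/
structure PPowSubgroup (p : ℕ) (G : Type*) [Group G] where
  toSubgroup : Subgroup G
  normal : toSubgroup.Normal
  index_eq : ∃ k : ℕ, toSubgroup.index = p ^ k

attribute [instance] PPowSubgroup.normal

/-- The pro-`p` topology of an abstract group `G`: the coarsest topology for which all the
projections of `G` onto its finite `p`-quotients, taken discrete, are continuous. -/
@[reducible]
def proPTopology (p : ℕ) (G : Type*) [Group G] : TopologicalSpace G :=
  ⨅ N : PPowSubgroup p G,
    TopologicalSpace.induced (fun g : G => (g : G ⧸ N.toSubgroup)) ⊥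

/-- The compatible families in `∏ N, FreeGroup X ⧸ N`, where `N` runs over the normal subgroups
of `p`-power index of the abstract free group on `X`. -/
def freeProPSubgroup (p : ℕ) (X : Type*) :
    Subgroup (∀ N : PPowSubgroup p (FreeGroup X), FreeGroup X ⧸ N.toSubgroup) where
  carrier := {w | ∀ (N M : PPowSubgroup p (FreeGroup X)) (h : N.toSubgroup ≤ M.toSubgroup),
    QuotientGroup.map N.toSubgroup M.toSubgroup (MonoidHom.id _) h (w N) = w M}
  mul_mem' := by
    intro a b ha hb N M h
    simp only [Pi.mul_apply, map_mul]
    rw [ha N M h, hb N M h]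
  one_mem' := by
    intro N M h
    simp only [Pi.one_apply, map_one]
  inv_mem' := by
    intro a ha N M h
    simp only [Pi.inv_apply, map_inv]
    rw [ha N M h]

/-- The free pro-`p` group on a finite set `X`: the pro-`p` completion of the abstract free group
on `X`, i.e. the inverse limit of the finite `p`-quotients of the latter. -/
def FreeProP (p : ℕ) (X : Type*) : Type _ := freeProPSubgroup p X

namespace FreeProP

variable {p : ℕ} {X Y : Type*}

noncomputable instance : Group (FreeProP p X) :=
  inferInstanceAs (Group (freeProPSubgroup p X))

/-- The projection of the free pro-`p` group onto a finite `p`-quotient. -/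
def proj (N : PPowSubgroup p (FreeGroup X)) (w : FreeProP p X) : FreeGroup X ⧸ N.toSubgroup :=
  w.1 N

/-- The inverse limit topology. -/
instance : TopologicalSpace (FreeProP p X) :=
  ⨅ N : PPowSubgroup p (FreeGroup X), TopologicalSpace.induced (proj N) ⊥

/-- The basis `X` of the free pro-`p` group. -/
def of (x : X) : FreeProP p X := ⟨fun _ => (FreeGroup.of x : FreeGroup X), fun _ _ _ => rfl⟩

/-- The abstract homomorphism `FreeGroup X → FreeGroup Y ⧸ M` with `x ↦ g x`. -/
def liftAux (g : X → FreeProP p Y) (M : PPowSubgroup p (FreeGroup Y)) :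
    FreeGroup X →* FreeGroup Y ⧸ M.toSubgroup :=
  FreeGroup.lift fun x => proj M (g x)

/-- The kernel of `liftAux`. -/
def liftKer [Fact p.Prime] (g : X → FreeProP p Y) (M : PPowSubgroup p (FreeGroup Y)) :
    PPowSubgroup p (FreeGroup X) where
  toSubgroup := (liftAux g M).ker
  normal := inferInstance
  index_eq := by
    obtain ⟨k, hk⟩ := M.index_eq
    have h : (liftAux g M).ker.index ∣ p ^ k := by
      rw [Subgroup.index_ker, ← hk, Subgroup.index]
      exact Subgroup.card_subgroup_dvd_card _
    obtain ⟨l, -, hl⟩ := (Nat.dvd_prime_pow Fact.out).1 h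
    exact ⟨l, hl⟩

/-- The continuous homomorphism `FreeProP p X → FreeProP p Y` with `x ↦ g x`. -/
def lift [Fact p.Prime] (g : X → FreeProP p Y) : FreeProP p X →* FreeProP p Y where
  toFun w := ⟨fun M => QuotientGroup.lift _ (liftAux g M) le_rfl (proj (liftKer g M) w), by
    intro N M h
    have key : (QuotientGroup.map N.toSubgroup M.toSubgroup (MonoidHom.id _) h).comp
        (liftAux g N) = liftAux g M := by
      ext x
      simpa [liftAux] using! (g x).2 N M h
    have hle : (liftKer g N).toSubgroup ≤ (liftKer g M).toSubgroup := by
      intro y hy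
      have hy' : liftAux g N y = 1 := hy
      change liftAux g M y = 1
      rw [← key, MonoidHom.comp_apply, hy', map_one]
    have hw := w.2 (liftKer g N) (liftKer g M) hle
    obtain ⟨y, hy⟩ := QuotientGroup.mk_surjective (w.1 (liftKer g N))
    change QuotientGroup.map _ _ _ h (QuotientGroup.lift _ (liftAux g N) _ (w.1 (liftKer g N))) =
      QuotientGroup.lift _ (liftAux g M) _ (w.1 (liftKer g M))
    rw [← hw, ← hy]
    change QuotientGroup.map _ _ _ h (liftAux g N y) = liftAux g M y
    rw [← key, MonoidHom.comp_apply]⟩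
  map_one' := by
    apply Subtype.ext
    funext M
    exact map_one (QuotientGroup.lift _ (liftAux g M) le_rfl)
  map_mul' a b := by
    apply Subtype.ext
    funext M
    exact map_mul (QuotientGroup.lift _ (liftAux g M) le_rfl) _ _

end FreeProP

end ProP

/-! ### Algebraic geometry -/

section AlgebraicGeometry

/-- For a finite set `X` of variables, `F = FreeProP p A` and a point `g ∈ F ^ X`, the evaluation
`FreeProP p X → F`, `x ↦ g x`, of equations without coefficients. -/
def evalPoint {p : ℕ} [Fact p.Prime] {A X : Type*} (g : X → FreeProP p A) :
    FreeProP p X →* FreeProP p A :=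
  FreeProP.lift g

/-- The group `F[[X]]` of equations with coefficients in `F = FreeProP p A`, i.e. the free pro-`p`
product of `F` and `FreeProP p X`, is the free pro-`p` group on `A ⊔ X`. For `g ∈ F ^ X` this is
the `F`-homomorphism `F[[X]] → F` with `x ↦ g x`. -/
def evalPointCoeff {p : ℕ} [Fact p.Prime] {A X : Type*} (g : X → FreeProP p A) :
    FreeProP p (A ⊕ X) →* FreeProP p A :=
  FreeProP.lift (Sum.elim FreeProP.of g)

/-- The inclusion of `F = FreeProP p A` into `F[[X]]`. -/
def coeffIncl {p : ℕ} [Fact p.Prime] (A X : Type*) : FreeProP p A →* FreeProP p (A ⊕ X) :=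
  FreeProP.lift fun a => FreeProP.of (Sum.inl a)

variable {P E F : Type*} [Group E] [Group F]

/-- `V(S)`: the points at which all the equations `f = 1`, `f ∈ S`, hold. Here `P` is the set of
points, `E` the group of left-hand sides of equations, and `ev g f` the value of `f` at `g`. -/
def algebraicSet (ev : P → E →* F) (S : Set E) : Set P := {g | ∀ f ∈ S, ev g f = 1}

/-- The Zariski topology: the algebraic sets form a pre-basis of closed sets. -/
@[reducible]
def zariskiTopology (ev : P → E →* F) : TopologicalSpace P :=
  TopologicalSpace.generateFrom {U | ∃ S : Set E, U = (algebraicSet ev S)ᶜ}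

/-- An irreducible set for the Zariski topology. -/
def ZariskiIrreducible (ev : P → E →* F) (V : Set P) : Prop :=
  @IsIrreducible P (zariskiTopology ev) V

/-- The radical of a set of points: the equations that hold at all of them. -/
def radical (ev : P → E →* F) (V : Set P) : Subgroup E := ⨅ g ∈ V, (ev g).ker

instance radical_normal (ev : P → E →* F) (V : Set P) : (radical ev V).Normal := by
  constructor
  intro n hn g
  simp only [radical, Subgroup.mem_iInf, MonoidHom.mem_ker] at hn ⊢
  intro i hi
  simp [hn i hi]

/-- The coordinate group of the algebraic set `V(S)`, with its quotient topology. -/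
abbrev CoordinateGroup (ev : P → E →* F) (S : Set E) : Type _ :=
  E ⧸ radical ev (algebraicSet ev S)

end AlgebraicGeometry

/-! ### Discrimination by continuous homomorphisms -/

section Discrimination

variable (H F : Type*) [Group H] [TopologicalSpace H] [Group F] [TopologicalSpace F]

/-- `H` is fully residually `F` by continuous homomorphisms. -/
def FullyResidually : Prop :=
  ∀ C : Set H, C.Finite → ∃ φ : H →ₜ* F, Set.InjOn φ C

variable {H F}

/-- `H`, regarded as an `F`-group through `α`, is fully residually `F` by continuous
`F`-homomorphisms. -/
def FullyResiduallyOver (α : F →ₜ* H) : Prop :=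
  ∀ C : Set H, C.Finite → ∃ φ : H →ₜ* F, (∀ f, φ (α f) = f) ∧ Set.InjOn φ C

end Discrimination

/-! ### Hall groups and free pro-Hall groups -/

section Hall

/-- The values of the Petresco words at a list of elements of a group, given by the recursion
`a₁ ^ i ⋯ aₙ ^ i = τ₁ ^ (i choose 1) * τ₂ ^ (i choose 2) * ⋯ * τᵢ ^ (i choose i)` (and `τ₀ = 1`). -/
def petresco {G : Type*} [Group G] (l : List G) (i : ℕ) : G :=
  (((List.finRange i).map fun k : Fin i => petresco l k.1 ^ i.choose k.1).prod)⁻¹ *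
    (l.map fun a => a ^ i).prod
termination_by i
decreasing_by exact k.2

/-- A Hall `R`-group: a nilpotent group with powers with exponents in the binomial ring `R`. -/
class HallGroup (R : Type*) [CommRing R] [BinomialRing R] (G : Type*) [Group G] where
  /-- the power `g ^ r` -/
  hpow : G → R → G
  nilpotent : Group.IsNilpotent G
  hpow_zero : ∀ g : G, hpow g 0 = 1
  hpow_one : ∀ g : G, hpow g 1 = g
  hpow_add : ∀ (g : G) (r s : R), hpow g (r + s) = hpow g r * hpow g s
  hpow_mul : ∀ (g : G) (r s : R), hpow g (r * s) = hpow (hpow g r) s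
  conj_hpow : ∀ (x y : G) (r : R), y⁻¹ * hpow x r * y = hpow (y⁻¹ * x * y) r
  prod_hpow : ∀ (l : List G) (r : R),
    (l.map fun x => hpow x r).prod =
      hpow l.prod r * ((List.Ico 2 (Group.nilpotencyClass G + 1)).map fun i =>
        hpow (petresco l i) (Ring.choose r i)).prod

/-- Terms over `A` in the language of groups with `R`-powers. -/
inductive HallTerm (R : Type u) (A : Type v) : Type (max u v)
  | var : A → HallTerm R A
  | one : HallTerm R A
  | mul : HallTerm R A → HallTerm R A → HallTerm R A
  | inv : HallTerm R A → HallTerm R A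
  | hpow : HallTerm R A → R → HallTerm R A

/-- The value of a term under an assignment of its variables in a Hall `R`-group. -/
def HallTerm.eval {R : Type u} [CommRing R] [BinomialRing R] {A : Type v}
    {G : Type*} [Group G] [HallGroup R G] (f : A → G) : HallTerm R A → G
  | var a => f a
  | one => 1
  | mul s t => s.eval f * t.eval f
  | inv s => (s.eval f)⁻¹
  | hpow s r => HallGroup.hpow (s.eval f) r

variable (R : Type u) [CommRing R] [BinomialRing R] (A : Type v) (c : ℕ)

/-- Two terms are identified if they have the same value under all assignments in all Hall
`R`-groups of nilpotency class at most `c`. -/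
def freeHallSetoid : Setoid (HallTerm R A) where
  r s t := ∀ (G : Type (max u v)) [Group G] [HallGroup R G], Group.nilpotencyClass G ≤ c →
    ∀ f : A → G, s.eval f = t.eval f
  iseqv :=
    ⟨fun _ _ _ _ _ _ => rfl, fun h G _ _ hG f => (h G hG f).symm,
      fun h h' G _ _ hG f => (h G hG f).trans (h' G hG f)⟩

/-- The free Hall `R`-group of class `c` on `A`, i.e. the relatively free object of the variety of
Hall `R`-groups of class at most `c`: the terms over `A` modulo the identities of the variety. -/
def FreeHall : Type (max u v) := Quotient (freeHallSetoid R A c)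

namespace FreeHall

variable {R A c}

instance : Group (FreeHall R A c) where
  mul := Quotient.map₂ HallTerm.mul fun _ _ h _ _ h' G _ _ hG f => by
    simp only [HallTerm.eval, h G hG f, h' G hG f]
  one := Quotient.mk _ HallTerm.one
  inv := Quotient.map HallTerm.inv fun _ _ h G _ _ hG f => by
    simp only [HallTerm.eval, h G hG f]
  mul_assoc := by
    rintro ⟨x⟩ ⟨y⟩ ⟨z⟩
    exact Quotient.sound fun G _ _ hG f => mul_assoc (x.eval f) (y.eval f) (z.eval f)
  one_mul := by
    rintro ⟨x⟩
    exact Quotient.sound fun G _ _ hG f => one_mul (x.eval f)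
  mul_one := by
    rintro ⟨x⟩
    exact Quotient.sound fun G _ _ hG f => mul_one (x.eval f)
  inv_mul_cancel := by
    rintro ⟨x⟩
    exact Quotient.sound fun G _ _ hG f => inv_mul_cancel (x.eval f)

/-- The `R`-powers in the free Hall `R`-group. -/
def hpow (g : FreeHall R A c) (r : R) : FreeHall R A c :=
  Quotient.map (fun t => HallTerm.hpow t r) (fun _ _ h G _ _ hG f => by
    simp only [HallTerm.eval, h G hG f]) g

/-- The free generators. -/
def of (a : A) : FreeHall R A c := Quotient.mk _ (HallTerm.var a)

/-- The natural homomorphism `ψ_c : F(A, R, c + 1) → F(A, R, c)`. -/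
def trans : FreeHall R A (c + 1) →* FreeHall R A c where
  toFun := Quotient.map id fun _ _ h G _ _ hG f => h G (hG.trans (Nat.le_succ c)) f
  map_one' := rfl
  map_mul' := by
    rintro ⟨x⟩ ⟨y⟩
    rfl

end FreeHall

/-- The compatible families in `∏ c, F(A, R, c)`. -/
def proHallSubgroup : Subgroup (∀ c : ℕ, FreeHall R A c) where
  carrier := {g | ∀ c, FreeHall.trans (g (c + 1)) = g c}
  mul_mem' := by
    intro a b ha hb c
    simp only [Pi.mul_apply, map_mul]
    rw [ha c, hb c]
  one_mem' := by
    intro c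
    simp only [Pi.one_apply, map_one]
  inv_mem' := by
    intro a ha c
    simp only [Pi.inv_apply, map_inv]
    rw [ha c]

/-- The free pro-Hall `R`-group `𝔽(A, R)`, the inverse limit of the groups `F(A, R, c)`. -/
def ProHall : Type (max u v) := proHallSubgroup R A

namespace ProHall

variable {R A}

noncomputable instance : Group (ProHall R A) := inferInstanceAs (Group (proHallSubgroup R A))

/-- The `c`-truncation `𝔽(A, R) → F(A, R, c)`. -/
noncomputable def trunc (c : ℕ) : ProHall R A →* FreeHall R A c :=
  (Pi.evalMonoidHom (fun c => FreeHall R A c) c).comp (proHallSubgroup R A).subtype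

/-- The basis `A` of `𝔽(A, R)`. -/
def of (a : A) : ProHall R A := ⟨fun _ => FreeHall.of a, fun _ => rfl⟩

end ProHall

variable {R A c}
variable (p : ℕ) [Fact p.Prime] [Algebra ℤ_[p] R] {m : ℕ}

/-- The Hall `ℤ_p`-subgroup of `F(A, R, c)` generated by a tuple: the smallest subgroup that
contains the tuple and is closed under powers with exponents in `ℤ_p`. -/
def hallSpan (h : Fin m → FreeHall R A c) : Subgroup (FreeHall R A c) :=
  sInf {K | (∀ i, h i ∈ K) ∧
    ∀ g ∈ K, ∀ r : ℤ_[p], FreeHall.hpow g (algebraMap ℤ_[p] R r) ∈ K}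

/-- The inverse limit, inside `𝔽(A, R)`, of the Hall `ℤ_p`-subgroups `H_c` of `F(A, R, c)`
generated by the `c`-truncations of `h₁, …, h_m`. -/
def genProPSubgroup (h : Fin m → ProHall R A) : Subgroup (ProHall R A) where
  carrier := {g | ∀ c, ProHall.trunc c g ∈ hallSpan p fun i => ProHall.trunc c (h i)}
  mul_mem' := by
    intro a b ha hb c
    rw [map_mul]
    exact mul_mem (ha c) (hb c)
  one_mem' := by
    intro c
    rw [map_one]
    exact one_mem _
  inv_mem' := by
    intro a ha c
    rw [map_inv]
    exact inv_mem (ha c)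

/-- The pro-`p` subgroup `⟨h₁, …, h_m⟩_𝔽` of `𝔽(A, R)` generated by `h₁, …, h_m`. -/
def GenProP (h : Fin m → ProHall R A) : Type _ := genProPSubgroup p h

namespace GenProP

variable {p}

noncomputable instance (h : Fin m → ProHall R A) : Group (GenProP p h) :=
  inferInstanceAs (Group (genProPSubgroup p h))

/-- The inclusion into `𝔽(A, R)`. -/
noncomputable def incl (h : Fin m → ProHall R A) : GenProP p h →* ProHall R A := (genProPSubgroup p h).subtype

/-- The projection onto `H_c`. -/
noncomputable def proj (h : Fin m → ProHall R A) (c : ℕ) (g : GenProP p h) :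
    hallSpan p fun i => ProHall.trunc c (h i) :=
  ⟨ProHall.trunc c (incl h g), g.2 c⟩

/-- The inverse limit topology, where the groups `H_c` carry their pro-`p` topologies. -/
noncomputable instance (h : Fin m → ProHall R A) : TopologicalSpace (GenProP p h) :=
  ⨅ c : ℕ, TopologicalSpace.induced (proj h c) (proPTopology p _)

end GenProP

end Hall

/-! Everything rests on a separation statement, `FreeHall.exists_discriminating`: for `x ≠ 1` in
`F(A, R, c)` there is `r ≠ 0` in `R` such that every ring homomorphism `ψ : R → ℤ_p` with `ψ r ≠ 0`
sends `x` to a nontrivial element of some finite `p`-quotient, of class at most `c`, of the free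
group on `A`. Here a finite `p`-group is a Hall `R`-group through `ψ`: its axioms hold for natural
exponents and extend to `ℤ_p` by density.

To separate, Lazard elimination writes `x` as a product of `R`-powers of commutators from a list
that depends only on `A` and `c`. By the same elimination in the free associative algebra, the Lie
elements of this list are linearly independent over every commutative ring. Let `r` be a nonzero
exponent of minimal weight. Under the Magnus map `a ↦ 1 + a X` over `ℤ/p^j`, with `ψ r ≠ 0` modulo
`p^j`, the leading coefficient of the product is a nontrivial combination of independent Lie
elements, hence nonzero.

The Hall formula for natural exponents needs the Hall–Petresco theorem. Among power series units it
follows by comparing coefficients that are polynomial in the exponent; Magnus's theorem on dimension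
subgroups, again a consequence of elimination, carries it to free groups.

Since `R` is discriminated by `ℤ_p`, a single `φ` that kills none of finitely many `r` makes the
specialization `𝔽(A, R) → 𝔽` injective on a given finite set. Each `H_c` is Hausdorff by separation
and compact by elimination, being a finite product of continuous images of `ℤ_p`; so `H` is pro-`p`.
The image of a continuous homomorphism from a compact group onto the generators is closed at each
level, hence stable under `ℤ_p`-powers, hence everything; compactness passes this to the limit.

For the coordinate group take `S = ker θ`. Specializations composed with `θ` are points of `V(S)`,
and their discriminating `H` yields both `Rad (V(S)) = ker θ` and irreducibility. Specializations
fix the `a_j`, so when `H` contains these they are `𝔽`-homomorphisms and retractions of `α`. -/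

open scoped commutatorElement

/-! ### Groups with powers -/

/-- Powers with exponents in `R` on a group `G` which are additive modulo power-closed subgroups
with abelian quotient. -/
structure PowStr (R : Type*) [CommRing R] (G : Type*) [Group G] where
  pow : G → R → G
  pow_zero : ∀ g, pow g 0 = 1
  pow_one : ∀ g, pow g 1 = g
  pow_add : ∀ g r s, pow g (r + s) = pow g r * pow g s
  pow_mul : ∀ g r s, pow g (r * s) = pow (pow g r) s
  conj_pow : ∀ x y r, y⁻¹ * pow x r * y = pow (y⁻¹ * x * y) r
  -- A weak form of the Hall formula that is enough for elimination. It holds for integer powers in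
  -- any group as well as for powers in free Hall groups.
  mul_pow_mem : ∀ K : Subgroup G, (∀ g ∈ K, ∀ r, pow g r ∈ K) →
    ∀ a ∈ Subgroup.normalizer (K : Set G), ∀ b ∈ Subgroup.normalizer (K : Set G), ⁅a, b⁆ ∈ K → ∀ r,
      (pow a r * pow b r)⁻¹ * pow (a * b) r ∈ K

namespace PowStr

variable {R : Type*} [CommRing R] {G : Type*} [Group G] (P : PowStr R G)

/-- A subgroup that is closed under powers. -/
def IsClosed (K : Subgroup G) : Prop := ∀ g ∈ K, ∀ r, P.pow g r ∈ K

/-- The smallest power-closed subgroup containing a set. -/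
def closure (s : Set G) : Subgroup G := sInf {K | s ⊆ K ∧ P.IsClosed K}

theorem subset_closure (s : Set G) : s ⊆ P.closure s := fun x hx => by
  simp only [closure, SetLike.mem_coe, Subgroup.mem_sInf]
  exact fun K hK => hK.1 hx

theorem isClosed_closure (s : Set G) : P.IsClosed (P.closure s) := fun g hg r => by
  simp only [closure, Subgroup.mem_sInf] at hg ⊢
  exact fun K hK => hK.2 g (hg K hK) r

theorem closure_le {s : Set G} {K : Subgroup G} (hs : s ⊆ K) (hK : P.IsClosed K) :
    P.closure s ≤ K := sInf_le ⟨hs, hK⟩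

theorem one_pow (r : R) : P.pow 1 r = 1 := by
  have h := P.pow_mul 1 0 r
  rwa [zero_mul, P.pow_zero, eq_comm] at h

theorem pow_neg (g : G) (r : R) : P.pow g (-r) = (P.pow g r)⁻¹ := by
  rw [eq_inv_iff_mul_eq_one, ← P.pow_add, neg_add_cancel, P.pow_zero]

theorem inv_pow (g : G) (r : R) : P.pow g⁻¹ r = (P.pow g r)⁻¹ := by
  have h : g⁻¹ = P.pow g (-1) := by rw [P.pow_neg, P.pow_one]
  rw [h, ← P.pow_mul, neg_one_mul, P.pow_neg]

theorem conj_pow' (x y : G) (r : R) : y * P.pow x r * y⁻¹ = P.pow (y * x * y⁻¹) r := by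
  simpa using P.conj_pow x y⁻¹ r

/-- Conjugation commutes with powers, so the preimage of `K` under it is again power-closed. -/
theorem conj_mem_closure {s : Set G} {K : Subgroup G} (hK : P.IsClosed K) (y : G)
    (hs : ∀ x ∈ s, y * x * y⁻¹ ∈ K) {g : G} (hg : g ∈ P.closure s) : y * g * y⁻¹ ∈ K := by
  have h : P.closure s ≤ K.comap (MulAut.conj y).toMonoidHom := by
    refine P.closure_le (fun x hx => by simpa using hs x hx) fun g hg r => ?_
    have hg' : y * g * y⁻¹ ∈ K := by simpa using hg
    have := hK _ hg' r
    rw [← P.conj_pow'] at this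
    simpa using this
  simpa using h hg

/-- Ordinary powers with exponents in `ℤ`. -/
def int (G : Type*) [Group G] : PowStr ℤ G where
  pow g r := g ^ r
  pow_zero g := zpow_zero g
  pow_one g := zpow_one g
  pow_add g r s := zpow_add g r s
  pow_mul g r s := zpow_mul g r s
  conj_pow x y r := by
    have := (conj_zpow (i := r) (a := y⁻¹) (b := x)).symm
    simpa using this
  mul_pow_mem K hK a ha b hb hab r := by
    let π := QuotientGroup.mk' (K.subgroupOf (Subgroup.normalizer (K : Set G)))
    let a' : Subgroup.normalizer (K : Set G) := ⟨a, ha⟩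
    let b' : Subgroup.normalizer (K : Set G) := ⟨b, hb⟩
    have hcomm : Commute (π a') (π b') := by
      rw [← commutatorElement_eq_one_iff_commute, ← map_commutatorElement]
      rw [QuotientGroup.mk'_apply, QuotientGroup.eq_one_iff]
      exact hab
    have h : π ((a' ^ r * b' ^ r)⁻¹ * (a' * b') ^ r) = 1 := by
      simp only [map_mul, map_inv, map_zpow, hcomm.mul_zpow, inv_mul_cancel]
    rw [QuotientGroup.mk'_apply, QuotientGroup.eq_one_iff] at h
    simpa [Subgroup.mem_subgroupOf] using! h

end PowStr

/-! ### Elimination -/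

section Elimination

variable {A : Type v}

/-- The value of a formal commutator in a group. -/
def commEval {G : Type*} [Group G] (f : A → G) : FreeMagma A → G
  | .of a => f a
  | .mul x y => ⁅commEval f x, commEval f y⁆

theorem map_commEval {G H : Type*} [Group G] [Group H] (g : G →* H) (f : A → G)
    (t : FreeMagma A) : g (commEval f t) = commEval (fun a => g (f a)) t := by
  induction t with
  | ih1 a => rfl
  | ih2 x y hx hy =>
    change g ⁅_, _⁆ = ⁅_, _⁆
    rw [map_commutatorElement, hx, hy]

/-- The formal commutator `[y, [y, …, [y, x]]]`. -/
def adIter (y x : FreeMagma A) (k : ℕ) : FreeMagma A := (fun t => FreeMagma.mul y t)^[k] x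

theorem adIter_zero (y x : FreeMagma A) : adIter y x 0 = x := rfl

theorem adIter_succ (y x : FreeMagma A) (k : ℕ) :
    adIter y x (k + 1) = FreeMagma.mul y (adIter y x k) :=
  Function.iterate_succ_apply' _ _ _

theorem length_adIter (y x : FreeMagma A) (k : ℕ) :
    (adIter y x k).length = k * y.length + x.length := by
  induction k with
  | zero => simp [adIter_zero]
  | succ k ih =>
    rw [adIter_succ]
    change y.length + (adIter y x k).length = _
    rw [ih]
    ring

/-- The family that replaces `S` when `S i₀` is eliminated. -/
def elimNext (c : ℕ) {ι : Type} (S : ι → FreeMagma A) (i₀ : ι) :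
    {i // i ≠ i₀} × Fin (c + 1) → FreeMagma A :=
  -- Iterates past the `c`-th have weight more than `c`; dropping them keeps the index type finite.
  fun q => adIter (S i₀) (S q.1) q.2

/-- The list of formal commutators eliminated one after another from a family, until all remaining
ones have weight more than `c`. -/
inductive Elim (c : ℕ) : ∀ {ι : Type}, (ι → FreeMagma A) → List (FreeMagma A) → Prop
  | done {ι : Type} (S : ι → FreeMagma A) (hS : ∀ i, c < (S i).length) : Elim c S []
  | step {ι : Type} (S : ι → FreeMagma A) (i₀ : ι) (h₀ : (S i₀).length ≤ c)
      (Y : List (FreeMagma A)) (hY : Elim c (elimNext c S i₀) Y) : Elim c S (S i₀ :: Y)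

theorem Elim.length_le {c : ℕ} {ι : Type} {S : ι → FreeMagma A} {Y : List (FreeMagma A)}
    (h : Elim c S Y) : ∀ t ∈ Y, t.length ≤ c := by
  induction h with
  | done => simp
  | step S i₀ h₀ Y hY ih => simpa [h₀] using ih

/-- Double induction: `w` bounds the weights from below, `d` controls the distance of `w` from `c`,
and `N` counts the members of weight exactly `w`. Eliminating one of these removes it and only adds
members of larger weight, so `N` drops by one; at `N = 0` the bound `w` can be raised. -/
theorem exists_elim_aux (c d : ℕ) : ∀ w, 0 < w → c < w + d → ∀ N : ℕ, ∀ {ι : Type} [Finite ι]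
    (S : ι → FreeMagma A), (∀ i, w ≤ (S i).length) → Nat.card {i // (S i).length = w} = N →
    ∃ Y, Elim c S Y := by
  induction d with
  | zero => exact fun w _ hc N ι _ S hS _ => ⟨[], .done S fun i => by have := hS i; omega⟩
  | succ d ihd =>
    intro w hw hc N
    induction N with
    | zero =>
      intro ι _ S hS hN
      refine ihd (w + 1) (by omega) (by omega) _ S (fun i => ?_) rfl
      have hne : (S i).length ≠ w := fun hi => by
        rw [Finite.card_eq_zero_iff] at hN
        exact hN.elim ⟨i, hi⟩
      have := hS i
      omega
    | succ N ihN =>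
      intro ι _ S hS hN
      by_cases hcw : c < w
      · exact ⟨[], .done S fun i => hcw.trans_le (hS i)⟩
      have hne : Nonempty {i // (S i).length = w} := by
        by_contra h
        rw [not_nonempty_iff] at h
        simp at hN
      obtain ⟨i₀, hi₀⟩ := hne
      have hlen (q) : (elimNext c S i₀ q).length = q.2 * w + (S q.1).length := by
        rw [elimNext, length_adIter, hi₀]
      have hk (q) (hq : (elimNext c S i₀ q).length = w) : q.2 = 0 ∧ (S q.1).length = w := by
        rw [hlen] at hq
        have h1 := hS q.1
        have h2 : (q.2 : ℕ) = 0 := by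
          rcases Nat.eq_zero_or_pos (q.2 : ℕ) with h | h
          · exact h
          · have := Nat.le_mul_of_pos_left w h
            omega
        refine ⟨Fin.ext h2, ?_⟩
        rw [h2] at hq
        omega
      have hcard : Nat.card {q // (elimNext c S i₀ q).length = w} = N := by
        have e : {q // (elimNext c S i₀ q).length = w} ≃
            {j : {i // (S i).length = w} // j ≠ ⟨i₀, hi₀⟩} :=
          { toFun := fun q => ⟨⟨q.1.1, (hk q.1 q.2).2⟩, fun h => q.1.1.2 (congrArg Subtype.val h)⟩
            invFun := fun j => ⟨(⟨j.1.1, fun h => j.2 (Subtype.ext h)⟩, 0), by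
              rw [hlen]
              simpa using j.1.2⟩
            left_inv := fun q => by
              apply Subtype.ext
              exact Prod.ext rfl (hk q.1 q.2).1.symm
            right_inv := fun j => rfl }
        rw [Nat.card_congr e]
        have := Fintype.ofFinite {i // (S i).length = w}
        classical
        rw [Nat.card_eq_fintype_card] at hN ⊢
        rw [Fintype.card_subtype_compl, Fintype.card_subtype_eq, hN]
        rfl
      obtain ⟨Y, hY⟩ := ihN (elimNext c S i₀)
        (fun q => by rw [hlen]; have := hS q.1; omega) hcard
      exact ⟨_, .step S i₀ (by omega) Y hY⟩

theorem exists_elim (c : ℕ) {ι : Type} [Finite ι] (S : ι → FreeMagma A) : ∃ Y, Elim c S Y :=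
  exists_elim_aux c c 1 one_pos (by omega) _ S (fun i => (S i).length_pos) rfl

variable {R : Type*} [CommRing R] {G : Type*} [Group G] (P : PowStr R G)

/-- The three subgroups lemma modulo `N`, read off in `G ⧸ N`. -/
theorem commutator_commutator_le_of_rotate (N H₁ H₂ H₃ : Subgroup G) [N.Normal]
    (h1 : ⁅⁅H₂, H₃⁆, H₁⁆ ≤ N) (h2 : ⁅⁅H₃, H₁⁆, H₂⁆ ≤ N) : ⁅⁅H₁, H₂⁆, H₃⁆ ≤ N := by
  have key (K : Subgroup G) : K ≤ N ↔ K.map (QuotientGroup.mk' N) = ⊥ := by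
    rw [Subgroup.map_eq_bot_iff, QuotientGroup.ker_mk']
  rw [key] at h1 h2 ⊢
  simp only [Subgroup.map_commutator] at h1 h2 ⊢
  exact Subgroup.commutator_commutator_eq_bot_of_rotate h1 h2

/-- The series is indexed from `0`, so this is the usual `[γ_i, γ_j] ≤ γ_{i+j}`; the induction is
the three subgroups lemma. -/
theorem commutator_lowerCentralSeries_le (n : ℕ) : ∀ m : ℕ,
    ⁅(⊤ : Subgroup G).lowerCentralSeries m, (⊤ : Subgroup G).lowerCentralSeries n⁆ ≤
      (⊤ : Subgroup G).lowerCentralSeries (m + n + 1) := by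
  induction n with
  | zero => exact fun m => le_rfl
  | succ n ih =>
    intro m
    rw [Subgroup.commutator_comm]
    refine commutator_commutator_le_of_rotate _ _ _ _ ?_ ?_
    · rw [Subgroup.commutator_comm ⊤, ← Subgroup.lowerCentralSeries_succ]
      exact (ih (m + 1)).trans (le_of_eq (congrArg _ (by omega)))
    · exact Subgroup.commutator_mono (ih m) le_rfl

theorem commEval_mem_lowerCentralSeries (f : A → G) (t : FreeMagma A) :
    commEval f t ∈ (⊤ : Subgroup G).lowerCentralSeries (t.length - 1) := by
  induction t with
  | ih1 a => simp [FreeMagma.length]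
  | ih2 x y hx hy =>
    change ⁅commEval f x, commEval f y⁆ ∈ (⊤ : Subgroup G).lowerCentralSeries (x.length + y.length - 1)
    have h1 := x.length_pos
    have h2 := y.length_pos
    have := commutator_lowerCentralSeries_le _ _ (Subgroup.commutator_mem_commutator hx hy)
    rwa [show x.length - 1 + (y.length - 1) + 1 = x.length + y.length - 1 by omega] at this

theorem commEval_eq_one {c : ℕ} (hG : (⊤ : Subgroup G).lowerCentralSeries c = ⊥) (f : A → G)
    {t : FreeMagma A} (ht : c < t.length) : commEval f t = 1 := by
  have := Subgroup.lowerCentralSeries_antitone ⊤ (show c ≤ t.length - 1 by omega)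
    (commEval_mem_lowerCentralSeries f t)
  rwa [hG, Subgroup.mem_bot] at this

theorem commEval_adIter (f : A → G) (x y : FreeMagma A) (k : ℕ) :
    commEval f (adIter y x k) = (fun t => ⁅commEval f y, t⁆)^[k] (commEval f x) := by
  induction k with
  | zero => rfl
  | succ k ih =>
    rw [adIter_succ, Function.iterate_succ_apply', ← ih]
    rfl

/-- Let `K` be the power-closed subgroup generated by the iterated commutators `t_k = [y, …, [y,
x]]`. Because `y t_k y⁻¹ = t_{k+1} t_k` and `t_k = 1` for `k > c`, the element `y` normalizes `K`.
Its powers then normalize `K` too, and the products `y^r h` with `h ∈ K` form a power-closed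
subgroup. -/
theorem closure_elim_step (y : G) (s : Set G) (c : ℕ)
    (hc : ∀ x ∈ s, ∀ k, c < k → (fun t => ⁅y, t⁆)^[k] x = 1)
    {g : G} (hg : g ∈ P.closure (insert y s)) :
    ∃ r, ∃ h ∈ P.closure {g | ∃ x ∈ s, ∃ k ≤ c, g = (fun t => ⁅y, t⁆)^[k] x},
      g = P.pow y r * h := by
  set s' := {g | ∃ x ∈ s, ∃ k ≤ c, g = (fun t => ⁅y, t⁆)^[k] x} with hs'
  set K := P.closure s' with hK
  have hKc : P.IsClosed K := P.isClosed_closure _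
  have hmem : ∀ x ∈ s, ∀ k, (fun t => ⁅y, t⁆)^[k] x ∈ K := fun x hx k => by
    rcases le_or_gt k c with hk | hk
    · exact P.subset_closure _ ⟨x, hx, k, hk, rfl⟩
    · rw [hc x hx k hk]
      exact one_mem _
  have hconj (x : G) (k : ℕ) : y * (fun t => ⁅y, t⁆)^[k] x * y⁻¹ =
      (fun t => ⁅y, t⁆)^[k + 1] x * (fun t => ⁅y, t⁆)^[k] x := by
    rw [Function.iterate_succ_apply', commutatorElement_def]
    group
  have h1 : ∀ g ∈ K, y * g * y⁻¹ ∈ K := fun g hg => by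
    refine P.conj_mem_closure hKc y ?_ hg
    rintro _ ⟨x, hx, k, -, rfl⟩
    rw [hconj]
    exact mul_mem (hmem x hx _) (hmem x hx _)
  -- Descending induction on `k`, starting above `c`: solve `y t_k y⁻¹ = t_{k+1} t_k` for `y⁻¹ t_k
  -- y`.
  have h2' : ∀ x ∈ s, ∀ d k, c < k + d → y⁻¹ * (fun t => ⁅y, t⁆)^[k] x * y ∈ K := by
    intro x hx d
    induction d with
    | zero =>
      intro k hk
      rw [hc x hx k hk]
      simp
    | succ d ih =>
      intro k hk
      have h := ih (k + 1) (by omega)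
      have h3 : y⁻¹ * (fun t => ⁅y, t⁆)^[k] x * y =
          (y⁻¹ * (fun t => ⁅y, t⁆)^[k + 1] x * y)⁻¹ * (fun t => ⁅y, t⁆)^[k] x := by
        have h4 := hconj x k
        generalize (fun t => ⁅y, t⁆)^[k + 1] x = a at h4 ⊢
        generalize (fun t => ⁅y, t⁆)^[k] x = b at h4 ⊢
        have h5 : a = y * b * y⁻¹ * b⁻¹ := by rw [h4]; group
        rw [h5]
        group
      rw [h3]
      exact mul_mem (inv_mem h) (hmem x hx k)
  have h2 : ∀ g ∈ K, y⁻¹ * g * y ∈ K := fun g hg => by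
    have := P.conj_mem_closure (s := s') hKc y⁻¹ ?_ hg
    · simpa using this
    · rintro _ ⟨x, hx, k, -, rfl⟩
      simpa using h2' x hx (c + 1) k (by omega)
  have hy : y ∈ Subgroup.normalizer (K : Set G) := by
    rw [Subgroup.mem_normalizer_iff]
    refine fun g => ⟨h1 g, fun h => ?_⟩
    have := h2 _ h
    simpa [mul_assoc] using this
  have hKN : K ≤ Subgroup.normalizer (K : Set G) := Subgroup.le_normalizer
  -- Apply `mul_pow_mem` to `y` and `x y⁻¹ x⁻¹`, whose product lies in `K`: then `y^r · x y^{-r}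
  -- x⁻¹` lies in `K` as well.
  have h3 : ∀ x ∈ K, ∀ r, P.pow y r * x * (P.pow y r)⁻¹ ∈ K := by
    intro x hx r
    have hab : ⁅y, x * y⁻¹ * x⁻¹⁆ ∈ K := by
      have e : ⁅y, x * y⁻¹ * x⁻¹⁆ = (y * x * y⁻¹) * x⁻¹ * (y⁻¹ * x * y) * x⁻¹ := by
        rw [commutatorElement_def]
        group
      rw [e]
      exact mul_mem (mul_mem (mul_mem (h1 x hx) (inv_mem hx)) (h2 x hx)) (inv_mem hx)
    have hb : x * y⁻¹ * x⁻¹ ∈ Subgroup.normalizer (K : Set G) :=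
      mul_mem (mul_mem (hKN hx) (inv_mem hy)) (inv_mem (hKN hx))
    have key := P.mul_pow_mem K hKc y hy _ hb hab r
    have hyx : y * (x * y⁻¹ * x⁻¹) ∈ K := by
      have : y * (x * y⁻¹ * x⁻¹) = (y * x * y⁻¹) * x⁻¹ := by group
      rw [this]
      exact mul_mem (h1 x hx) (inv_mem hx)
    have h4 := (Subgroup.mul_mem_cancel_right K (hKc _ hyx r)).1 key
    rw [inv_mem_iff, ← P.conj_pow', P.inv_pow] at h4
    have h5 := mul_mem h4 hx
    simpa [mul_assoc] using h5
  let Q : Subgroup G :=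
    { carrier := {g | ∃ r, ∃ h ∈ K, g = P.pow y r * h}
      one_mem' := ⟨0, 1, one_mem _, by simp [P.pow_zero]⟩
      mul_mem' := by
        rintro _ _ ⟨r, h, hh, rfl⟩ ⟨r', h', hh', rfl⟩
        refine ⟨r + r', _, mul_mem (h3 h hh (-r')) hh', ?_⟩
        rw [P.pow_add, P.pow_neg]
        group
      inv_mem' := by
        rintro _ ⟨r, h, hh, rfl⟩
        refine ⟨-r, _, h3 _ (inv_mem hh) r, ?_⟩
        rw [P.pow_neg]
        group }
  have hQ : P.closure (insert y s) ≤ Q := by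
    refine P.closure_le ?_ ?_
    · rintro x (rfl | hx)
      · exact ⟨1, 1, one_mem _, by simp [P.pow_one]⟩
      · exact ⟨0, x, hmem x hx 0, by simp [P.pow_zero]⟩
    · rintro _ ⟨t, h, hh, rfl⟩ r
      have hyt : P.pow y t ∈ Subgroup.normalizer (K : Set G) := by
        rw [Subgroup.mem_normalizer_iff]
        refine fun g => ⟨fun hg => h3 g hg t, fun hg => ?_⟩
        have := h3 _ hg (-t)
        rw [P.pow_neg] at this
        simpa [mul_assoc] using this
      have hab : ⁅P.pow y t, h⁆ ∈ K := mul_mem (h3 h hh t) (inv_mem hh)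
      have key := P.mul_pow_mem K hKc _ hyt h (hKN hh) hab r
      refine ⟨t * r, _, mul_mem (hKc h hh r) key, ?_⟩
      rw [P.pow_mul]
      group
  exact hQ hg

/-- In a nilpotent group with powers, the elements of the power-closed subgroup generated by a
family of commutators are products of powers of the eliminated commutators. -/
theorem Elim.exists_eq_prod {c : ℕ} (hG : (⊤ : Subgroup G).lowerCentralSeries c = ⊥) (f : A → G)
    {ι : Type} {S : ι → FreeMagma A} {Y : List (FreeMagma A)} (h : Elim c S Y) :
    ∀ g ∈ P.closure (Set.range fun i => commEval f (S i)), ∃ L : List (FreeMagma A × R),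
      L.map Prod.fst = Y ∧ g = (L.map fun q => P.pow (commEval f q.1) q.2).prod := by
  induction h with
  | done S hS =>
    refine fun g hg => ⟨[], rfl, ?_⟩
    have : P.closure (Set.range fun i => commEval f (S i)) ≤ ⊥ := by
      refine P.closure_le ?_ ?_
      · rintro _ ⟨i, rfl⟩
        simp [commEval_eq_one hG f (hS i)]
      · intro g hg r
        rw [Subgroup.mem_bot] at hg ⊢
        rw [hg, P.one_pow]
    simpa using this hg
  | step S i₀ h₀ Y hY ih =>
    intro g hg
    have hg' : g ∈ P.closure (insert (commEval f (S i₀))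
        (Set.range fun i : {i // i ≠ i₀} => commEval f (S i))) := by
      refine (P.closure_le ?_ (P.isClosed_closure _)) hg
      rintro _ ⟨i, rfl⟩
      refine P.subset_closure _ ?_
      by_cases hi : i = i₀
      · exact Or.inl (by rw [hi])
      · exact Or.inr ⟨⟨i, hi⟩, rfl⟩
    obtain ⟨r, h, hh, rfl⟩ := closure_elim_step P _ _ c (by
      rintro _ ⟨i, rfl⟩ k hk
      rw [← commEval_adIter]
      refine commEval_eq_one hG f ?_
      rw [length_adIter]
      have h1 := (S i₀).length_pos
      have h2 := Nat.le_mul_of_pos_right k h1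
      omega) hg'
    obtain ⟨L, hL, rfl⟩ := ih h (by
      refine (P.closure_le ?_ (P.isClosed_closure _)) hh
      rintro _ ⟨_, ⟨i, rfl⟩, k, hk, rfl⟩
      refine P.subset_closure _ ⟨(i, ⟨k, by omega⟩), ?_⟩
      exact commEval_adIter f _ _ _)
    exact ⟨(S i₀, r) :: L, by simp [hL], by simp⟩

end Elimination

/-! ### Linear independence of the eliminated commutators -/

section Independence

variable {A : Type v} (k : Type*) [CommRing k]

/-- The value of a formal commutator in the free associative algebra. -/
noncomputable def lieEval : FreeMagma A → FreeAlgebra k A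
  | .of a => FreeAlgebra.ι k a
  | .mul x y => lieEval x * lieEval y - lieEval y * lieEval x

/-- A formal commutator in the free Lie algebra on a family, at the index `(i, k)`. -/
noncomputable def adGen {ι : Type} (i₀ : ι) (i : ι) (l : ℕ) : FreeAlgebra k ι :=
  (fun t => FreeAlgebra.ι k i₀ * t - t * FreeAlgebra.ι k i₀)^[l] (FreeAlgebra.ι k i)

theorem adGen_succ {ι : Type} (i₀ : ι) (i : ι) (l : ℕ) : adGen k i₀ i (l + 1) =
    FreeAlgebra.ι k i₀ * adGen k i₀ i l - adGen k i₀ i l * FreeAlgebra.ι k i₀ :=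
  Function.iterate_succ_apply' _ _ _

/-- The substitution of the family obtained by elimination of the generator `i₀`. -/
noncomputable def elimHom (c : ℕ) {ι : Type} (i₀ : ι) :
    FreeAlgebra k ({i // i ≠ i₀} × Fin (c + 1)) →ₐ[k] FreeAlgebra k ι :=
  FreeAlgebra.lift k fun q => adGen k i₀ q.1 q.2

/-- The derivation `(i, l) ↦ (i, l + 1)` of the free algebra, bundled with the identity. -/
noncomputable def shiftHom (c : ℕ) (ι : Type) :
    FreeAlgebra k (ι × Fin (c + 1)) →ₐ[k] DualNumber (FreeAlgebra k (ι × Fin (c + 1))) :=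
  FreeAlgebra.lift k fun q => TrivSqZeroExt.inl (FreeAlgebra.ι k q) +
    -- The value `0` at the top index is arbitrary: only indices below `c` are ever shifted.
    TrivSqZeroExt.inr (if h : (q.2 : ℕ) + 1 < c + 1 then FreeAlgebra.ι k (q.1, ⟨q.2 + 1, h⟩) else 0)

theorem fst_shiftHom (c : ℕ) (ι : Type) (x) : (shiftHom k c ι x).fst = x := by
  have : (TrivSqZeroExt.fstHom k _ _).comp (shiftHom k c ι) = AlgHom.id k _ := by
    ext q
    simp only [shiftHom, AlgHom.comp_apply, Function.comp_apply, FreeAlgebra.lift_ι_apply]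
    simp [-DualNumber.inr_eq_smul_eps]
  exact DFunLike.congr_fun this x

/-- The derivation `(i, l) ↦ (i, l + 1)` of the free algebra. -/
noncomputable def shiftDer (c : ℕ) (ι : Type) :
    Module.End k (FreeAlgebra k (ι × Fin (c + 1))) :=
  (TrivSqZeroExt.sndHom _ _).restrictScalars k ∘ₗ (shiftHom k c ι).toLinearMap

theorem shiftDer_mul (c : ℕ) (ι : Type) (x y) :
    shiftDer k c ι (x * y) = x * shiftDer k c ι y + shiftDer k c ι x * y := by
  simp [shiftDer, TrivSqZeroExt.snd_mul, fst_shiftHom]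

theorem shiftDer_ι (c : ℕ) (ι : Type) (i : ι) (l : ℕ) (h : l + 1 < c + 1) :
    shiftDer k c ι (FreeAlgebra.ι k (i, ⟨l, by omega⟩)) = FreeAlgebra.ι k (i, ⟨l + 1, h⟩) := by
  simp only [shiftDer, shiftHom, LinearMap.comp_apply, AlgHom.toLinearMap_apply,
    FreeAlgebra.lift_ι_apply, LinearMap.restrictScalars_apply, TrivSqZeroExt.sndHom_apply]
  simp [h]

open Classical in
/-- The action of the free algebra in which `i₀` acts by the derivation and the other generators
act by multiplication. -/
noncomputable def elimRep (c : ℕ) {ι : Type} (i₀ : ι) : FreeAlgebra k ι →ₐ[k]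
    Module.End k (FreeAlgebra k ({i // i ≠ i₀} × Fin (c + 1))) :=
  FreeAlgebra.lift k fun i => if h : i = i₀ then shiftDer k c _ else
    Algebra.lmul k _ (FreeAlgebra.ι k (⟨i, h⟩, 0))

/-- For a derivation `D` and left multiplications `L`, `[D, L_u] = L_{D u}`. Each bracket with the
generator `i₀` therefore raises the index by one. -/
theorem elimRep_adGen (c : ℕ) {ι : Type} (i₀ : ι) (i : {i // i ≠ i₀}) (l : ℕ) (hl : l < c + 1) :
    elimRep k c i₀ (adGen k i₀ i l) = Algebra.lmul k _ (FreeAlgebra.ι k (i, ⟨l, hl⟩)) := by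
  induction l with
  | zero =>
    simp only [adGen, Function.iterate_zero, id_eq, elimRep, FreeAlgebra.lift_ι_apply]
    rw [dif_neg i.2]
    rfl
  | succ l ih =>
    rw [adGen_succ, map_sub, map_mul, map_mul, ih (by omega)]
    have h0 : elimRep k c i₀ (FreeAlgebra.ι k i₀) = shiftDer k c _ := by
      simp [elimRep]
    rw [h0]
    apply LinearMap.ext
    intro x
    change shiftDer k c _ (_ * x) - _ * shiftDer k c _ x = _ * x
    rw [shiftDer_mul, shiftDer_ι k c _ i l hl, add_sub_cancel_left]

/-- Followed by `elimRep` the map becomes the left regular representation, which is faithful. This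
is Lazard elimination: the iterated brackets generate a free subalgebra. -/
theorem elimHom_injective (c : ℕ) {ι : Type} (i₀ : ι) : Function.Injective (elimHom k c i₀) := by
  have h : (elimRep k c i₀).comp (elimHom k c i₀) = Algebra.lmul k _ := by
    ext1
    funext q
    simp only [Function.comp_apply, AlgHom.comp_apply, elimHom, FreeAlgebra.lift_ι_apply]
    exact elimRep_adGen k c i₀ q.1 q.2 q.2.2
  intro x y hxy
  have := congrArg (fun z => elimRep k c i₀ z 1) hxy
  simp only [← AlgHom.comp_apply, h] at this
  simpa using this

/-- The substitution of the values of a family of formal commutators. -/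
noncomputable def lieHom {ι : Type} (S : ι → FreeMagma A) : FreeAlgebra k ι →ₐ[k] FreeAlgebra k A :=
  FreeAlgebra.lift k fun i => lieEval k (S i)

theorem lieHom_adGen {ι : Type} (S : ι → FreeMagma A) (i₀ i : ι) (l : ℕ) :
    lieHom k S (adGen k i₀ i l) = lieEval k (adIter (S i₀) (S i) l) := by
  induction l with
  | zero => simp [lieHom, adGen, adIter_zero]
  | succ l ih =>
    rw [adGen_succ, map_sub, map_mul, map_mul, ih, adIter_succ]
    simp [lieHom, lieEval]

theorem lieHom_elimNext (c : ℕ) {ι : Type} (S : ι → FreeMagma A) (i₀ : ι) :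
    lieHom k (elimNext c S i₀) = (lieHom k S).comp (elimHom k c i₀) := by
  ext1
  funext q
  simp only [Function.comp_apply, AlgHom.comp_apply, elimHom, FreeAlgebra.lift_ι_apply,
    lieHom_adGen]
  simp [lieHom, elimNext]

/-- A character of the free algebra kills brackets, and `χ` kills the generators other than `i₀`; so
only the constant term survives. This separates `ι i₀` from the image of `elimHom`. -/
theorem algebraMapInv_elimHom (c : ℕ) {ι : Type} (i₀ : ι) [DecidableEq ι]
    (χ : ι → k) (hχ : ∀ i, i ≠ i₀ → χ i = 0) (x) :
    FreeAlgebra.lift k χ (elimHom k c i₀ x) = FreeAlgebra.algebraMapInv x := by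
  have : (FreeAlgebra.lift k χ).comp (elimHom k c i₀) = FreeAlgebra.algebraMapInv := by
    ext1
    funext q
    simp only [Function.comp_apply, AlgHom.comp_apply, elimHom, FreeAlgebra.lift_ι_apply]
    have (l : ℕ) : FreeAlgebra.lift k χ (adGen k i₀ q.1 l) = 0 := by
      cases l with
      | zero => simp [adGen, hχ _ q.1.2]
      | succ l =>
        rw [adGen_succ, map_sub, map_mul, map_mul, mul_comm, sub_self]
    rw [this]
    simp [FreeAlgebra.algebraMapInv]
  exact DFunLike.congr_fun this x

/-- The vanishing constant term is recorded because it is what the character with value `1` at `i₀`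
detects in the independence proof. -/
theorem Elim.exists_lieHom_eq {c : ℕ} {ι : Type} {S : ι → FreeMagma A} {Y : List (FreeMagma A)}
    (h : Elim c S Y) :
    ∀ t ∈ Y, ∃ z, lieHom k S z = lieEval k t ∧ FreeAlgebra.algebraMapInv z = 0 := by
  induction h with
  | done => simp
  | @step ι S i₀ h₀ Y hY ih =>
    intro t ht
    rcases List.mem_cons.1 ht with rfl | ht
    · exact ⟨FreeAlgebra.ι k i₀, by simp [lieHom], by simp [FreeAlgebra.algebraMapInv]⟩
    · obtain ⟨z, hz, hz0⟩ := ih t ht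
      classical
      refine ⟨elimHom k c i₀ z, by rw [← hz, lieHom_elimNext]; rfl, ?_⟩
      rw [FreeAlgebra.algebraMapInv, algebraMapInv_elimHom k c i₀ _ (by simp), hz0]

/-- Linear independence over an arbitrary commutative ring. By injectivity a relation reads `r • ι
i₀ + elimHom z = 0` with `z` of constant term zero. The character with value `1` at `i₀` gives `r =
0`, and the rest is a relation for the next family, whose substitution is still injective. -/
theorem Elim.eq_zero_of_sum_eq_zero {c : ℕ} {ι : Type} {S : ι → FreeMagma A}
    {Y : List (FreeMagma A)} (h : Elim c S Y) (hS : Function.Injective (lieHom k S)) :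
    ∀ L : List (FreeMagma A × k), L.map Prod.fst = Y →
      (L.map fun q => q.2 • lieEval k q.1).sum = 0 → ∀ q ∈ L, q.2 = 0 := by
  induction h with
  | done =>
    intro L hL _
    rw [List.map_eq_nil_iff] at hL
    simp [hL]
  | @step ι S i₀ h₀ Y hY ih =>
    intro L hL hsum
    obtain ⟨⟨t, r⟩, L, rfl, rfl, hL'⟩ := List.map_eq_cons_iff.1 hL
    have hZ : ∀ L : List (FreeMagma A × k), (∀ q ∈ L, q.1 ∈ Y) →
        ∃ z, lieHom k (elimNext c S i₀) z = (L.map fun q => q.2 • lieEval k q.1).sum ∧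
          FreeAlgebra.algebraMapInv z = 0 := by
      intro L hL
      induction L with
      | nil => exact ⟨0, by simp, by simp⟩
      | cons q L ihL =>
        obtain ⟨z, hz, hz0⟩ := ihL fun q hq => hL q (List.mem_cons_of_mem _ hq)
        obtain ⟨z', hz', hz0'⟩ := hY.exists_lieHom_eq k q.1 (hL q List.mem_cons_self)
        exact ⟨q.2 • z' + z, by simp [hz, hz'], by simp [hz0, hz0']⟩
    obtain ⟨z, hz, hz0⟩ := hZ L fun q hq => hL' ▸ List.mem_map_of_mem hq
    have h1 : lieHom k S (r • FreeAlgebra.ι k i₀ + elimHom k c i₀ z) = 0 := by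
      rw [map_add, map_smul, ← AlgHom.comp_apply, ← lieHom_elimNext, hz]
      simpa [lieHom] using hsum
    have h2 := hS (h1.trans (map_zero _).symm)
    classical
    have hr : r = 0 := by
      have := congrArg (FreeAlgebra.lift k fun i => if i = i₀ then (1 : k) else 0) h2
      rw [map_add, algebraMapInv_elimHom k c i₀ _ (by simp +contextual), hz0] at this
      simpa using this
    intro q hq
    rcases List.mem_cons.1 hq with rfl | hq
    · exact hr
    · refine ih ?_ L hL' ?_ q hq
      · rw [lieHom_elimNext]
        exact hS.comp (elimHom_injective k c i₀)
      · simpa [hr] using hsum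

theorem lieHom_of_injective (A : Type) :
    Function.Injective (lieHom k (FreeMagma.of : A → FreeMagma A)) := by
  have : lieHom k (FreeMagma.of : A → FreeMagma A) = AlgHom.id k _ := by
    ext a
    simp [lieHom, lieEval]
  rw [this]
  exact Function.injective_id

end Independence

/-! ### The Magnus embedding -/

section Magnus

open PowerSeries

/-! ### The filtration of the units of `T⟦X⟧` by powers of `X`. -/

section Filtration

variable {T : Type*} [Ring T]

/-- The units of a ring of power series that are congruent to `1` modulo `X ^ d`. -/
def congrUnits (T : Type*) [Ring T] (d : ℕ) : Subgroup T⟦X⟧ˣ where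
  carrier := {a | X ^ d ∣ (a : T⟦X⟧) - 1}
  one_mem' := by simp
  mul_mem' {a b} ha hb := by
    have e : ((a * b : T⟦X⟧ˣ) : T⟦X⟧) - 1 = (a - 1) * b + (b - 1) := by
      rw [Units.val_mul]
      noncomm_ring
    simp only [Set.mem_ofPred_eq] at ha hb ⊢
    rw [e]
    exact dvd_add (ha.mul_right _) hb
  inv_mem' {a} ha := by
    have e : ((a⁻¹ : T⟦X⟧ˣ) : T⟦X⟧) - 1 = (a - 1) * (-(a⁻¹ : T⟦X⟧ˣ)) := by
      rw [sub_mul, mul_neg, Units.mul_inv]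
      noncomm_ring
    simp only [Set.mem_ofPred_eq] at ha ⊢
    rw [e]
    exact ha.mul_right _

theorem mem_congrUnits {d : ℕ} {a : T⟦X⟧ˣ} : a ∈ congrUnits T d ↔ X ^ d ∣ (a : T⟦X⟧) - 1 := Iff.rfl

theorem mem_congrUnits_iff_coeff {d : ℕ} {a : T⟦X⟧ˣ} :
    a ∈ congrUnits T d ↔ ∀ i < d, coeff i ((a : T⟦X⟧) - 1) = 0 := X_pow_dvd_iff

theorem congrUnits_antitone : Antitone (congrUnits T) := fun _ _ h _ ha =>
  (pow_dvd_pow X h).trans ha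

/-- The coefficient of `X ^ d` in a unit congruent to `1` modulo `X ^ d`. -/
noncomputable def lead (d : ℕ) (a : T⟦X⟧ˣ) : T := coeff d ((a : T⟦X⟧) - 1)

theorem mem_congrUnits_succ {d : ℕ} {a : T⟦X⟧ˣ} :
    a ∈ congrUnits T (d + 1) ↔ a ∈ congrUnits T d ∧ lead d a = 0 := by
  simp only [mem_congrUnits_iff_coeff, lead]
  exact Nat.forall_lt_succ_right

theorem lead_eq_zero {d e : ℕ} (h : d < e) {a : T⟦X⟧ˣ} (ha : a ∈ congrUnits T e) : lead d a = 0 :=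
  mem_congrUnits_iff_coeff.1 ha d h

theorem lead_one (d : ℕ) : lead d (1 : T⟦X⟧ˣ) = 0 := by simp [lead]

theorem lead_mul {d : ℕ} (hd : 0 < d) {a b : T⟦X⟧ˣ} (ha : a ∈ congrUnits T d)
    (hb : b ∈ congrUnits T d) : lead d (a * b) = lead d a + lead d b := by
  obtain ⟨u, hu⟩ := ha
  obtain ⟨v, hv⟩ := hb
  have e : ((a * b : T⟦X⟧ˣ) : T⟦X⟧) - 1 = ((a : T⟦X⟧) - 1) + ((b : T⟦X⟧) - 1) + X ^ (d + d) * (u * v) := by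
    have : X ^ (d + d) * (u * v) = ((a : T⟦X⟧) - 1) * ((b : T⟦X⟧) - 1) := by
      rw [hu, hv, pow_add, mul_assoc, mul_assoc, ← mul_assoc u, ← X_pow_mul (φ := u), mul_assoc]
    rw [this, Units.val_mul]
    noncomm_ring
  have h0 : coeff d (X ^ (d + d) * (u * v)) = 0 := by
    rw [coeff_X_pow_mul', if_neg (by omega)]
  rw [lead, e, map_add, map_add, h0, add_zero, lead, lead]

theorem lead_pow {d : ℕ} (hd : 0 < d) {a : T⟦X⟧ˣ} (ha : a ∈ congrUnits T d) (n : ℕ) :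
    lead d (a ^ n) = n • lead d a := by
  induction n with
  | zero => simp [lead_one]
  | succ n ih => rw [pow_succ, lead_mul hd (pow_mem ha n) ha, ih, succ_nsmul]

theorem lead_zpow {d : ℕ} (hd : 0 < d) {a : T⟦X⟧ˣ} (ha : a ∈ congrUnits T d) (n : ℤ) :
    lead d (a ^ n) = n • lead d a := by
  have h := lead_mul hd (zpow_mem ha n) (zpow_mem ha (-n))
  cases n with
  | ofNat n => simpa using lead_pow hd ha n
  | negSucc n =>
    rw [← zpow_add, add_neg_cancel, zpow_zero, lead_one, Int.neg_negSucc,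
      zpow_natCast, lead_pow hd ha] at h
    rw [eq_neg_of_add_eq_zero_left h.symm, Int.negSucc_eq, neg_smul, ← Nat.cast_succ,
      natCast_zsmul]

theorem commutator_sub_one (a b : T⟦X⟧ˣ) :
    ((⁅a, b⁆ : T⟦X⟧ˣ) : T⟦X⟧) - 1 =
      ((a : T⟦X⟧) * b - b * a) * (((a⁻¹ : T⟦X⟧ˣ) : T⟦X⟧) * ((b⁻¹ : T⟦X⟧ˣ) : T⟦X⟧)) := by
  have h1 : ((b : T⟦X⟧) * a) * ((a⁻¹ : T⟦X⟧ˣ) * (b⁻¹ : T⟦X⟧ˣ)) = 1 := by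
    rw [← Units.val_mul, ← Units.val_mul, ← Units.val_mul]
    simp
  rw [sub_mul, h1, commutatorElement_def]
  simp [mul_assoc]

/-- Replacing `a`, `b` by `a - 1`, `b - 1` does not change `ab - ba`, and `X` is central. -/
theorem commutator_sub_one' {i j : ℕ} {a b : T⟦X⟧ˣ} {u v : T⟦X⟧} (hu : (a : T⟦X⟧) - 1 = X ^ i * u)
    (hv : (b : T⟦X⟧) - 1 = X ^ j * v) :
    ((⁅a, b⁆ : T⟦X⟧ˣ) : T⟦X⟧) - 1 =
      X ^ (i + j) * ((u * v - v * u) * (((a⁻¹ : T⟦X⟧ˣ) : T⟦X⟧) * ((b⁻¹ : T⟦X⟧ˣ) : T⟦X⟧))) := by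
  have e : (a : T⟦X⟧) * b - b * a = 
      (a - 1 : T⟦X⟧) * (b - 1 : T⟦X⟧) - (b - 1 : T⟦X⟧) * (a - 1 : T⟦X⟧) := by
    noncomm_ring
  have e1 : X ^ i * u * (X ^ j * v) = X ^ (i + j) * (u * v) := by
    rw [pow_add, mul_assoc, mul_assoc, ← mul_assoc u, ← X_pow_mul (φ := u), mul_assoc]
  have e2 : X ^ j * v * (X ^ i * u) = X ^ (i + j) * (v * u) := by
    rw [add_comm i j, pow_add, mul_assoc, mul_assoc, ← mul_assoc v, ← X_pow_mul (φ := v), mul_assoc]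
  rw [commutator_sub_one, e, hu, hv, e1, e2, ← mul_sub, mul_assoc]

theorem commutator_mem_congrUnits {i j : ℕ} {a b : T⟦X⟧ˣ} (ha : a ∈ congrUnits T i)
    (hb : b ∈ congrUnits T j) : ⁅a, b⁆ ∈ congrUnits T (i + j) := by
  obtain ⟨u, hu⟩ := ha
  obtain ⟨v, hv⟩ := hb
  exact ⟨_, commutator_sub_one' hu hv⟩

theorem constantCoeff_eq_one {i : ℕ} (hi : 0 < i) {a : T⟦X⟧ˣ} (ha : a ∈ congrUnits T i) :
    constantCoeff (a : T⟦X⟧) = 1 := by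
  have := lead_eq_zero hi ha
  rw [lead, map_sub, coeff_zero_eq_constantCoeff_apply, coeff_zero_eq_constantCoeff_apply,
    map_one] at this
  exact sub_eq_zero.1 this

/-- The factor `a⁻¹ b⁻¹` has constant term `1`, so it does not affect the leading coefficient. -/
theorem lead_commutator {i j : ℕ} (hi : 0 < i) (hj : 0 < j) {a b : T⟦X⟧ˣ}
    (ha : a ∈ congrUnits T i) (hb : b ∈ congrUnits T j) :
    lead (i + j) ⁅a, b⁆ = lead i a * lead j b - lead j b * lead i a := by
  have ha' := constantCoeff_eq_one hi (inv_mem ha)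
  have hb' := constantCoeff_eq_one hj (inv_mem hb)
  obtain ⟨u, hu⟩ := ha
  obtain ⟨v, hv⟩ := hb
  have h (n : ℕ) (w : T⟦X⟧) : coeff n (X ^ n * w) = constantCoeff w := by
    rw [coeff_X_pow_mul', if_pos le_rfl, Nat.sub_self, coeff_zero_eq_constantCoeff_apply]
  rw [lead, lead, lead, commutator_sub_one' hu hv, hu, hv, h, h, h]
  simp only [map_mul, map_sub, ha', hb', mul_one]

theorem lowerCentralSeries_le_comap_congrUnits {G : Type*} [Group G] (f : G →* T⟦X⟧ˣ)
    (hf : ∀ g, f g ∈ congrUnits T 1) (c : ℕ) :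
    (⊤ : Subgroup G).lowerCentralSeries c ≤ (congrUnits T (c + 1)).comap f := by
  induction c with
  | zero => exact fun g _ => hf g
  | succ c ih =>
    rw [Subgroup.lowerCentralSeries_succ, Subgroup.commutator_le]
    intro g hg g' _
    rw [Subgroup.mem_comap, map_commutatorElement]
    exact commutator_mem_congrUnits (ih hg) (hf g')

/-- The unit `1 + a X`. -/
noncomputable def oneAddUnit (a : T) : T⟦X⟧ˣ where
  val := 1 + X * C a
  inv := mk fun n => (-a) ^ n
  val_inv := by
    ext n
    cases n with
    | zero => simp [add_mul, mul_assoc]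
    | succ n => simp [add_mul, mul_assoc, coeff_succ_X_mul, pow_succ', coeff_one]
  inv_val := by
    ext n
    have h : (mk fun n => (-a) ^ n) * (1 + X * C a) =
      (mk fun n => (-a) ^ n) + X * ((mk fun n => (-a) ^ n) * C a) := by
      rw [mul_add, mul_one, ← mul_assoc, ← X_mul, mul_assoc]
    rw [h]
    cases n with
    | zero => simp
    | succ n => simp [coeff_succ_X_mul, pow_succ, coeff_one]

theorem oneAddUnit_mem (a : T) : oneAddUnit a ∈ congrUnits T 1 := ⟨C a, by simp [oneAddUnit]⟩

theorem lead_oneAddUnit (a : T) : lead 1 (oneAddUnit a) = a := by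
  simp [lead, oneAddUnit]

end Filtration

/-! ### The Magnus homomorphism. -/

variable {A : Type v} (k : Type*) [CommRing k]

/-- The Magnus homomorphism `a ↦ 1 + a X`. -/
noncomputable def magnus : FreeGroup A →* (FreeAlgebra k A)⟦X⟧ˣ :=
  FreeGroup.lift fun a => oneAddUnit (FreeAlgebra.ι k a)

theorem FreeGroup.map_mem {G : Type*} [Group G] (f : FreeGroup A →* G) (K : Subgroup G)
    (h : ∀ a, f (FreeGroup.of a) ∈ K) (g : FreeGroup A) : f g ∈ K := by
  have : (⊤ : Subgroup (FreeGroup A)) ≤ K.comap f := by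
    rw [← FreeGroup.closure_range_of, Subgroup.closure_le]
    rintro _ ⟨a, rfl⟩
    exact h a
  exact this (Subgroup.mem_top g)

theorem magnus_mem (g : FreeGroup A) : magnus k g ∈ congrUnits _ 1 :=
  FreeGroup.map_mem _ _ (fun a => by simpa [magnus] using oneAddUnit_mem _) g

theorem magnus_commEval (t : FreeMagma A) :
    magnus k (commEval FreeGroup.of t) ∈ congrUnits _ t.length ∧
      lead t.length (magnus k (commEval FreeGroup.of t)) = lieEval k t := by
  induction t with
  | ih1 a =>
    refine ⟨magnus_mem k _, ?_⟩
    change lead 1 (magnus k (FreeGroup.of a)) = FreeAlgebra.ι k a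
    simp [magnus, lead_oneAddUnit]
  | ih2 x y hx hy =>
    change magnus k ⁅_, _⁆ ∈ congrUnits _ (x.length + y.length) ∧
      lead (x.length + y.length) (magnus k ⁅_, _⁆) = _
    rw [map_commutatorElement]
    refine ⟨commutator_mem_congrUnits hx.1 hy.1, ?_⟩
    rw [lead_commutator x.length_pos y.length_pos hx.1 hy.1, hx.2, hy.2]
    rfl

/-- Leading coefficients in degree `w` add up: factors of smaller weight are trivial by hypothesis,
and factors of larger weight are invisible in this degree. -/
theorem magnus_prod_zpow (w : ℕ) (hw : 0 < w) (L : List (FreeMagma A × ℤ))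
    (hL : ∀ q ∈ L, q.1.length < w → q.2 = 0) :
    magnus k (L.map fun q => commEval FreeGroup.of q.1 ^ q.2).prod ∈ congrUnits _ w ∧
      lead w (magnus k (L.map fun q => commEval FreeGroup.of q.1 ^ q.2).prod) =
        (L.map fun q => (if q.1.length = w then (q.2 : k) else 0) • lieEval k q.1).sum := by
  induction L with
  | nil => simp [lead_one]
  | cons q L ih =>
    have ih' := ih fun q hq => hL q (List.mem_cons_of_mem _ hq)
    have hq := magnus_commEval k q.1
    have hq1 : magnus k (commEval FreeGroup.of q.1 ^ q.2) ∈ congrUnits _ w ∧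
        lead w (magnus k (commEval FreeGroup.of q.1 ^ q.2)) =
          (if q.1.length = w then (q.2 : k) else 0) • lieEval k q.1 := by
      rw [map_zpow]
      rcases lt_trichotomy q.1.length w with h | h | h
      · rw [hL q List.mem_cons_self h]
        simp [lead_one]
      · subst h
        refine ⟨zpow_mem hq.1 _, ?_⟩
        rw [lead_zpow hw hq.1, hq.2, if_pos rfl, Int.cast_smul_eq_zsmul]
      · have h1 := zpow_mem hq.1 q.2
        refine ⟨congrUnits_antitone h.le h1, ?_⟩
        rw [lead_eq_zero h h1, if_neg h.ne', zero_smul]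
    simp only [List.map_cons, List.prod_cons, List.sum_cons, map_mul]
    exact ⟨mul_mem hq1.1 ih'.1, by rw [lead_mul hw hq1.1 ih'.1, hq1.2, ih'.2]⟩

/-- A product of powers of the eliminated commutators with a nonzero exponent, of minimal weight, is
not congruent to `1` under the Magnus homomorphism. -/
theorem Elim.magnus_notMem {A : Type} {c : ℕ} {Y : List (FreeMagma A)}
    (hY : Elim c (FreeMagma.of : A → FreeMagma A) Y) (L : List (FreeMagma A × ℤ))
    (hL : L.map Prod.fst = Y) (q : FreeMagma A × ℤ) (hq : q ∈ L) (hq0 : (q.2 : k) ≠ 0)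
    (hmin : ∀ q' ∈ L, q'.1.length < q.1.length → q'.2 = 0) :
    magnus k (L.map fun q => commEval FreeGroup.of q.1 ^ q.2).prod ∉ congrUnits _ (c + 1) := by
  intro h
  have hqc : q.1.length < c + 1 :=
    Nat.lt_succ_of_le (hY.length_le _ (hL ▸ List.mem_map_of_mem hq))
  have h0 := lead_eq_zero hqc h
  rw [(magnus_prod_zpow k _ q.1.length_pos L hmin).2] at h0
  have := hY.eq_zero_of_sum_eq_zero k (lieHom_of_injective k A)
    (L.map fun q' => (q'.1, if q'.1.length = q.1.length then (q'.2 : k) else 0))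
    (by rw [List.map_map]; exact hL) (by rw [List.map_map]; exact h0) _ (List.mem_map_of_mem hq)
  simp only [if_true] at this
  exact hq0 this

/-- Magnus's theorem: the dimension subgroups of a free group are the terms of its lower central
series. -/
theorem mem_lowerCentralSeries_of_magnus_mem {A : Type} [Finite A] (c : ℕ) (g : FreeGroup A)
    (hg : magnus ℤ g ∈ congrUnits _ (c + 1)) :
    g ∈ (⊤ : Subgroup (FreeGroup A)).lowerCentralSeries c := by
  obtain ⟨Y, hY⟩ := exists_elim c (FreeMagma.of : A → FreeMagma A)
  let N := (⊤ : Subgroup (FreeGroup A)).lowerCentralSeries c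
  let π := QuotientGroup.mk' N
  have hπ : (⊤ : Subgroup (FreeGroup A ⧸ N)).lowerCentralSeries c = ⊥ := by
    rw [← Subgroup.map_top_of_surjective π (QuotientGroup.mk'_surjective N),
      ← Subgroup.map_lowerCentralSeries, Subgroup.map_eq_bot_iff, QuotientGroup.ker_mk']
  have hcl : π g ∈ (PowStr.int (FreeGroup A ⧸ N)).closure
      (Set.range fun a => commEval (fun a => π (FreeGroup.of a)) (FreeMagma.of a)) :=
    FreeGroup.map_mem π _ (fun a => PowStr.subset_closure _ _ (Set.mem_range_self a)) g
  obtain ⟨L, hL, hgL⟩ := hY.exists_eq_prod _ hπ (fun a => π (FreeGroup.of a)) _ hcl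
  -- The elimination takes place in the nilpotent quotient; the exponents are integers, so the
  -- product lifts to the free group and changes `g` only by an element of `N`.
  set g' := (L.map fun q => commEval FreeGroup.of q.1 ^ q.2).prod with hg'
  have hgg' : π g = π g' := by
    rw [hgL, hg', map_list_prod, List.map_map]
    congr 1
    refine List.map_congr_left fun q _ => ?_
    simp only [Function.comp_apply, map_zpow, map_commEval]
    rfl
  have hmem : g⁻¹ * g' ∈ N := QuotientGroup.eq.1 hgg'
  have hg'm : magnus ℤ g' ∈ congrUnits _ (c + 1) := by
    have := lowerCentralSeries_le_comap_congrUnits (magnus ℤ) (magnus_mem ℤ) c hmem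
    rw [Subgroup.mem_comap, map_mul, map_inv] at this
    exact (Subgroup.mul_mem_cancel_left _ (inv_mem hg)).1 this
  -- A nonzero exponent of least weight would show up in the Magnus image, so all exponents vanish
  -- weight by weight.
  have hzero : ∀ w, ∀ q ∈ L, q.1.length < w → q.2 = 0 := by
    intro w
    induction w with
    | zero => simp
    | succ w ih =>
      intro q hq hqw
      by_contra h
      have hqw' : q.1.length = w := by
        by_contra h'
        exact h (ih q hq (by omega))
      exact hY.magnus_notMem ℤ L hL q hq (by simpa using h)
        (fun q' hq' h' => ih q' hq' (by omega)) hg'm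
  have hg'1 : g' = 1 := by
    rw [hg', List.prod_eq_one]
    simp only [List.mem_map]
    rintro _ ⟨q, hq, rfl⟩
    rw [hzero _ q hq (Nat.lt_succ_self _), zpow_zero]
  rw [hg'1, mul_one, inv_mem_iff] at hmem
  exact hmem

end Magnus

/-! ### The Hall–Petresco theorem -/

section Petresco

open PowerSeries

theorem List.prod_map_range_add {M : Type*} [Monoid M] (f : ℕ → M) (a b : ℕ)
    (h : ∀ k, a ≤ k → f k = 1) :
    ((List.range (a + b)).map f).prod = ((List.range a).map f).prod := by
  rw [List.range_add, List.map_append, List.prod_append, List.map_map,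
    List.prod_eq_one (l := List.map _ (List.range b)), mul_one]
  simp only [List.mem_map]
  rintro _ ⟨k, -, rfl⟩
  exact h _ (Nat.le_add_right a k)

theorem petresco_eq {G : Type*} [Group G] (l : List G) (i : ℕ) :
    petresco l i = (((List.range i).map fun k => petresco l k ^ i.choose k).prod)⁻¹ *
      (l.map fun a => a ^ i).prod := by
  rw [petresco, ← List.map_coe_finRange_eq_range, List.map_map]
  rfl

theorem prod_pow_eq {G : Type*} [Group G] (l : List G) (i : ℕ) :
    (l.map fun a => a ^ i).prod =
      ((List.range (i + 1)).map fun k => petresco l k ^ i.choose k).prod := by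
  rw [List.range_succ, List.map_append, List.prod_append, List.map_singleton, List.prod_singleton,
    Nat.choose_self, pow_one, petresco_eq l i]
  group

theorem petresco_zero {G : Type*} [Group G] (l : List G) : petresco l 0 = 1 := by
  rw [petresco_eq]
  simp

theorem petresco_one {G : Type*} [Group G] (l : List G) : petresco l 1 = l.prod := by
  rw [petresco_eq]
  simp [petresco_zero]

theorem map_petresco {G H : Type*} [Group G] [Group H] (f : G →* H) (l : List G) (i : ℕ) :
    f (petresco l i) = petresco (l.map f) i := by
  induction i using Nat.strong_induction_on with
  | _ i ih =>
    rw [petresco_eq, petresco_eq, map_mul, map_inv, map_list_prod, map_list_prod, List.map_map,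
      List.map_map, List.map_map]
    congr 3
    · refine List.map_congr_left fun k hk => ?_
      simp [ih k (List.mem_range.1 hk)]
    · funext a
      simp

theorem petresco_commute {G : Type*} [Group G] {a b : G} (h : Commute a b) (i : ℕ) :
    petresco [a, b] (i + 2) = 1 := by
  induction i using Nat.strong_induction_on with
  | _ i ih =>
    rw [petresco_eq, inv_mul_eq_one, List.range_succ_eq_map, List.map_cons, List.prod_cons,
      List.map_map, List.range_succ_eq_map, List.map_cons, List.prod_cons, List.map_map,
      List.prod_eq_one (l := List.map _ (List.range i))]
    · simp [petresco_zero, petresco_one, h.mul_pow]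
    · simp only [List.mem_map, List.mem_range]
      rintro _ ⟨k, hk, rfl⟩
      simp [ih k hk]

/-! ### Sequences that are polynomial in the exponent. -/

/-- A sequence whose `d`-th iterated difference vanishes. -/
def PolyLT {T : Type*} [AddGroup T] : ℕ → (ℕ → T) → Prop
  | 0, f => f = 0
  | d + 1, f => PolyLT d fun n => f (n + 1) - f n

namespace PolyLT

variable {T : Type*} [Ring T]

theorem zero (d : ℕ) : PolyLT d (0 : ℕ → T) := by
  induction d with
  | zero => rfl
  | succ d ih =>
    rw [PolyLT]
    simpa using! ih

theorem const (d : ℕ) (a : T) : PolyLT (d + 1) fun _ => a := by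
  rw [PolyLT]
  simpa using! zero d

theorem mono {d e : ℕ} (h : d ≤ e) {f : ℕ → T} (hf : PolyLT d f) : PolyLT e f := by
  induction e generalizing d f with
  | zero =>
    rw [Nat.le_zero] at h
    rwa [h] at hf
  | succ e ih =>
    cases d with
    | zero =>
      rw [PolyLT] at hf
      rw [hf]
      exact zero _
    | succ d => exact ih (Nat.le_of_succ_le_succ h) hf

theorem add {d : ℕ} {f g : ℕ → T} (hf : PolyLT d f) (hg : PolyLT d g) : PolyLT d (f + g) := by
  induction d generalizing f g with
  | zero =>
    rw [PolyLT] at hf hg ⊢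
    rw [hf, hg, add_zero]
  | succ d ih =>
    rw [PolyLT] at hf hg ⊢
    have e : (fun n => (f + g) (n + 1) - (f + g) n) =
        (fun n => f (n + 1) - f n) + fun n => g (n + 1) - g n := by
      funext n
      simp only [Pi.add_apply]
      abel
    rw [e]
    exact ih hf hg

theorem neg {d : ℕ} {f : ℕ → T} (hf : PolyLT d f) : PolyLT d (-f) := by
  induction d generalizing f with
  | zero =>
    rw [PolyLT] at hf ⊢
    rw [hf, neg_zero]
  | succ d ih =>
    rw [PolyLT] at hf ⊢
    have e : (fun n => (-f) (n + 1) - (-f) n) = -fun n => f (n + 1) - f n := by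
      funext n
      simp only [Pi.neg_apply]
      abel
    rw [e]
    exact ih hf

theorem sum {ι : Type*} (s : Finset ι) {d : ℕ} {f : ι → ℕ → T} (hf : ∀ i ∈ s, PolyLT d (f i)) :
    PolyLT d fun n => ∑ i ∈ s, f i n := by
  classical
  induction s using Finset.induction_on with
  | empty => simpa using! zero d
  | insert i s hi ih =>
    simp only [Finset.sum_insert hi]
    exact add (hf i (Finset.mem_insert_self _ _))
      (ih fun j hj => hf j (Finset.mem_insert_of_mem hj))

theorem shift {d : ℕ} {f : ℕ → T} (hf : PolyLT d f) : PolyLT d fun n => f (n + 1) := by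
  induction d generalizing f with
  | zero =>
    rw [PolyLT] at hf ⊢
    rw [hf]
    rfl
  | succ d ih => exact ih hf

/-- The discrete Leibniz rule. `PolyLT d` means degree less than `d`, whence the bound `a + b - 1`;
its truncation is harmless, as a factor with bound `0` is zero. -/
theorem mul_aux (N : ℕ) : ∀ {a b : ℕ}, a + b = N → ∀ {f g : ℕ → T}, PolyLT a f → PolyLT b g →
    PolyLT (a + b - 1) fun n => f n * g n := by
  induction N using Nat.strong_induction_on with
  | _ N ih =>
    intro a b hN f g hf hg
    cases a with
    | zero =>
      rw [PolyLT] at hf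
      simpa [hf] using! zero _
    | succ a =>
      cases b with
      | zero =>
        rw [PolyLT] at hg
        simpa [hg] using! zero _
      | succ b =>
        have e : (fun n => f (n + 1) * g (n + 1) - f n * g n) =
            (fun n => (f (n + 1) - f n) * g (n + 1)) + fun n => f n * (g (n + 1) - g n) := by
          funext n
          simp only [Pi.add_apply]
          noncomm_ring
        rw [show a + 1 + (b + 1) - 1 = a + b + 1 by omega, PolyLT, e]
        refine add ?_ ?_
        · exact ih (a + (b + 1)) (by omega) rfl (f := fun n => f (n + 1) - f n) hf hg.shift
        · have := ih (a + 1 + b) (by omega) rfl (g := fun n => g (n + 1) - g n) hf hg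
          rwa [show a + 1 + b - 1 = a + b by omega] at this

theorem mul {a b : ℕ} {f g : ℕ → T} (hf : PolyLT a f) (hg : PolyLT b g) :
    PolyLT (a + b - 1) fun n => f n * g n := mul_aux _ rfl hf hg

theorem eq_zero {d : ℕ} {f : ℕ → T} (hf : PolyLT d f) (h : ∀ n < d, f n = 0) : f = 0 := by
  induction d generalizing f with
  | zero => exact hf
  | succ d ih =>
    have h1 := ih (f := fun n => f (n + 1) - f n) hf fun n hn => by
      simp [h n (by omega), h (n + 1) (by omega)]
    funext n
    induction n with
    | zero => exact h 0 (by omega)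
    | succ n ihn => exact (sub_eq_zero.1 (congrFun h1 n)).trans ihn

end PolyLT

section

variable {T : Type*} [Ring T]

/-- Sequences of power series whose `d`-th coefficients are polynomial of degree at most `d`. -/
def PolySeq (f : ℕ → T⟦X⟧) : Prop := ∀ d, PolyLT (d + 1) fun n => coeff d (f n)

theorem PolySeq.one : PolySeq fun _ => (1 : T⟦X⟧) := fun d => PolyLT.const d _

theorem PolySeq.mul {f g : ℕ → T⟦X⟧} (hf : PolySeq f) (hg : PolySeq g) :
    PolySeq fun n => f n * g n := by
  intro d
  simp only [coeff_mul]
  refine PolyLT.sum _ fun q hq => ?_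
  have := (hf q.1).mul (hg q.2)
  rw [Finset.HasAntidiagonal.mem_antidiagonal] at hq
  exact this.mono (by omega)

theorem PolySeq.list_prod {ι : Type*} (l : List ι) (f : ι → ℕ → T⟦X⟧)
    (hf : ∀ i ∈ l, PolySeq (f i)) : PolySeq fun n => (l.map fun i => f i n).prod := by
  induction l with
  | nil => simpa using PolySeq.one
  | cons i l ih =>
    simp only [List.map_cons, List.prod_cons]
    exact (hf i List.mem_cons_self).mul (ih fun j hj => hf j (List.mem_cons_of_mem _ hj))

/-- By Pascal's rule the difference in `n` of `a ^ (n choose (i+1))` is `a ^ (n choose (i+1)) * (a ^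
(n choose i) - 1)`, which is controlled by the case of `i` and by lower coefficients. A truncated
bound of `0` says that the coefficient vanishes for all `n`. -/
theorem polyLT_coeff_pow_choose {j : ℕ} {a : T⟦X⟧ˣ} (ha : a ∈ congrUnits T j) {i : ℕ} (hij : i ≤ j)
    (d : ℕ) : PolyLT (d + 1 - (j - i)) fun n => coeff d ((a : T⟦X⟧) ^ n.choose i - 1) := by
  induction i generalizing d with
  | zero =>
    simp only [Nat.choose_zero_right, pow_one, Nat.sub_zero]
    rcases lt_or_ge d j with h | h
    · have := mem_congrUnits_iff_coeff.1 ha d h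
      simp only [this]
      exact PolyLT.zero _
    · rw [show d + 1 - j = d - j + 1 by omega]
      exact PolyLT.const _ _
  | succ i ih =>
    induction d using Nat.strong_induction_on with
    | _ d ihd =>
      have hd : (fun n => coeff d ((a : T⟦X⟧) ^ (n + 1).choose (i + 1) - 1) -
          coeff d ((a : T⟦X⟧) ^ n.choose (i + 1) - 1)) = fun n =>
          ∑ q ∈ Finset.HasAntidiagonal.antidiagonal d, coeff q.1 ((a : T⟦X⟧) ^ n.choose (i + 1)) *
            coeff q.2 ((a : T⟦X⟧) ^ n.choose i - 1) := by
        funext n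
        rw [← coeff_mul, ← map_sub, Nat.choose_succ_succ, add_comm, pow_add]
        congr 1
        noncomm_ring
      have hpoly : PolyLT (d + 1 - (j - i)) (fun n =>
          coeff d ((a : T⟦X⟧) ^ (n + 1).choose (i + 1) - 1) -
          coeff d ((a : T⟦X⟧) ^ n.choose (i + 1) - 1)) := by
        rw [hd]
        refine PolyLT.sum _ fun q hq => ?_
        rw [Finset.HasAntidiagonal.mem_antidiagonal] at hq
        have h2 := ih (by omega) q.2
        -- The term with `q.2 = 0` vanishes, so only `q.1 < d` occurs and the induction on `d`
        -- applies.
        rcases Nat.eq_zero_or_pos q.2 with h0 | h0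
        · rw [h0, show 0 + 1 - (j - i) = 0 by omega] at h2
          simp only [h0, congrFun (show _ = (0 : ℕ → T) from h2)]
          simpa using! PolyLT.zero _
        · have h1 : PolyLT (q.1 + 1) fun n : ℕ => coeff q.1 ((a : T⟦X⟧) ^ n.choose (i + 1)) := by
            have h3 := ((ihd q.1 (by omega)).mono (show _ ≤ q.1 + 1 by omega)).add
              (PolyLT.const q.1 (coeff q.1 (1 : T⟦X⟧)))
            have e : ((fun n : ℕ => coeff q.1 ((a : T⟦X⟧) ^ n.choose (i + 1) - 1)) +
              fun _ => coeff q.1 (1 : T⟦X⟧)) = fun n : ℕ => coeff q.1 ((a : T⟦X⟧) ^ n.choose (i + 1)) := by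
              funext n
              simp
            rwa [e] at h3
          have := h1.mul h2
          rcases Nat.eq_zero_or_pos (q.2 + 1 - (j - i)) with h4 | h4
          · rw [h4] at h2
            simp only [congrFun (show _ = (0 : ℕ → T) from h2)]
            simpa using! PolyLT.zero _
          · exact this.mono (by omega)
      rcases lt_or_ge d (j - (i + 1)) with h | h
      · rw [show d + 1 - (j - i) = 0 by omega] at hpoly
        rw [show d + 1 - (j - (i + 1)) = 0 by omega]
        have h3 : ∀ n : ℕ, coeff d ((a : T⟦X⟧) ^ n.choose (i + 1) - 1) = 0 := by
          intro n
          induction n with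
          | zero => simp
          | succ n ihn => rw [← ihn, ← sub_eq_zero]; exact congrFun hpoly n
        exact funext h3
      · rw [show d + 1 - (j - (i + 1)) = d + 1 - (j - i) + 1 by omega]
        exact hpoly

theorem polySeq_pow_choose {j : ℕ} {a : T⟦X⟧ˣ} (ha : a ∈ congrUnits T j) :
    PolySeq fun n => (a : T⟦X⟧) ^ n.choose j := by
  intro d
  have h := (polyLT_coeff_pow_choose ha le_rfl d).add
    ((PolyLT.const d (coeff d (1 : T⟦X⟧))).mono (by omega))
  have e : ((fun n : ℕ => coeff d ((a : T⟦X⟧) ^ n.choose j - 1)) +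
    fun _ => coeff d (1 : T⟦X⟧)) = fun n : ℕ => coeff d ((a : T⟦X⟧) ^ n.choose j) := by
    funext n
    simp
  rw [e] at h
  simpa using h

/-- `P n` is the Petresco product without the factors of index at least `i`, so it agrees with `Q n`
for `n < i`. In degree `d < i` the coefficients of both are polynomials in `n` of degree at most
`d`, so agreement at `i` points forces agreement everywhere. At `n = i` the quotient of `Q` by `P`
is the `i`-th Petresco word. -/
theorem petresco_mem_congrUnits (l : List T⟦X⟧ˣ) (hl : ∀ a ∈ l, a ∈ congrUnits T 1) (i : ℕ) :
    petresco l i ∈ congrUnits T i := by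
  induction i using Nat.strong_induction_on with
  | _ i ih =>
    let P : ℕ → T⟦X⟧ := fun n =>
      ((List.range i).map fun k => ((petresco l k : T⟦X⟧ˣ) : T⟦X⟧) ^ n.choose k).prod
    let Q : ℕ → T⟦X⟧ := fun n => (l.map fun a : T⟦X⟧ˣ => (a : T⟦X⟧) ^ n).prod
    have hP : PolySeq P := PolySeq.list_prod _ (fun k n => ((petresco l k : T⟦X⟧ˣ) : T⟦X⟧) ^ n.choose k)
      fun k hk => polySeq_pow_choose (ih k (List.mem_range.1 hk))
    have hQ : PolySeq Q := PolySeq.list_prod _ (fun (a : T⟦X⟧ˣ) n => (a : T⟦X⟧) ^ n) fun a ha => by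
      simpa using polySeq_pow_choose (hl a ha)
    have hPu (n : ℕ) :
        P n = (((List.range i).map fun k => petresco l k ^ n.choose k).prod : T⟦X⟧ˣ) := by
      rw [← Units.coeHom_apply, map_list_prod, List.map_map]
      rfl
    have hQu (n : ℕ) : Q n = ((l.map fun a => a ^ n).prod : T⟦X⟧ˣ) := by
      rw [← Units.coeHom_apply, map_list_prod, List.map_map]
      rfl
    have hPQ : ∀ n < i, P n = Q n := by
      intro n hn
      rw [hPu, hQu, prod_pow_eq]
      congr 1
      obtain ⟨d, rfl⟩ : ∃ d, i = n + 1 + d := ⟨i - (n + 1), by omega⟩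
      exact List.prod_map_range_add _ _ _ fun k hk => by
        rw [Nat.choose_eq_zero_of_lt hk, pow_zero]
    have hcoeff : ∀ d < i, ∀ n, coeff d (Q n - P n) = 0 := by
      intro d hd
      have h1 := ((hQ d).add (hP d).neg).mono (show d + 1 ≤ i from hd)
      have h2 := h1.eq_zero fun n hn => by
        simp [hPQ n hn]
      intro n
      rw [map_sub, sub_eq_add_neg]
      exact congrFun h2 n
    obtain ⟨u, hu⟩ := X_pow_dvd_iff.2 fun d hd => hcoeff d hd i
    set π : T⟦X⟧ˣ := ((List.range i).map fun k => petresco l k ^ i.choose k).prod with hπ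
    have hpet : petresco l i = π⁻¹ * (l.map fun a => a ^ i).prod := petresco_eq l i
    refine ⟨(π⁻¹ : T⟦X⟧ˣ) * u, ?_⟩
    rw [← mul_assoc, X_pow_mul, mul_assoc, ← hu, hpet, mul_sub, hQu, hPu, Units.val_mul,
      Units.inv_mul]

end

theorem map_mem_lowerCentralSeries {G H : Type*} [Group G] [Group H] (f : G →* H) {c : ℕ} {x : G}
    (hx : x ∈ (⊤ : Subgroup G).lowerCentralSeries c) :
    f x ∈ (⊤ : Subgroup H).lowerCentralSeries c :=
  Subgroup.lowerCentralSeries_mono c le_top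
    (Subgroup.map_lowerCentralSeries ⊤ f c ▸ Subgroup.mem_map_of_mem f hx)

/-- The Hall–Petresco theorem. -/
theorem petresco_mem_lowerCentralSeries {G : Type*} [Group G] (l : List G) (i : ℕ) :
    petresco l (i + 1) ∈ (⊤ : Subgroup G).lowerCentralSeries i := by
  let f : FreeGroup (Fin l.length) →* G := FreeGroup.lift l.get
  let l' : List (FreeGroup (Fin l.length)) := List.ofFn FreeGroup.of
  have hl : l'.map f = l := by
    simp only [l', List.map_ofFn]
    have : (⇑f ∘ FreeGroup.of) = l.get := by
      funext j
      simp [f]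
    rw [this, List.ofFn_get]
  have h1 : petresco l' (i + 1) ∈ (⊤ : Subgroup _).lowerCentralSeries i := by
    refine mem_lowerCentralSeries_of_magnus_mem i _ ?_
    rw [map_petresco]
    refine petresco_mem_congrUnits _ ?_ _
    simp only [List.mem_map]
    rintro _ ⟨g, -, rfl⟩
    exact magnus_mem ℤ g
  rw [← hl, ← map_petresco]
  exact map_mem_lowerCentralSeries f h1

theorem petresco_eq_one {G : Type*} [Group G] [Group.IsNilpotent G] (l : List G) {i : ℕ}
    (hi : Group.nilpotencyClass G < i) : petresco l i = 1 := by
  cases i with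
  | zero => omega
  | succ i =>
    have := Subgroup.lowerCentralSeries_eq_bot_iff_nilpotencyClass_le.2 (Nat.le_of_lt_succ hi) ▸
      petresco_mem_lowerCentralSeries l i
    exact this

end Petresco

/-! ### Hall groups -/

section HallGroups

namespace HallGroup

variable {R : Type*} [CommRing R] [BinomialRing R] {G : Type*} [Group G] [HallGroup R G]

theorem one_hpow (r : R) : hpow (1 : G) r = 1 := by
  have h := hpow_mul (1 : G) (0 : R) r
  rwa [zero_mul, hpow_zero, eq_comm] at h

variable (R) in
theorem isNilpotent (G : Type*) [Group G] [HallGroup R G] : Group.IsNilpotent G :=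
  HallGroup.nilpotent R

/-- Petresco words beyond the class are trivial, so one bound `c` serves all groups that define
`FreeHall R A c`. Class `0` is separate because there the interval from `2` is already empty. -/
theorem prod_hpow_of_le {c : ℕ} (hc : Group.nilpotencyClass G ≤ c) (l : List G) (r : R) :
    (l.map fun x => hpow x r).prod = hpow l.prod r * ((List.Ico 2 (c + 1)).map fun i =>
      hpow (petresco l i) (Ring.choose r i)).prod := by
  have : Group.IsNilpotent G := isNilpotent R G
  rcases Nat.eq_zero_or_pos (Group.nilpotencyClass G) with h | h
  · have := Group.nilpotencyClass_zero_iff_subsingleton.1 h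
    exact Subsingleton.elim _ _
  · rw [prod_hpow, ← List.Ico.append_consecutive (show 2 ≤ Group.nilpotencyClass G + 1 by omega)
      (show Group.nilpotencyClass G + 1 ≤ c + 1 by omega), List.map_append, List.prod_append,
      List.prod_eq_one (l := List.map _ (List.Ico (Group.nilpotencyClass G + 1) (c + 1))), mul_one]
    simp only [List.mem_map, List.Ico.mem]
    rintro _ ⟨i, hi, rfl⟩
    rw [petresco_eq_one l (by omega), one_hpow]

end HallGroup

/-- The Hall formula for natural exponents, from which the formula for `ℤ_p` follows by density. -/
theorem prod_pow_eq_of_isNilpotent {G : Type*} [Group G] [Group.IsNilpotent G] (l : List G)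
    (n : ℕ) : (l.map fun a => a ^ n).prod = l.prod ^ n *
      ((List.Ico 2 (Group.nilpotencyClass G + 1)).map fun i => petresco l i ^ n.choose i).prod := by
  rcases Nat.eq_zero_or_pos (Group.nilpotencyClass G) with h | h
  · have := Group.nilpotencyClass_zero_iff_subsingleton.1 h
    exact Subsingleton.elim _ _
  · rw [prod_pow_eq, ← List.prod_map_range_add _ _ (Group.nilpotencyClass G) fun k hk => by
        rw [Nat.choose_eq_zero_of_lt hk, pow_zero],
      show n + 1 + Group.nilpotencyClass G = Group.nilpotencyClass G + 1 + n by omega,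
      List.prod_map_range_add _ _ n fun k hk => by rw [petresco_eq_one l hk, one_pow],
      ← List.Ico.zero_bot, ← List.Ico.append_consecutive (Nat.zero_le 2)
        (show 2 ≤ Group.nilpotencyClass G + 1 by omega), List.map_append, List.prod_append]
    congr 1
    change (petresco l 0 ^ n.choose 0) * (petresco l 1 ^ n.choose 1 * 1) = _
    rw [petresco_zero, one_pow, one_mul, mul_one, petresco_one, Nat.choose_one_right]

/-- In the normalizer modulo `K` the two elements commute, and Petresco words of index at least `2`
vanish on commuting pairs. -/
theorem petresco_mem_of_commutator_mem {G : Type*} [Group G] (K : Subgroup G) {a b : G}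
    (ha : a ∈ Subgroup.normalizer (K : Set G)) (hb : b ∈ Subgroup.normalizer (K : Set G))
    (hab : ⁅a, b⁆ ∈ K) (i : ℕ) : petresco [a, b] (i + 2) ∈ K := by
  let π := QuotientGroup.mk' (K.subgroupOf (Subgroup.normalizer (K : Set G)))
  let a' : Subgroup.normalizer (K : Set G) := ⟨a, ha⟩
  let b' : Subgroup.normalizer (K : Set G) := ⟨b, hb⟩
  have hcomm : Commute (π a') (π b') := by
    rw [← commutatorElement_eq_one_iff_commute, ← map_commutatorElement]
    rw [QuotientGroup.mk'_apply, QuotientGroup.eq_one_iff]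
    exact hab
  have h : π (petresco [a', b'] (i + 2)) = 1 := by
    rw [map_petresco]
    exact petresco_commute hcomm i
  rw [QuotientGroup.mk'_apply, QuotientGroup.eq_one_iff, Subgroup.mem_subgroupOf] at h
  have e := map_petresco (Subgroup.normalizer (K : Set G)).subtype [a', b'] (i + 2)
  rw [Subgroup.subtype_apply] at e
  rw [e] at h
  exact h

namespace FreeHall

variable {R : Type u} [CommRing R] [BinomialRing R] {A : Type v} {c : ℕ}

/-- The homomorphism from the free Hall group to a Hall group given by an assignment. -/
def lift {G : Type (max u v)} [Group G] [HallGroup R G] (hG : Group.nilpotencyClass G ≤ c)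
    (f : A → G) : FreeHall R A c →* G where
  toFun := Quotient.lift (fun t => t.eval f) fun _ _ h => h G hG f
  map_one' := rfl
  map_mul' := by
    rintro ⟨x⟩ ⟨y⟩
    rfl

variable {G : Type (max u v)} [Group G] [HallGroup R G] (hG : Group.nilpotencyClass G ≤ c)
  (f : A → G)

theorem lift_hpow (g : FreeHall R A c) (r : R) :
    lift hG f (hpow g r) = HallGroup.hpow (lift hG f g) r := by
  obtain ⟨t, rfl⟩ := Quotient.exists_rep g
  rfl

theorem trans_hpow (g : FreeHall R A (c + 1)) (r : R) : trans (hpow g r) = hpow (trans g) r := by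
  obtain ⟨t, rfl⟩ := Quotient.exists_rep g
  rfl

/-- Terms are identified by their values in Hall groups of class at most `c`, so the identities of
the free object are checked there. -/
theorem ext_lift {x y : FreeHall R A c} (h : ∀ (G : Type (max u v)) [Group G] [HallGroup R G]
    (hG : Group.nilpotencyClass G ≤ c) (f : A → G), lift hG f x = lift hG f y) : x = y := by
  obtain ⟨s, rfl⟩ := Quotient.exists_rep x
  obtain ⟨t, rfl⟩ := Quotient.exists_rep y
  exact Quotient.sound fun G _ _ hG f => h G hG f

theorem prod_hpow (l : List (FreeHall R A c)) (r : R) :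
    (l.map fun x => hpow x r).prod = hpow l.prod r * ((List.Ico 2 (c + 1)).map fun i =>
      hpow (petresco l i) (Ring.choose r i)).prod := by
  refine ext_lift fun G _ _ hG f => ?_
  have := HallGroup.prod_hpow_of_le hG (l.map (lift hG f)) r
  rw [List.map_map] at this
  simp only [map_list_prod, map_mul, List.map_map, lift_hpow, Function.comp_def] at this ⊢
  simpa only [map_petresco] using this

theorem lowerCentralSeries_eq_bot :
    (⊤ : Subgroup (FreeHall R A c)).lowerCentralSeries c = ⊥ := by
  rw [eq_bot_iff]
  intro x hx
  rw [Subgroup.mem_bot]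
  refine ext_lift fun G _ _ hG f => ?_
  have : Group.IsNilpotent G := HallGroup.isNilpotent R G
  have h1 := map_mem_lowerCentralSeries (lift (R := R) hG f) hx
  rw [Subgroup.lowerCentralSeries_eq_bot_iff_nilpotencyClass_le.2 hG] at h1
  rw [map_one]
  exact h1

variable (R A c) in
/-- The powers in the free Hall group with exponents in a ring that maps to `R`. -/
def powStr {R' : Type*} [CommRing R'] [BinomialRing R'] (ψ : R' →+* R) :
    PowStr R' (FreeHall R A c) where
  pow g r := hpow g (ψ r)
  pow_zero g := ext_lift fun G _ _ hG f => by
    rw [lift_hpow, map_zero, HallGroup.hpow_zero, map_one]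
  pow_one g := ext_lift fun G _ _ hG f => by
    rw [lift_hpow, map_one, HallGroup.hpow_one]
  pow_add g r s := ext_lift fun G _ _ hG f => by
    rw [lift_hpow, map_add, HallGroup.hpow_add, map_mul, lift_hpow, lift_hpow]
  pow_mul g r s := ext_lift fun G _ _ hG f => by
    rw [lift_hpow, map_mul, HallGroup.hpow_mul, lift_hpow, lift_hpow]
  conj_pow x y r := ext_lift fun G _ _ hG f => by
    simp only [map_mul, map_inv, lift_hpow, HallGroup.conj_hpow]
  mul_pow_mem K hK a ha b hb hab r := by
    have key := prod_hpow [a, b] (ψ r)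
    simp only [List.map_cons, List.map_nil, List.prod_cons, List.prod_nil, mul_one] at key
    rw [key, mul_inv_rev, inv_mul_cancel_right, inv_mem_iff]
    refine list_prod_mem fun x hx => ?_
    simp only [List.mem_map, List.Ico.mem] at hx
    obtain ⟨i, hi, rfl⟩ := hx
    obtain ⟨j, rfl⟩ := Nat.exists_eq_add_of_le' hi.1
    -- Binomial coefficients of `ψ r` come from `R'`, so closure of `K` under `R'`-powers suffices.
    rw [← Ring.map_choose]
    exact hK _ (petresco_mem_of_commutator_mem K ha hb hab j) _

theorem mem_closure_of (g : FreeHall R A c) :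
    g ∈ (powStr R A c (RingHom.id R)).closure (Set.range of) := by
  obtain ⟨t, rfl⟩ := Quotient.exists_rep g
  induction t with
  | var a => exact PowStr.subset_closure _ _ (Set.mem_range_self a)
  | one => exact one_mem _
  | mul s t hs ht => exact mul_mem hs ht
  | inv s hs => exact inv_mem hs
  | hpow s r hs => exact PowStr.isClosed_closure _ _ _ hs r

end FreeHall

end HallGroups

/-! ### Finite `p`-groups as Hall groups -/

section PGroups

variable {p : ℕ} [Fact p.Prime]

theorem PadicInt.continuous_comp_toZModPow {D : Type*} [TopologicalSpace D]
    (n : ℕ) (g : ZMod (p ^ n) → D) : Continuous fun s : ℤ_[p] => g (PadicInt.toZModPow n s) := by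
  refine IsLocallyConstant.continuous ((IsLocallyConstant.iff_eventually_eq _).2 fun x => ?_)
  have hp : (0 : ℝ) < p := Nat.cast_pos.2 (Fact.out : p.Prime).pos
  filter_upwards [Metric.closedBall_mem_nhds x (zpow_pos hp (-(n : ℤ)))] with y hy
  rw [Metric.mem_closedBall, dist_eq_norm, PadicInt.norm_le_pow_iff_mem_span_pow,
    ← PadicInt.ker_toZModPow, RingHom.mem_ker, map_sub, sub_eq_zero] at hy
  rw [hy]

variable {Q : Type*} [Group Q]

/-- Powers with exponents in `ℤ_p` in a finite `p`-group. -/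
noncomputable def ppow (x : Q) (s : ℤ_[p]) : Q :=
  x ^ (PadicInt.toZModPow (Nat.card Q) s).val

/-- If `|Q| = p ^ k` then `k ≤ |Q|`, so `p ^ |Q|` is a crude exponent that avoids naming `k`. -/
theorem pow_prime_pow_card [Finite Q] (hQ : IsPGroup p Q) (x : Q) : x ^ p ^ Nat.card Q = 1 := by
  obtain ⟨k, hk⟩ := IsPGroup.iff_card.1 hQ
  rw [← orderOf_dvd_iff_pow_eq_one]
  refine (orderOf_dvd_natCard x).trans ?_
  nth_rw 1 [hk]
  refine pow_dvd_pow p ?_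
  rw [hk]
  exact (Nat.lt_pow_self (Fact.out : p.Prime).one_lt).le

theorem ppow_eq_of_toZModPow_eq [Finite Q] (hQ : IsPGroup p Q) (x : Q) (s : ℤ_[p]) (n : ℕ)
    (h : PadicInt.toZModPow (Nat.card Q) s = n) : ppow x s = x ^ n := by
  rw [ppow, h, ZMod.val_natCast, pow_eq_pow_iff_modEq]
  exact (Nat.mod_modEq _ _).of_dvd (orderOf_dvd_of_pow_eq_one (pow_prime_pow_card hQ x))

theorem ppow_natCast [Finite Q] (hQ : IsPGroup p Q) (x : Q) (n : ℕ) :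
    ppow (p := p) x n = x ^ n :=
  ppow_eq_of_toZModPow_eq hQ x n n (map_natCast _ _)

theorem map_ppow [Finite Q] (hQ : IsPGroup p Q) {Q' : Type*} [Group Q'] [Finite Q']
    (hQ' : IsPGroup p Q') (f : Q →* Q') (x : Q) (s : ℤ_[p]) : f (ppow x s) = ppow (f x) s := by
  -- One integer approximating `s` well enough for both groups.
  let n := (PadicInt.toZModPow (p := p) (Nat.card Q + Nat.card Q') s).val
  have h (d : ℕ) (hd : d ≤ Nat.card Q + Nat.card Q') : PadicInt.toZModPow d s = (n : ZMod (p ^ d)) := by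
    rw [← PadicInt.cast_toZModPow d _ hd, ← ZMod.natCast_val]
  rw [ppow_eq_of_toZModPow_eq hQ x s n (h _ (Nat.le_add_right _ _)),
    ppow_eq_of_toZModPow_eq hQ' _ s n (h _ (Nat.le_add_left _ _)), map_pow]

theorem continuous_ppow [TopologicalSpace Q] (x : Q) : Continuous fun s : ℤ_[p] => ppow x s :=
  PadicInt.continuous_comp_toZModPow _ fun z => x ^ z.val

/-- A finite `p`-group is a Hall group over every ring that maps to `ℤ_p`. -/
@[reducible]
noncomputable def IsPGroup.hallGroup {R : Type*} [CommRing R] [BinomialRing R] (ψ : R →+* ℤ_[p])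
    [Finite Q] (hQ : IsPGroup p Q) : HallGroup R Q :=
  letI : TopologicalSpace Q := ⊥
  haveI : DiscreteTopology Q := ⟨rfl⟩
  haveI : Group.IsNilpotent Q := hQ.isNilpotent
  -- With `Q` discrete both sides of each exponent axiom are continuous on `ℤ_p`, so natural
  -- exponents suffice.
  have ext {f g : ℤ_[p] → Q} (hf : Continuous f) (hg : Continuous g) (h : ∀ n : ℕ, f n = g n)
      (s : ℤ_[p]) : f s = g s :=
    congrFun (PadicInt.denseRange_natCast.equalizer hf hg (funext h)) s
  { hpow := fun g r => ppow g (ψ r)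
    nilpotent := inferInstance
    hpow_zero := fun g => by simpa using ppow_natCast hQ g 0
    hpow_one := fun g => by simpa using ppow_natCast hQ g 1
    hpow_add := fun g r s => by
      rw [map_add]
      refine ext (f := fun s => ppow g (ψ r + s)) (g := fun s => ppow g (ψ r) * ppow g s)
        ((continuous_ppow g).comp (by fun_prop))
        (continuous_const.mul (continuous_ppow g)) (fun n => ?_) (ψ s)
      refine ext (f := fun r => ppow g (r + (n : ℤ_[p]))) (g := fun r => ppow g r * ppow g (n : ℤ_[p]))
        ((continuous_ppow g).comp (by fun_prop))
        ((continuous_ppow g).mul continuous_const) (fun m => ?_) (ψ r)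
      rw [← Nat.cast_add, ppow_natCast hQ, ppow_natCast hQ, ppow_natCast hQ, pow_add]
    hpow_mul := fun g r s => by
      rw [map_mul]
      refine ext (f := fun s => ppow g (ψ r * s)) (g := fun s => ppow (ppow g (ψ r)) s)
        ((continuous_ppow g).comp (by fun_prop))
        (continuous_ppow _) (fun n => ?_) (ψ s)
      refine ext (f := fun r => ppow g (r * (n : ℤ_[p]))) (g := fun r => ppow (ppow g r) (n : ℤ_[p]))
        ((continuous_ppow g).comp (by fun_prop))
        ((continuous_of_discreteTopology (f := fun x => ppow x (n : ℤ_[p]))).comp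
          (continuous_ppow g)) (fun m => ?_) (ψ r)
      rw [← Nat.cast_mul, ppow_natCast hQ, ppow_natCast hQ, ppow_natCast hQ, pow_mul]
    conj_hpow := fun x y r => by
      simpa using map_ppow hQ hQ (MulAut.conj y⁻¹).toMonoidHom x (ψ r)
    prod_hpow := fun l r => by
      simp only [Ring.map_choose]
      refine ext (f := fun s => (l.map fun x => ppow x s).prod) (g := fun s =>
        ppow l.prod s * ((List.Ico 2 (Group.nilpotencyClass Q + 1)).map fun i =>
          ppow (petresco l i) (Ring.choose s i)).prod)
        (continuous_list_prod l fun x _ => continuous_ppow x)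
        ((continuous_ppow _).mul (continuous_list_prod _ fun i _ =>
          (continuous_ppow _).comp (PadicInt.continuous_choose i))) (fun n => ?_) (ψ r)
      simp only [ppow_natCast hQ, Ring.choose_natCast]
      exact prod_pow_eq_of_isNilpotent l n }

end PGroups

/-! ### Finite `p`-quotients of free groups and of free Hall groups -/

section PQuotients

open PowerSeries

instance congrUnits_normal (T : Type*) [Ring T] (d : ℕ) : (congrUnits T d).Normal where
  conj_mem a ha g := by
    obtain ⟨u, hu⟩ := ha
    refine ⟨g * u * (g⁻¹ : T⟦X⟧ˣ), ?_⟩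
    have e : ((g * a * g⁻¹ : T⟦X⟧ˣ) : T⟦X⟧) - 1 =
        (g : T⟦X⟧) * ((a : T⟦X⟧) - 1) * ((g⁻¹ : T⟦X⟧ˣ) : T⟦X⟧) := by
      rw [mul_sub, sub_mul, mul_one, Units.mul_inv, Units.val_mul, Units.val_mul]
    rw [e, hu, ← mul_assoc, ← X_pow_mul, mul_assoc, mul_assoc, mul_assoc]

/-- Homogeneity: `V ^ d` is a finite set when `k` and `A` are finite, which makes the truncated
Magnus group finite. -/
theorem magnus_coeff_mem {A : Type v} (k : Type*) [CommRing k] (g : FreeGroup A) (d : ℕ) :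
    coeff d (magnus k g : (FreeAlgebra k A)⟦X⟧) ∈
      (Submodule.span k (Set.range (FreeAlgebra.ι k (X := A)))) ^ d := by
  set V := Submodule.span k (Set.range (FreeAlgebra.ι k (X := A))) with hV
  have hmul {x y : (FreeAlgebra k A)⟦X⟧} (hx : ∀ d, coeff d x ∈ V ^ d)
      (hy : ∀ d, coeff d y ∈ V ^ d) (d : ℕ) : coeff d (x * y) ∈ V ^ d := by
    rw [coeff_mul]
    refine Submodule.sum_mem _ fun q hq => ?_
    rw [Finset.HasAntidiagonal.mem_antidiagonal] at hq
    rw [← hq, pow_add]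
    exact Submodule.mul_mem_mul (hx _) (hy _)
  let K : Subgroup (FreeAlgebra k A)⟦X⟧ˣ :=
    { carrier := {a | (∀ d, coeff d (a : (FreeAlgebra k A)⟦X⟧) ∈ V ^ d) ∧
        ∀ d, coeff d ((a⁻¹ : (FreeAlgebra k A)⟦X⟧ˣ) : (FreeAlgebra k A)⟦X⟧) ∈ V ^ d}
      one_mem' := by
        have (d : ℕ) : coeff d (1 : (FreeAlgebra k A)⟦X⟧) ∈ V ^ d := by
          rw [coeff_one]
          split_ifs with h
          · rw [h, pow_zero]
            exact Submodule.one_le.1 le_rfl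
          · exact zero_mem _
        exact ⟨by simpa using this, by simpa using this⟩
      mul_mem' := fun {a b} ha hb => ⟨by simpa using hmul ha.1 hb.1, by
        simpa using hmul hb.2 ha.2⟩
      inv_mem' := fun {a} ha => ⟨ha.2, by simpa using ha.1⟩ }
  refine (FreeGroup.map_mem (magnus k) K (fun a => ?_) g).1 d
  have ha : FreeAlgebra.ι k a ∈ V := Submodule.subset_span ⟨a, rfl⟩
  have hm : magnus k (FreeGroup.of a) = oneAddUnit (FreeAlgebra.ι k a) := by simp [magnus]
  rw [hm]
  constructor
  · intro d
    change coeff d (1 + X * C (FreeAlgebra.ι k a)) ∈ _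
    rcases d with _ | _ | d
    · simp
    · simpa [coeff_one, coeff_succ_X_mul] using ha
    · simp [coeff_one, coeff_X]
  · intro d
    change coeff d (mk fun n => (-FreeAlgebra.ι k a) ^ n) ∈ _
    rw [coeff_mk]
    exact Submodule.pow_mem_pow _ (neg_mem ha) d

/-- A `q`-th power multiplies the leading coefficient by `q = 0`, so it moves one step down the
filtration. -/
theorem pow_mem_congrUnits {A : Type v} (q : ℕ) (c : ℕ) {a : (FreeAlgebra (ZMod q) A)⟦X⟧ˣ}
    (ha : a ∈ congrUnits _ 1) : a ^ q ^ c ∈ congrUnits _ (c + 1) := by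
  induction c with
  | zero => simpa using ha
  | succ c ih =>
    rw [pow_succ, pow_mul, mem_congrUnits_succ]
    refine ⟨pow_mem ih q, ?_⟩
    rw [lead_pow c.succ_pos ih, ← Nat.cast_smul_eq_nsmul (ZMod q), ZMod.natCast_self, zero_smul]

theorem PPowSubgroup.isPGroup {p : ℕ} {G : Type*} [Group G] (N : PPowSubgroup p G) :
    IsPGroup p (G ⧸ N.toSubgroup) := by
  obtain ⟨k, hk⟩ := N.index_eq
  exact IsPGroup.of_card (n := k) (by rw [← hk, Subgroup.index])

variable (p : ℕ) [Fact p.Prime]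

instance PPowSubgroup.finite_quotient {G : Type*} [Group G] (N : PPowSubgroup p G) :
    Finite (G ⧸ N.toSubgroup) := by
  obtain ⟨k, hk⟩ := N.index_eq
  refine Nat.finite_of_card_ne_zero ?_
  rw [← Subgroup.index, hk]
  exact pow_ne_zero _ (Fact.out : p.Prime).ne_zero

/-- The kernel of a homomorphism to a finite `p`-group. -/
def PPowSubgroup.ofKer {p : ℕ} [Fact p.Prime] {G Q : Type*} [Group G] [Group Q] [Finite Q]
    (hQ : IsPGroup p Q) (f : G →* Q) : PPowSubgroup p G where
  toSubgroup := f.ker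
  normal := inferInstance
  index_eq := by
    rw [Subgroup.index_ker]
    exact IsPGroup.iff_card.1 (hQ.to_subgroup f.range)

/-- The elements of the free group that are congruent to `1` modulo `p ^ j` and modulo terms of
degree more than `c` under the Magnus homomorphism. -/
noncomputable def magnusKer (A : Type) [Finite A] (j c : ℕ) : PPowSubgroup p (FreeGroup A) where
  toSubgroup := (congrUnits _ (c + 1)).comap (magnus (ZMod (p ^ j)))
  normal := inferInstance
  index_eq := by
    set k := ZMod (p ^ j)
    have : NeZero (p ^ j) := ⟨pow_ne_zero _ (Fact.out : p.Prime).ne_zero⟩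
    set V := Submodule.span k (Set.range (FreeAlgebra.ι k (X := A)))
    set N := (congrUnits _ (c + 1)).comap (magnus (A := A) k)
    have hfin (d : ℕ) : Finite (V ^ d : Submodule k (FreeAlgebra k A)) := by
      have : Module.Finite k (V ^ d : Submodule k (FreeAlgebra k A)) :=
        Module.Finite.iff_fg.2 (Submodule.FG.pow (Submodule.fg_span (Set.finite_range _)) d)
      exact Module.finite_of_finite k
    -- The class of `g` modulo `N` is determined by finitely many coefficients, each in a finite
    -- module.
    let F : FreeGroup A → ∀ d : Fin (c + 1), (V ^ (d : ℕ) : Submodule k (FreeAlgebra k A)) :=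
      fun g d => ⟨_, magnus_coeff_mem k g d⟩
    have hF (g g' : FreeGroup A) (h : F g = F g') : (g : FreeGroup A ⧸ N) = g' := by
      rw [QuotientGroup.eq, Subgroup.mem_comap, map_mul, map_inv, mem_congrUnits]
      have e : (((magnus k g)⁻¹ * magnus k g' : (FreeAlgebra k A)⟦X⟧ˣ) : (FreeAlgebra k A)⟦X⟧) - 1 =
          (((magnus k g)⁻¹ : (FreeAlgebra k A)⟦X⟧ˣ) : (FreeAlgebra k A)⟦X⟧) *
            ((magnus k g' : (FreeAlgebra k A)⟦X⟧) - (magnus k g : (FreeAlgebra k A)⟦X⟧)) := by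
        rw [mul_sub, Units.inv_mul, Units.val_mul]
      obtain ⟨u, hu⟩ : X ^ (c + 1) ∣
          (magnus k g' : (FreeAlgebra k A)⟦X⟧) - (magnus k g : (FreeAlgebra k A)⟦X⟧) := by
        rw [X_pow_dvd_iff]
        intro d hd
        have := congrArg Subtype.val (congrFun h ⟨d, hd⟩)
        rw [map_sub, sub_eq_zero]
        exact this.symm
      rw [e, hu, ← mul_assoc, ← X_pow_mul, mul_assoc]
      exact dvd_mul_right _ _
    have : Finite (FreeGroup A ⧸ N) := Finite.of_injective (fun q => F q.out) fun q q' h => by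
      have := hF _ _ h
      rwa [QuotientGroup.out_eq', QuotientGroup.out_eq'] at this
    have hp : IsPGroup p (FreeGroup A ⧸ N) := by
      intro x
      obtain ⟨g, rfl⟩ := QuotientGroup.mk_surjective x
      refine ⟨j * c, ?_⟩
      rw [← QuotientGroup.mk_pow, QuotientGroup.eq_one_iff, Subgroup.mem_comap, map_pow, pow_mul]
      exact pow_mem_congrUnits _ _ (magnus_mem k g)
    exact IsPGroup.iff_card.1 hp

variable {p}

namespace FreeHall

variable {R : Type u} [CommRing R] [BinomialRing R] {A : Type} {c : ℕ}

/-- Homomorphisms of free Hall groups that are compatible with powers are determined by the images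
of the generators. -/
theorem hom_ext {H : Type*} [Group H] (pw : H → R → H) {g₁ g₂ : FreeHall R A c →* H}
    (h₁ : ∀ x r, g₁ (hpow x r) = pw (g₁ x) r) (h₂ : ∀ x r, g₂ (hpow x r) = pw (g₂ x) r)
    (h : ∀ a, g₁ (of a) = g₂ (of a)) (x : FreeHall R A c) : g₁ x = g₂ x := by
  obtain ⟨t, rfl⟩ := Quotient.exists_rep x
  induction t with
  | var a => exact h a
  | one => exact (map_one g₁).trans (map_one g₂).symm
  | mul s t hs ht => exact (map_mul g₁ _ _).trans ((congrArg₂ _ hs ht).trans (map_mul g₂ _ _).symm)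
  | inv s hs => exact (map_inv g₁ _).trans ((congrArg _ hs).trans (map_inv g₂ _).symm)
  | hpow s r hs => exact (h₁ _ r).trans ((congrArg (pw · r) hs).trans (h₂ _ r).symm)

/-- `ULift` moves `Q` to the universe of the groups over which `FreeHall` is defined. -/
theorem nilpotencyClass_ulift_le {Q : Type} [Group Q] [Finite Q] (hQ : IsPGroup p Q)
    (hc : (⊤ : Subgroup Q).lowerCentralSeries c = ⊥) :
    Group.nilpotencyClass (ULift.{u} Q) ≤ c := by
  have : Group.IsNilpotent (ULift.{u} Q) :=
    (hQ.of_equiv (MulEquiv.ulift.{0, u}.symm)).isNilpotent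
  rw [← Subgroup.lowerCentralSeries_eq_bot_iff_nilpotencyClass_le, eq_bot_iff]
  intro x hx
  have h := map_mem_lowerCentralSeries (MulEquiv.ulift.{0, u} (α := Q)).toMonoidHom hx
  rw [hc, Subgroup.mem_bot] at h
  exact MulEquiv.ulift.injective (h.trans (map_one _).symm)

variable (ψ : R →+* ℤ_[p]) {Q : Type} [Group Q] [Finite Q] (hQ : IsPGroup p Q)

/-- The homomorphism from the free Hall `R`-group to a finite `p`-group given by an assignment and a
homomorphism `R → ℤ_p`. -/
noncomputable def toPGroup (hc : (⊤ : Subgroup Q).lowerCentralSeries c = ⊥) (f : A → Q) :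
    FreeHall R A c →* Q :=
  letI : HallGroup R (ULift.{u} Q) := (hQ.of_equiv (MulEquiv.ulift.{0, u}.symm)).hallGroup ψ
  (MulEquiv.ulift.{0, u} (α := Q)).toMonoidHom.comp
    (lift (nilpotencyClass_ulift_le hQ hc) fun a => ULift.up (f a))

variable (hc : (⊤ : Subgroup Q).lowerCentralSeries c = ⊥) (f : A → Q)

theorem toPGroup_hpow (x : FreeHall R A c) (r : R) :
    toPGroup ψ hQ hc f (hpow x r) = ppow (toPGroup ψ hQ hc f x) (ψ r) := by
  let : HallGroup R (ULift.{u} Q) := (hQ.of_equiv (MulEquiv.ulift.{0, u}.symm)).hallGroup ψ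
  have h := lift_hpow (nilpotencyClass_ulift_le hQ hc) (fun a => ULift.up.{u} (f a)) x r
  have h2 := map_ppow (hQ.of_equiv (MulEquiv.ulift.{0, u}.symm)) hQ
    (MulEquiv.ulift.{0, u} (α := Q)).toMonoidHom
    (lift (nilpotencyClass_ulift_le hQ hc) (fun a => ULift.up.{u} (f a)) x) (ψ r)
  exact (congrArg (MulEquiv.ulift.{0, u} (α := Q)).toMonoidHom h).trans h2

theorem map_toPGroup {Q' : Type} [Group Q'] [Finite Q'] (hQ' : IsPGroup p Q')
    (hc' : (⊤ : Subgroup Q').lowerCentralSeries c = ⊥) (g : Q →* Q') (x : FreeHall R A c) :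
    g (toPGroup ψ hQ hc f x) = toPGroup ψ hQ' hc' (fun a => g (f a)) x :=
  hom_ext (g₁ := g.comp (toPGroup ψ hQ hc f)) (fun y r => ppow y (ψ r))
    (fun x r => by
      rw [MonoidHom.comp_apply, toPGroup_hpow, map_ppow hQ hQ']
      rfl)
    (fun x r => toPGroup_hpow _ _ _ _ x r) (fun a => rfl) x

theorem toPGroup_trans (hc' : (⊤ : Subgroup Q).lowerCentralSeries (c + 1) = ⊥)
    (x : FreeHall R A (c + 1)) :
    toPGroup ψ hQ hc f (trans x) = toPGroup ψ hQ hc' f x :=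
  hom_ext (g₁ := (toPGroup ψ hQ hc f).comp trans) (fun y r => ppow y (ψ r))
    (fun x r => by
      rw [MonoidHom.comp_apply, trans_hpow, toPGroup_hpow]
      rfl)
    (fun x r => toPGroup_hpow _ _ _ _ x r) (fun a => rfl) x

/-- The separation statement. The element `r` is a nonzero exponent of minimal weight in an
elimination product for `x`, and `N` is a Magnus kernel modulo a power of `p` that sees `ψ r`. -/
theorem exists_discriminating [Finite A] (x : FreeHall R A c) (hx : x ≠ 1) :
    ∃ r : R, r ≠ 0 ∧ ∀ ψ : R →+* ℤ_[p], ψ r ≠ 0 → ∃ N : PPowSubgroup p (FreeGroup A),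
      ∃ hc : (⊤ : Subgroup (FreeGroup A ⧸ N.toSubgroup)).lowerCentralSeries c = ⊥,
        toPGroup ψ N.isPGroup hc (fun a => (FreeGroup.of a : FreeGroup A)) x ≠ 1 := by
  obtain ⟨Y, hY⟩ := exists_elim c (FreeMagma.of : A → FreeMagma A)
  obtain ⟨L, hL, hxL⟩ := hY.exists_eq_prod (powStr R A c (RingHom.id R)) lowerCentralSeries_eq_bot
    of x (mem_closure_of x)
  classical
  have hex : ∃ w, ∃ q ∈ L, q.2 ≠ 0 ∧ q.1.length = w := by
    by_contra h
    push Not at h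
    refine hx ?_
    rw [hxL, List.prod_eq_one]
    simp only [List.mem_map]
    rintro _ ⟨q, hq, rfl⟩
    by_cases h0 : q.2 = 0
    · rw [h0, PowStr.pow_zero]
    · exact absurd rfl (h _ q hq h0)
  obtain ⟨q, hq, hq0, hqw⟩ := Nat.find_spec hex
  have hmin : ∀ q' ∈ L, q'.1.length < q.1.length → q'.2 = 0 := by
    intro q' hq' hlt
    by_contra h0
    rw [hqw] at hlt
    exact Nat.find_min hex hlt ⟨q', hq', h0, rfl⟩
  refine ⟨q.2, hq0, fun ψ hψ => ?_⟩
  obtain ⟨j, hj⟩ : ∃ j, PadicInt.toZModPow j (ψ q.2) ≠ 0 := by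
    by_contra h
    push Not at h
    exact hψ (PadicInt.ext_of_toZModPow.1 fun n => by rw [h n, map_zero])
  let N := magnusKer p A j c
  let π := QuotientGroup.mk' N.toSubgroup
  have hc : (⊤ : Subgroup (FreeGroup A ⧸ N.toSubgroup)).lowerCentralSeries c = ⊥ := by
    rw [← Subgroup.map_top_of_surjective π (QuotientGroup.mk'_surjective _),
      ← Subgroup.map_lowerCentralSeries, Subgroup.map_eq_bot_iff, QuotientGroup.ker_mk']
    exact lowerCentralSeries_le_comap_congrUnits _ (magnus_mem _) c
  refine ⟨N, hc, fun h1 => ?_⟩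
  -- Integers approximating modulo `p ^ M` both compute the powers in the quotient and remember `ψ
  -- r` modulo `p ^ j`.
  set M := j + Nat.card (FreeGroup A ⧸ N.toSubgroup) with hM
  let n : R → ℕ := fun r => (PadicInt.toZModPow M (ψ r)).val
  have hn (d : ℕ) (hd : d ≤ M) (r : R) : PadicInt.toZModPow d (ψ r) = (n r : ZMod (p ^ d)) := by
    rw [← PadicInt.cast_toZModPow d _ hd, ← ZMod.natCast_val]
  let L' : List (FreeMagma A × ℤ) := L.map fun q => (q.1, (n q.2 : ℤ))
  have hval : toPGroup ψ N.isPGroup hc (fun a => (FreeGroup.of a : FreeGroup A)) x =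
      π (L'.map fun q => commEval FreeGroup.of q.1 ^ q.2).prod := by
    rw [hxL, map_list_prod, map_list_prod, List.map_map, List.map_map, List.map_map]
    congr 1
    refine List.map_congr_left fun q' _ => ?_
    change toPGroup ψ N.isPGroup hc _ (hpow _ q'.2) = π (_ ^ (n q'.2 : ℤ))
    rw [toPGroup_hpow, map_commEval, zpow_natCast, map_pow, map_commEval,
      ppow_eq_of_toZModPow_eq N.isPGroup _ _ _ (hn _ (Nat.le_add_left _ _) _)]
    rfl
  rw [hval, QuotientGroup.mk'_apply, QuotientGroup.eq_one_iff] at h1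
  refine hY.magnus_notMem (ZMod (p ^ j)) L' (by rw [List.map_map]; exact hL) (q.1, (n q.2 : ℤ))
    (List.mem_map_of_mem hq) ?_ ?_ h1
  · rw [Int.cast_natCast, ← hn j (Nat.le_add_right _ _)]
    exact hj
  · simp only [L', List.mem_map]
    rintro _ ⟨q', hq', rfl⟩ hlt
    have := hmin q' hq' hlt
    simp [n, this]

end FreeHall

end PQuotients

/-! ### Topologies given by homomorphisms to discrete groups -/

section InducedTopology

open Topology Filter

variable {p : ℕ} {G : Type*} [Group G] [t : TopologicalSpace G] {ι : Type*} {Q : ι → Type*}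
  [∀ j, Group (Q j)] (f : ∀ j, G →* Q j)

theorem isTopologicalGroup_of_eq_iInf_induced
    (ht : t = ⨅ j, TopologicalSpace.induced (f j) ⊥) : IsTopologicalGroup G := by
  subst ht
  refine topologicalGroup_iInf fun j => ?_
  let : TopologicalSpace (Q j) := ⊥
  have : DiscreteTopology (Q j) := ⟨rfl⟩
  exact topologicalGroup_induced (f j)

theorem continuous_of_eq_iInf_induced (ht : t = ⨅ j, TopologicalSpace.induced (f j) ⊥) (j : ι) :
    @Continuous G (Q j) t ⊥ (f j) := by
  subst ht
  exact continuous_iInf_dom continuous_induced_dom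

theorem totallySeparatedSpace_of_eq_iInf_induced
    (ht : t = ⨅ j, TopologicalSpace.induced (f j) ⊥) (hf : ∀ x, (∀ j, f j x = 1) → x = 1) :
    TotallySeparatedSpace G := by
  rw [totallySeparatedSpace_iff_exists_isClopen]
  intro x y hxy
  obtain ⟨j, hj⟩ : ∃ j, f j x ≠ f j y := by
    by_contra h
    push Not at h
    refine hxy (inv_mul_eq_one.1 (hf _ fun j => ?_))
    rw [map_mul, map_inv, h j, inv_mul_cancel]
  let : TopologicalSpace (Q j) := ⊥
  have : DiscreteTopology (Q j) := ⟨rfl⟩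
  refine ⟨f j ⁻¹' {f j x}, (isClopen_discrete _).preimage (continuous_of_eq_iInf_induced f ht j),
    rfl, fun h => hj h.symm⟩

theorem exists_finset_of_isOpen (ht : t = ⨅ j, TopologicalSpace.induced (f j) ⊥) {U : Set G}
    (hU : IsOpen U) {x : G} (hx : x ∈ U) :
    ∃ J : Finset ι, ∀ y, (∀ j ∈ J, f j y = f j x) → y ∈ U := by
  have h := hU.mem_nhds hx
  rw [ht, nhds_iInf, Filter.mem_iInf_finite] at h
  obtain ⟨J, hJ⟩ := h
  refine ⟨J, fun y hy => ?_⟩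
  have : ∀ j ∈ J, 𝓟 {y | f j y = f j x} ≤ @nhds G (TopologicalSpace.induced (f j) ⊥) x := by
    intro j _
    let : TopologicalSpace (Q j) := ⊥
    have : DiscreteTopology (Q j) := ⟨rfl⟩
    rw [nhds_induced, nhds_discrete, comap_pure]
    exact le_rfl
  have h2 : ⨅ j ∈ J, 𝓟 {y | f j y = f j x} ≤
      ⨅ j ∈ J, @nhds G (TopologicalSpace.induced (f j) ⊥) x :=
    iInf₂_mono this
  have h3 := h2 hJ
  rw [Filter.iInf_principal_finset, mem_principal] at h3
  exact h3 (Set.mem_iInter₂.2 hy)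

/-- An open normal subgroup contains a finite intersection of kernels of maps to finite `p`-groups.
-/
theorem isProP_of_eq_iInf_induced [Fact p.Prime] (ht : t = ⨅ j, TopologicalSpace.induced (f j) ⊥)
    (hf : ∀ x, (∀ j, f j x = 1) → x = 1) [∀ j, Finite (Q j)] (hQ : ∀ j, IsPGroup p (Q j))
    [CompactSpace G] : IsProP p G where
  isTopologicalGroup := isTopologicalGroup_of_eq_iInf_induced f ht
  compactSpace := inferInstance
  t2Space := by
    have := totallySeparatedSpace_of_eq_iInf_induced f ht hf
    infer_instance
  totallyDisconnectedSpace := by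
    have := totallySeparatedSpace_of_eq_iInf_induced f ht hf
    infer_instance
  index_eq N hN hNo := by
    obtain ⟨J, hJ⟩ := exists_finset_of_isOpen f ht hNo (one_mem N)
    simp only [map_one] at hJ
    have hle : ⨅ j : J, (f j).ker ≤ N := fun y hy => hJ y fun j hj => by
      rw [Subgroup.mem_iInf] at hy
      exact hy ⟨j, hj⟩
    have (j : J) : (f j).ker.FiniteIndex := by
      rw [Subgroup.finiteIndex_iff, Subgroup.index_ker]
      exact Nat.card_pos.ne'
    have h1 : (⨅ j : J, (f j).ker).FiniteIndex := Subgroup.finiteIndex_iInf this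
    have h2 : N.FiniteIndex := Subgroup.finiteIndex_of_le hle
    have hp : IsPGroup p (G ⧸ N) := by
      intro x
      obtain ⟨g, rfl⟩ := QuotientGroup.mk_surjective x
      choose k hk using fun j => hQ j (f j g)
      refine ⟨∑ j ∈ J, k j, ?_⟩
      rw [← QuotientGroup.mk_pow, QuotientGroup.eq_one_iff]
      refine hJ _ fun j hj => ?_
      obtain ⟨d, hd⟩ := Nat.exists_eq_add_of_le (Finset.single_le_sum_of_canonicallyOrdered hj (f := k))
      rw [hd, pow_add, pow_mul, map_pow, map_pow, hk, one_pow]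
    exact IsPGroup.iff_card.1 hp

end InducedTopology

/-! ### The pro-`p` topology of an abstract group -/

section ProPTopology

variable {p : ℕ} [Fact p.Prime] {G : Type*} [Group G]

theorem continuous_proPTopology {Q : Type*} [Group Q] [Finite Q] (hQ : IsPGroup p Q) (f : G →* Q) :
    @Continuous G Q (proPTopology p G) ⊥ f := by
  let N := PPowSubgroup.ofKer hQ f
  let := proPTopology p G
  let : TopologicalSpace Q := ⊥
  let : TopologicalSpace (G ⧸ N.toSubgroup) := ⊥
  have : DiscreteTopology (G ⧸ N.toSubgroup) := ⟨rfl⟩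
  have h1 : Continuous (QuotientGroup.mk' N.toSubgroup) :=
    continuous_of_eq_iInf_induced (fun N : PPowSubgroup p G => QuotientGroup.mk' N.toSubgroup) rfl N
  let k : G ⧸ N.toSubgroup → Q := QuotientGroup.kerLift f
  exact (continuous_of_discreteTopology (f := k)).comp h1

theorem continuous_proPTopology_hom {H : Type*} [Group H] (f : G →* H) :
    @Continuous G H (proPTopology p G) (proPTopology p H) f := by
  refine continuous_iInf_rng.2 fun N => continuous_induced_rng.2 ?_
  exact continuous_proPTopology N.isPGroup ((QuotientGroup.mk' N.toSubgroup).comp f)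

theorem PPowSubgroup.exists_le_inf (N M : PPowSubgroup p G) :
    ∃ K : PPowSubgroup p G, K.toSubgroup ≤ N.toSubgroup ∧ K.toSubgroup ≤ M.toSubgroup := by
  have hp : IsPGroup p ((G ⧸ N.toSubgroup) × (G ⧸ M.toSubgroup)) := by
    rintro ⟨x, y⟩
    obtain ⟨k, hk⟩ := N.isPGroup x
    obtain ⟨l, hl⟩ := M.isPGroup y
    refine ⟨k + l, Prod.ext ?_ ?_⟩
    · simp [pow_add, pow_mul, hk]
    · simp [add_comm k l, pow_add, pow_mul, hl]
  refine ⟨PPowSubgroup.ofKer hp ((QuotientGroup.mk' N.toSubgroup).prod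
    (QuotientGroup.mk' M.toSubgroup)), fun g hg => ?_, fun g hg => ?_⟩
  · exact (QuotientGroup.eq_one_iff g).1 (congrArg Prod.fst (MonoidHom.mem_ker.1 hg))
  · exact (QuotientGroup.eq_one_iff g).1 (congrArg Prod.snd (MonoidHom.mem_ker.1 hg))

theorem PPowSubgroup.exists_le_finset (J : Finset (PPowSubgroup p G)) :
    ∃ K : PPowSubgroup p G, ∀ N ∈ J, K.toSubgroup ≤ N.toSubgroup := by
  classical
  induction J using Finset.induction_on with
  | empty => exact ⟨⟨⊤, inferInstance, 0, by simp⟩, by simp⟩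
  | insert N J _ ih =>
    obtain ⟨K, hK⟩ := ih
    obtain ⟨K', h1, h2⟩ := PPowSubgroup.exists_le_inf N K
    refine ⟨K', fun M hM => ?_⟩
    rcases Finset.mem_insert.1 hM with rfl | hM
    · exact h1
    · exact h2.trans (hK M hM)

end ProPTopology

/-! ### The free pro-`p` group -/

namespace FreeProP

open Topology

variable {p : ℕ} {X Y : Type*}

/-- The projections as homomorphisms. -/
def projHom (N : PPowSubgroup p (FreeGroup X)) : FreeProP p X →* FreeGroup X ⧸ N.toSubgroup where
  toFun := proj N
  map_one' := rfl
  map_mul' _ _ := rfl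

theorem ext_proj {w w' : FreeProP p X} (h : ∀ N, proj N w = proj N w') : w = w' :=
  Subtype.ext (funext h)

theorem map_proj (w : FreeProP p X) {N M : PPowSubgroup p (FreeGroup X)}
    (h : N.toSubgroup ≤ M.toSubgroup) {g : FreeGroup X} (hg : proj N w = (g : FreeGroup X)) :
    proj M w = (g : FreeGroup X) := by
  have := w.2 N M h
  change QuotientGroup.map _ _ _ h (proj N w) = proj M w at this
  rw [← this, hg]
  rfl

theorem topology_eq : (inferInstance : TopologicalSpace (FreeProP p X)) =
    ⨅ N, TopologicalSpace.induced (projHom N) ⊥ := rfl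

instance : IsTopologicalGroup (FreeProP p X) :=
  isTopologicalGroup_of_eq_iInf_induced projHom topology_eq

instance : TotallySeparatedSpace (FreeProP p X) :=
  totallySeparatedSpace_of_eq_iInf_induced projHom topology_eq fun _ hx => ext_proj hx

theorem continuous_proj (N : PPowSubgroup p (FreeGroup X)) : @Continuous _ _ _ ⊥ (proj N) :=
  continuous_of_eq_iInf_induced projHom topology_eq N

theorem isOpen_ker_proj (N : PPowSubgroup p (FreeGroup X)) : IsOpen {w | proj N w = 1} := by
  let : TopologicalSpace (FreeGroup X ⧸ N.toSubgroup) := ⊥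
  have : DiscreteTopology (FreeGroup X ⧸ N.toSubgroup) := ⟨rfl⟩
  exact (isOpen_discrete {1}).preimage (continuous_proj N)

theorem continuous_rng {Z : Type*} [TopologicalSpace Z] {f : Z → FreeProP p X}
    (hf : ∀ N, @Continuous _ _ _ ⊥ fun z => proj N (f z)) : Continuous f :=
  continuous_iInf_rng.2 fun N => continuous_induced_rng.2 (hf N)

instance [Fact p.Prime] : CompactSpace (FreeProP p X) := by
  let (N : PPowSubgroup p (FreeGroup X)) : TopologicalSpace (FreeGroup X ⧸ N.toSubgroup) := ⊥
  have (N : PPowSubgroup p (FreeGroup X)) : DiscreteTopology (FreeGroup X ⧸ N.toSubgroup) := ⟨rfl⟩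
  let coord : FreeProP p X → ∀ N : PPowSubgroup p (FreeGroup X), FreeGroup X ⧸ N.toSubgroup :=
    fun w N => proj N w
  have hind : IsInducing coord := by
    constructor
    rw [Pi.topologicalSpace, induced_iInf]
    simp only [induced_compose]
    rfl
  refine Topology.IsClosedEmbedding.compactSpace (f := coord)
    ⟨⟨hind, fun w w' h => ext_proj (congrFun h)⟩, ?_⟩
  have : Set.range coord =
      ⋂ (N) (M) (h : N.toSubgroup ≤ M.toSubgroup),
        {w | QuotientGroup.map N.toSubgroup M.toSubgroup (MonoidHom.id _) h (w N) = w M} := by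
    refine Subtype.range_val.trans (?_ : {w | w ∈ freeProPSubgroup p X} = _)
    ext w
    simp only [Set.mem_iInter]
    rfl
  rw [this]
  refine isClosed_iInter fun N => isClosed_iInter fun M => isClosed_iInter fun h => ?_
  exact isClosed_eq (continuous_of_discreteTopology.comp (continuous_apply N)) (continuous_apply M)

/-- The homomorphism from the abstract free group. -/
def ofFreeGroup : FreeGroup X →* FreeProP p X where
  toFun g := ⟨fun _ => (g : FreeGroup X), fun _ _ _ => rfl⟩
  map_one' := rfl
  map_mul' _ _ := rfl

theorem denseRange_ofFreeGroup [Fact p.Prime] :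
    DenseRange (ofFreeGroup : FreeGroup X → FreeProP p X) := by
  intro w
  rw [mem_closure_iff]
  intro U hU hw
  obtain ⟨J, hJ⟩ := exists_finset_of_isOpen projHom topology_eq hU hw
  obtain ⟨K, hK⟩ := PPowSubgroup.exists_le_finset J
  obtain ⟨g, hg⟩ := QuotientGroup.mk_surjective (proj K w)
  exact ⟨ofFreeGroup g, hJ _ fun N hN => (map_proj w (hK N hN) hg.symm).symm, g, rfl⟩

theorem hom_ext [Fact p.Prime] {P : Type*} [Group P] [TopologicalSpace P] [T2Space P]
    {f g : FreeProP p X →* P} (hf : Continuous f) (hg : Continuous g)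
    (h : ∀ x, f (of x) = g (of x)) : f = g := by
  have h1 : f.comp ofFreeGroup = g.comp ofFreeGroup := by
    ext x
    exact h x
  refine MonoidHom.ext (congrFun (denseRange_ofFreeGroup.equalizer hf hg ?_))
  exact congrArg DFunLike.coe h1

theorem lift_of [Fact p.Prime] (g : X → FreeProP p Y) (x : X) : lift g (of x) = g x := by
  refine ext_proj fun M => ?_
  change liftAux g M (FreeGroup.of x) = _
  simp [liftAux]

theorem continuous_lift [Fact p.Prime] (g : X → FreeProP p Y) : Continuous (lift g) := by
  refine continuous_rng fun M => ?_
  let : TopologicalSpace (FreeGroup Y ⧸ M.toSubgroup) := ⊥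
  let : TopologicalSpace (FreeGroup X ⧸ (liftKer g M).toSubgroup) := ⊥
  have : DiscreteTopology (FreeGroup X ⧸ (liftKer g M).toSubgroup) := ⟨rfl⟩
  exact (continuous_of_discreteTopology
    (f := QuotientGroup.lift (liftKer g M).toSubgroup (liftAux g M) le_rfl)).comp
    (continuous_proj (liftKer g M))

/-- The universal property of the free pro-`p` group. -/
theorem exists_lift [Fact p.Prime] {P : Type*} [Group P] [TopologicalSpace P] (hP : IsProP p P)
    (g : X → P) : ∃ θ : FreeProP p X →ₜ* P, ∀ x, θ (of x) = g x := by
  have := hP.isTopologicalGroup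
  have := hP.compactSpace
  have := hP.t2Space
  have := hP.totallyDisconnectedSpace
  let f := FreeGroup.lift g
  let PP (U : OpenNormalSubgroup P) : PPowSubgroup p P :=
    ⟨U.toSubgroup, inferInstance, hP.index_eq _ inferInstance U.isOpen'⟩
  let NN (U : OpenNormalSubgroup P) : PPowSubgroup p (FreeGroup X) :=
    PPowSubgroup.ofKer (PP U).isPGroup ((QuotientGroup.mk' (PP U).toSubgroup).comp f)
  have hNN (U : OpenNormalSubgroup P) (y : FreeGroup X) : y ∈ (NN U).toSubgroup ↔ f y ∈ U :=
    QuotientGroup.eq_one_iff (f y)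
  -- the condition on the value of `θ` at `w`
  let Z (w : FreeProP p X) (U : OpenNormalSubgroup P) : Set P :=
    {x | ∀ y : FreeGroup X, proj (NN U) w = y → x⁻¹ * f y ∈ U}
  have hZmk (w : FreeProP p X) (U : OpenNormalSubgroup P) (y : FreeGroup X)
      (hy : proj (NN U) w = y) (x : P) : x ∈ Z w U ↔ x⁻¹ * f y ∈ U := by
    refine ⟨fun h => h y hy, fun h y' hy' => ?_⟩
    have h1 : y⁻¹ * y' ∈ (NN U).toSubgroup := QuotientGroup.eq.1 (hy.symm.trans hy')
    rw [hNN, map_mul, map_inv] at h1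
    have := mul_mem h h1
    simpa [mul_assoc] using this
  have hZmono (w : FreeProP p X) {U V : OpenNormalSubgroup P} (h : U ≤ V) : Z w U ⊆ Z w V := by
    intro x hx
    obtain ⟨y, hy⟩ := QuotientGroup.mk_surjective (proj (NN U) w)
    have hle : (NN U).toSubgroup ≤ (NN V).toSubgroup := fun y hy =>
      (hNN V y).2 (h ((hNN U y).1 hy))
    exact (hZmk w V y (map_proj w hle hy.symm) x).2 (h (hx y hy.symm))
  have : Nonempty (OpenNormalSubgroup P) := ⟨⟨⊤, inferInstanceAs (⊤ : Subgroup P).Normal⟩⟩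
  -- Each `Z w U` is a coset of `U`. These closed cosets are directed, so they meet by compactness;
  -- open normal subgroups intersect trivially, so they meet in one point.
  have hne (w : FreeProP p X) : (⋂ U, Z w U).Nonempty := by
    refine IsCompact.nonempty_iInter_of_directed_nonempty_isCompact_isClosed _ ?_ ?_ ?_ ?_
    · exact fun U V => ⟨U ⊓ V, hZmono w inf_le_left, hZmono w inf_le_right⟩
    · intro U
      obtain ⟨y, hy⟩ := QuotientGroup.mk_surjective (proj (NN U) w)
      exact ⟨f y, (hZmk w U y hy.symm _).2 (by simp)⟩
    all_goals
      intro U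
      have hcl : IsClosed (Z w U) := by
        obtain ⟨y, hy⟩ := QuotientGroup.mk_surjective (proj (NN U) w)
        have : Z w U = (fun x => x⁻¹ * f y) ⁻¹' U := by
          ext x
          exact hZmk w U y hy.symm x
        rw [this]
        exact (U.toOpenSubgroup.isClosed).preimage (by fun_prop)
      first | exact hcl.isCompact | exact hcl
  have huniq (w : FreeProP p X) {x x' : P} (hx : x ∈ ⋂ U, Z w U) (hx' : x' ∈ ⋂ U, Z w U) :
      x = x' := by
    by_contra hxx
    have hne : x⁻¹ * x' ≠ 1 := fun h => hxx (inv_mul_eq_one.1 h)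
    obtain ⟨U, hU⟩ := ProfiniteGrp.exist_openNormalSubgroup_sub_open_nhds_of_one
      (isOpen_compl_singleton (x := x⁻¹ * x')) (fun h => hne h.symm)
    obtain ⟨y, hy⟩ := QuotientGroup.mk_surjective (proj (NN U) w)
    have h1 := Set.mem_iInter.1 hx U y hy.symm
    have h2 := Set.mem_iInter.1 hx' U y hy.symm
    have h3 := mul_mem h1 (inv_mem h2)
    refine hU (show x⁻¹ * x' ∈ (U : Set P) from ?_) rfl
    simpa [mul_assoc] using h3
  choose θ hθ using hne
  have hθ' (w : FreeProP p X) (U : OpenNormalSubgroup P) : θ w ∈ Z w U :=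
    Set.mem_iInter.1 (hθ w) U
  let Θ : FreeProP p X →* P := MonoidHom.mk' θ fun w w' => by
    refine huniq (w * w') (hθ _) (Set.mem_iInter.2 fun U => ?_)
    obtain ⟨y, hy⟩ := QuotientGroup.mk_surjective (proj (NN U) w)
    obtain ⟨y', hy'⟩ := QuotientGroup.mk_surjective (proj (NN U) w')
    have e : proj (NN U) (w * w') = ((y * y' : FreeGroup X) : FreeGroup X ⧸ _) := by
      change proj (NN U) w * proj (NN U) w' = _
      rw [← hy, ← hy']
      rfl
    rw [hZmk _ U _ e]
    have h1 := hθ' w U y hy.symm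
    have h2 := hθ' w' U y' hy'.symm
    have h3 := mul_mem h2 (U.isNormal'.conj_mem _ h1 (f y')⁻¹)
    rw [map_mul]
    simpa [mul_assoc] using h3
  have hcont : Continuous Θ := by
    refine continuous_of_continuousAt_one Θ ?_
    rw [ContinuousAt, map_one]
    intro W hW
    obtain ⟨W', hW', hW'o, h1⟩ := mem_nhds_iff.1 hW
    obtain ⟨U, hU⟩ := ProfiniteGrp.exist_openNormalSubgroup_sub_open_nhds_of_one hW'o h1
    refine Filter.mem_map.2 (Filter.mem_of_superset
      ((isOpen_ker_proj (NN U)).mem_nhds (show proj (NN U) 1 = 1 from rfl)) fun w hw => ?_)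
    have := hθ' w U 1 hw
    rw [map_one, mul_one] at this
    exact hW' (hU (inv_mem_iff.1 this))
  refine ⟨⟨Θ, hcont⟩, fun x => huniq (of x) (hθ _) (Set.mem_iInter.2 fun U => ?_)⟩
  rw [hZmk _ U (FreeGroup.of x) rfl]
  simp [f]

end FreeProP

/-! ### Specialization of free pro-Hall groups -/

section Specialization

variable {p : ℕ} [Fact p.Prime] {R : Type u} [CommRing R] [BinomialRing R] {A : Type}

namespace ProHall

theorem trans_trunc (c : ℕ) (w : ProHall R A) : FreeHall.trans (trunc (c + 1) w) = trunc c w :=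
  w.2 c

theorem ext_trunc {w w' : ProHall R A} (h : ∀ c, trunc c w = trunc c w') : w = w' :=
  Subtype.ext (funext h)

/-- Any level at or beyond the class computes the same map; this makes the components at different
quotients comparable. -/
theorem toPGroup_trunc_eq (ψ : R →+* ℤ_[p]) {Q : Type} [Group Q] [Finite Q] (hQ : IsPGroup p Q)
    (f : A → Q) {c : ℕ} (d : ℕ) (hc : (⊤ : Subgroup Q).lowerCentralSeries c = ⊥)
    (hd : (⊤ : Subgroup Q).lowerCentralSeries (c + d) = ⊥) (w : ProHall R A) :
    FreeHall.toPGroup ψ hQ hd f (trunc (c + d) w) = FreeHall.toPGroup ψ hQ hc f (trunc c w) := by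
  induction d with
  | zero => rfl
  | succ d ih =>
    have hd' : (⊤ : Subgroup Q).lowerCentralSeries (c + d) = ⊥ :=
      eq_bot_iff.2 (hc ▸ Subgroup.lowerCentralSeries_antitone _ (Nat.le_add_right c d))
    rw [← ih hd', ← trans_trunc (c + d)]
    exact (FreeHall.toPGroup_trans ψ hQ hd' f hd _).symm

theorem toPGroup_trunc_eq' (ψ : R →+* ℤ_[p]) {Q : Type} [Group Q] [Finite Q] (hQ : IsPGroup p Q)
    (f : A → Q) {c d : ℕ} (hc : (⊤ : Subgroup Q).lowerCentralSeries c = ⊥)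
    (hd : (⊤ : Subgroup Q).lowerCentralSeries d = ⊥) (w : ProHall R A) :
    FreeHall.toPGroup ψ hQ hd f (trunc d w) = FreeHall.toPGroup ψ hQ hc f (trunc c w) := by
  rcases le_total c d with h | h
  · obtain ⟨e, rfl⟩ := Nat.exists_eq_add_of_le h
    exact toPGroup_trunc_eq ψ hQ f e hc hd w
  · obtain ⟨e, rfl⟩ := Nat.exists_eq_add_of_le h
    exact (toPGroup_trunc_eq ψ hQ f e hd hc w).symm

theorem lowerCentralSeries_class (N : PPowSubgroup p (FreeGroup A)) :
    (⊤ : Subgroup (FreeGroup A ⧸ N.toSubgroup)).lowerCentralSeries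
      (Group.nilpotencyClass (FreeGroup A ⧸ N.toSubgroup)) = ⊥ :=
  have := N.isPGroup.isNilpotent
  Subgroup.lowerCentralSeries_nilpotencyClass

/-- The component at a finite `p`-quotient of the homomorphism induced by `R → ℤ_p`. -/
noncomputable def toQuotient (ψ : R →+* ℤ_[p]) (N : PPowSubgroup p (FreeGroup A)) :
    ProHall R A →* FreeGroup A ⧸ N.toSubgroup :=
  (FreeHall.toPGroup ψ N.isPGroup (lowerCentralSeries_class N)
    fun a => (FreeGroup.of a : FreeGroup A)).comp (trunc _)

theorem toQuotient_eq (ψ : R →+* ℤ_[p]) (N : PPowSubgroup p (FreeGroup A)) {c : ℕ}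
    (hc : (⊤ : Subgroup (FreeGroup A ⧸ N.toSubgroup)).lowerCentralSeries c = ⊥) (w : ProHall R A) :
    toQuotient ψ N w = FreeHall.toPGroup ψ N.isPGroup hc
      (fun a => (FreeGroup.of a : FreeGroup A)) (trunc c w) :=
  toPGroup_trunc_eq' ψ _ _ hc (lowerCentralSeries_class N) w

/-- The homomorphism from the free pro-Hall `R`-group to the free pro-`p` group induced by a
homomorphism `R → ℤ_p`. -/
noncomputable def toFreeProP (ψ : R →+* ℤ_[p]) : ProHall R A →* FreeProP p A where
  toFun w := ⟨fun N => toQuotient ψ N w, fun N M h => by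
    let cN := Group.nilpotencyClass (FreeGroup A ⧸ N.toSubgroup)
    let cM := Group.nilpotencyClass (FreeGroup A ⧸ M.toSubgroup)
    have hN : (⊤ : Subgroup (FreeGroup A ⧸ N.toSubgroup)).lowerCentralSeries (cN + cM) = ⊥ :=
      eq_bot_iff.2 (lowerCentralSeries_class N ▸
        Subgroup.lowerCentralSeries_antitone _ (Nat.le_add_right _ _))
    have hM : (⊤ : Subgroup (FreeGroup A ⧸ M.toSubgroup)).lowerCentralSeries (cN + cM) = ⊥ :=
      eq_bot_iff.2 (lowerCentralSeries_class M ▸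
        Subgroup.lowerCentralSeries_antitone _ (Nat.le_add_left _ _))
    change QuotientGroup.map _ _ _ h (toQuotient ψ N w) = toQuotient ψ M w
    rw [toQuotient_eq ψ N hN, toQuotient_eq ψ M hM]
    exact FreeHall.map_toPGroup ψ N.isPGroup hN _ M.isPGroup hM _ _⟩
  map_one' := Subtype.ext (funext fun N => map_one (toQuotient ψ N))
  map_mul' w w' := Subtype.ext (funext fun N => map_mul (toQuotient ψ N) w w')

theorem proj_toFreeProP (ψ : R →+* ℤ_[p]) (N : PPowSubgroup p (FreeGroup A)) (w : ProHall R A) :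
    FreeProP.proj N (toFreeProP ψ w) = toQuotient ψ N w := rfl

theorem toFreeProP_of (ψ : R →+* ℤ_[p]) (a : A) :
    toFreeProP ψ (of a : ProHall R A) = FreeProP.of a := rfl

theorem exists_discriminating [Finite A] (w : ProHall R A) (hw : w ≠ 1) :
    ∃ r : R, r ≠ 0 ∧ ∀ ψ : R →+* ℤ_[p], ψ r ≠ 0 → toFreeProP ψ w ≠ 1 := by
  obtain ⟨c, hc⟩ : ∃ c, trunc c w ≠ 1 := by
    by_contra h
    push Not at h
    exact hw (ext_trunc fun c => (h c).trans (map_one _).symm)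
  obtain ⟨r, hr, h⟩ := FreeHall.exists_discriminating (p := p) _ hc
  refine ⟨r, hr, fun ψ hψ h1 => ?_⟩
  obtain ⟨N, hN, hne⟩ := h ψ hψ
  refine hne ?_
  rw [← toQuotient_eq, ← proj_toFreeProP, h1]
  rfl

/-- The free pro-Hall group is discriminated by the specializations to the free pro-`p` group. -/
theorem exists_injOn_toFreeProP [Finite A] [Algebra ℤ_[p] R]
    (hR : ∀ C : Set R, C.Finite → ∃ φ : R →ₐ[ℤ_[p]] ℤ_[p], Set.InjOn φ C)
    (C : Set (ProHall R A)) (hC : C.Finite) :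
    ∃ φ : R →ₐ[ℤ_[p]] ℤ_[p], Set.InjOn (toFreeProP (φ : R →+* ℤ_[p])) C := by
  have h : ∀ w : ProHall R A, ∃ r : R, w ≠ 1 → r ≠ 0 ∧
      ∀ ψ : R →+* ℤ_[p], ψ r ≠ 0 → toFreeProP ψ w ≠ 1 := fun w => by
    by_cases hw : w = 1
    · exact ⟨0, fun h => absurd hw h⟩
    · obtain ⟨r, hr⟩ := exists_discriminating (p := p) w hw
      exact ⟨r, fun _ => hr⟩
  choose r hr using h
  -- Injectivity on a set containing `0` makes `φ` nonzero on every nonzero `r (x⁻¹ * y)`.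
  obtain ⟨φ, hφ⟩ := hR (insert 0 (Set.image2 (fun x y => r (x⁻¹ * y)) C C))
    ((hC.image2 _ hC).insert 0)
  refine ⟨φ, fun x hx y hy hxy => ?_⟩
  by_contra hne
  obtain ⟨h0, h1⟩ := hr (x⁻¹ * y) fun h => hne (inv_mul_eq_one.1 h)
  refine h1 φ (fun h2 => h0 ?_) (by rw [map_mul, map_inv, hxy, inv_mul_cancel])
  exact hφ (Or.inr ⟨x, hx, y, hy, rfl⟩) (Or.inl rfl) (h2.trans (map_zero φ).symm)

end ProHall

end Specialization

/-! ### The Hall `ℤ_p`-subgroups generated by a tuple -/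

section HallSpan

variable {p : ℕ} [Fact p.Prime]

/-- Automatic continuity: modulo a subgroup of index `p ^ k`, elements of `p ^ k ℤ_p` go to `p ^
k`-th powers, which are trivial. -/
theorem continuous_of_map_add {G : Type*} [Group G] (π : ℤ_[p] → G)
    (hπ : ∀ r s, π (r + s) = π r * π s) : @Continuous _ _ _ (proPTopology p G) π := by
  have h0 : π 0 = 1 := by simpa using hπ 0 0
  have hn (n : ℕ) (s : ℤ_[p]) : π (n * s) = π s ^ n := by
    induction n with
    | zero => simp [h0]
    | succ n ih => rw [Nat.cast_succ, add_mul, one_mul, hπ, ih, pow_succ]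
  refine continuous_iInf_rng.2 fun N => continuous_induced_rng.2 ?_
  obtain ⟨k, hk⟩ := N.index_eq
  let : TopologicalSpace (G ⧸ N.toSubgroup) := ⊥
  have key (r : ℤ_[p]) : (π r : G ⧸ N.toSubgroup) = π ((PadicInt.toZModPow k r).val : ℤ_[p]) := by
    have : NeZero (p ^ k) := ⟨pow_ne_zero _ (Fact.out : p.Prime).ne_zero⟩
    have h1 : r - ((PadicInt.toZModPow k r).val : ℤ_[p]) ∈ RingHom.ker (PadicInt.toZModPow k) := by
      rw [RingHom.mem_ker, map_sub, map_natCast, ZMod.natCast_zmod_val, sub_self]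
    rw [PadicInt.ker_toZModPow, Ideal.mem_span_singleton] at h1
    obtain ⟨s, hs⟩ := h1
    have h2 : r = ((PadicInt.toZModPow k r).val : ℤ_[p]) + ((p ^ k : ℕ) : ℤ_[p]) * s := by
      rw [Nat.cast_pow, ← hs]
      ring
    conv_lhs => rw [h2]
    have h3 : (π s : G ⧸ N.toSubgroup) ^ p ^ k = 1 := by
      rw [← hk, Subgroup.index, pow_card_eq_one']
    rw [hπ, hn, QuotientGroup.mk_mul, QuotientGroup.mk_pow, h3, mul_one]
  have : (fun g : G => (g : G ⧸ N.toSubgroup)) ∘ π =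
      fun r => (fun z : ZMod (p ^ k) => (π (z.val : ℤ_[p]) : G ⧸ N.toSubgroup))
        (PadicInt.toZModPow k r) := funext key
  rw [this]
  exact PadicInt.continuous_comp_toZModPow k
    fun z : ZMod (p ^ k) => (π (z.val : ℤ_[p]) : G ⧸ N.toSubgroup)

variable {R : Type u} [CommRing R] [BinomialRing R] [Algebra ℤ_[p] R] {A : Type} {c m : ℕ}
  (g : Fin m → FreeHall R A c)

theorem hallSpan_eq_closure :
    hallSpan p g = (FreeHall.powStr R A c (algebraMap ℤ_[p] R)).closure (Set.range g) := by
  rw [hallSpan, PowStr.closure]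
  simp only [Set.range_subset_iff]
  rfl

theorem hpow_mem_hallSpan {x : FreeHall R A c} (hx : x ∈ hallSpan p g) (r : ℤ_[p]) :
    FreeHall.hpow x (algebraMap ℤ_[p] R r) ∈ hallSpan p g := by
  rw [hallSpan_eq_closure] at hx ⊢
  exact PowStr.isClosed_closure _ _ x hx r

theorem mem_hallSpan (i : Fin m) : g i ∈ hallSpan p g := by
  rw [hallSpan_eq_closure]
  exact PowStr.subset_closure _ _ (Set.mem_range_self i)

theorem hallSpan_le {K : Subgroup (FreeHall R A c)} (h : ∀ i, g i ∈ K)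
    (hK : ∀ x ∈ K, ∀ r : ℤ_[p], FreeHall.hpow x (algebraMap ℤ_[p] R r) ∈ K) : hallSpan p g ≤ K :=
  sInf_le ⟨h, hK⟩

/-- The `ℤ_p`-powers in a Hall `ℤ_p`-subgroup. -/
noncomputable def spanPow (x : hallSpan p g) (r : ℤ_[p]) : hallSpan p g :=
  ⟨FreeHall.hpow x.1 (algebraMap ℤ_[p] R r), hpow_mem_hallSpan g x.2 r⟩

theorem spanPow_add (x : hallSpan p g) (r s : ℤ_[p]) :
    spanPow g x (r + s) = spanPow g x r * spanPow g x s :=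
  Subtype.ext ((FreeHall.powStr R A c (algebraMap ℤ_[p] R)).pow_add x.1 r s)

theorem spanPow_natCast (x : hallSpan p g) (n : ℕ) : spanPow g x n = x ^ n := by
  induction n with
  | zero =>
    rw [pow_zero, Nat.cast_zero]
    exact Subtype.ext ((FreeHall.powStr R A c (algebraMap ℤ_[p] R)).pow_zero x.1)
  | succ n ih =>
    rw [Nat.cast_succ, spanPow_add, ih, pow_succ]
    congr 1
    exact Subtype.ext ((FreeHall.powStr R A c (algebraMap ℤ_[p] R)).pow_one x.1)

theorem continuous_spanPow (x : hallSpan p g) :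
    @Continuous _ _ _ (proPTopology p (hallSpan p g)) (spanPow g x) :=
  continuous_of_map_add _ (spanPow_add g x)

theorem isTopologicalGroup_proPTopology (p : ℕ) (G : Type*) [Group G] :
    @IsTopologicalGroup G (proPTopology p G) _ :=
  let := proPTopology p G
  isTopologicalGroup_of_eq_iInf_induced
    (fun N : PPowSubgroup p G => QuotientGroup.mk' N.toSubgroup) rfl

/-- By elimination `H_c` is a product of finitely many sets `t ^ ℤ_p`, each a continuous image of
`ℤ_p`. -/
theorem compactSpace_hallSpan : @CompactSpace (hallSpan p g) (proPTopology p _) := by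
  let := proPTopology p (hallSpan p g)
  have := isTopologicalGroup_proPTopology p (hallSpan p g)
  let g' : Fin m → hallSpan p g := fun i => ⟨g i, mem_hallSpan g i⟩
  have hcomp (Y : List (FreeMagma (Fin m))) : IsCompact {x | ∃ L : List (FreeMagma (Fin m) × ℤ_[p]),
      L.map Prod.fst = Y ∧ x = (L.map fun q => spanPow g (commEval g' q.1) q.2).prod} := by
    induction Y with
    | nil =>
      convert isCompact_singleton (x := (1 : hallSpan p g))
      ext x
      constructor
      · rintro ⟨L, hL, rfl⟩
        rw [List.map_eq_nil_iff] at hL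
        simp [hL]
      · rintro rfl
        exact ⟨[], rfl, rfl⟩
    | cons t Y ih =>
      convert (isCompact_range (continuous_spanPow g (commEval g' t))).mul ih
      ext x
      constructor
      · rintro ⟨L, hL, rfl⟩
        obtain ⟨⟨t, r⟩, L, rfl, rfl, rfl⟩ := List.map_eq_cons_iff.1 hL
        exact ⟨_, ⟨r, rfl⟩, _, ⟨L, rfl, rfl⟩, by simp⟩
      · rintro ⟨_, ⟨r, rfl⟩, _, ⟨L, rfl, rfl⟩, rfl⟩
        exact ⟨(t, r) :: L, by simp, by simp⟩
  obtain ⟨Y, hY⟩ := exists_elim c (FreeMagma.of : Fin m → FreeMagma (Fin m))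
  refine ⟨?_⟩
  convert hcomp Y
  refine (Set.eq_univ_of_forall fun x => ?_).symm
  have hx := (hallSpan_eq_closure g).le x.2
  obtain ⟨L, hL, hxL⟩ := hY.exists_eq_prod _ FreeHall.lowerCentralSeries_eq_bot g x.1 hx
  refine ⟨L, hL, Subtype.ext (hxL.trans ?_)⟩
  rw [← Subgroup.subtype_apply, map_list_prod, List.map_map]
  congr 1
  refine List.map_congr_left fun q _ => ?_
  have h1 := map_commEval (hallSpan p g).subtype g' q.1
  change FreeHall.hpow _ _ = FreeHall.hpow ((hallSpan p g).subtype (commEval g' q.1)) _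
  rw [h1]
  rfl

/-- `H_c` is residually a finite `p`-group: restrict to it the map that separates `x` from `1`. -/
theorem eq_one_of_forall_ppow [IsDomain R] [Finite A]
    (hR : ∀ C : Set R, C.Finite → ∃ φ : R →ₐ[ℤ_[p]] ℤ_[p], Set.InjOn φ C) (x : hallSpan p g)
    (hx : ∀ N : PPowSubgroup p (hallSpan p g), x ∈ N.toSubgroup) : x = 1 := by
  by_contra hne
  have hne' : x.1 ≠ 1 := fun h => hne (Subtype.ext h)
  obtain ⟨r, hr, h⟩ := FreeHall.exists_discriminating (p := p) x.1 hne'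
  obtain ⟨φ, hφ⟩ := hR {0, r} (by simp)
  have hφr : φ r ≠ 0 := fun h0 =>
    hr (hφ (by simp) (by simp) (h0.trans (map_zero φ).symm))
  obtain ⟨N, hN, hN'⟩ := h φ hφr
  exact hN' (hx (PPowSubgroup.ofKer N.isPGroup ((FreeHall.toPGroup (φ : R →+* ℤ_[p]) N.isPGroup hN
    fun a => (FreeGroup.of a : FreeGroup A)).comp (hallSpan p g).subtype)))

theorem t2Space_hallSpan [IsDomain R] [Finite A]
    (hR : ∀ C : Set R, C.Finite → ∃ φ : R →ₐ[ℤ_[p]] ℤ_[p], Set.InjOn φ C) :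
    @T2Space (hallSpan p g) (proPTopology p _) := by
  let := proPTopology p (hallSpan p g)
  have : TotallySeparatedSpace (hallSpan p g) := totallySeparatedSpace_of_eq_iInf_induced
    (fun N : PPowSubgroup p (hallSpan p g) => QuotientGroup.mk' N.toSubgroup) rfl
    fun x hx => eq_one_of_forall_ppow g hR x fun N => (QuotientGroup.eq_one_iff x).1 (hx N)
  infer_instance

end HallSpan

/-! ### The pro-`p` group generated by a tuple -/

namespace GenProP

open Topology

variable {p : ℕ} [Fact p.Prime] {R : Type u} [CommRing R] [BinomialRing R] [Algebra ℤ_[p] R]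
  {A : Type} {m : ℕ} (h : Fin m → ProHall R A)

/-- The projection onto `H_c` as a homomorphism. -/
noncomputable def projHom (c : ℕ) :
    GenProP p h →* hallSpan p fun i => ProHall.trunc c (h i) where
  toFun := proj h c
  map_one' := Subtype.ext (map_one ((ProHall.trunc c).comp (incl (p := p) h)))
  map_mul' x y := Subtype.ext (map_mul ((ProHall.trunc c).comp (incl (p := p) h)) x y)

theorem incl_injective : Function.Injective (incl h : GenProP p h → ProHall R A) :=
  Subtype.val_injective

theorem ext_proj {x y : GenProP p h} (hxy : ∀ c, proj h c x = proj h c y) : x = y :=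
  incl_injective h (ProHall.ext_trunc fun c => congrArg Subtype.val (hxy c))

theorem continuous_proj (c : ℕ) : @Continuous (GenProP p h) _ _ (proPTopology p _) (proj h c) :=
  continuous_iInf_dom continuous_induced_dom

/-- The homomorphism `H_{c + 1} → H_c`. -/
noncomputable def transHom (c : ℕ) : (hallSpan p fun i => ProHall.trunc (c + 1) (h i)) →*
    hallSpan p fun i => ProHall.trunc c (h i) :=
  (FreeHall.trans.comp (hallSpan p fun i => ProHall.trunc (c + 1) (h i)).subtype).codRestrict _
    fun x => by
      have : (hallSpan p fun i => ProHall.trunc (c + 1) (h i)) ≤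
          (hallSpan p fun i => ProHall.trunc c (h i)).comap FreeHall.trans := by
        refine hallSpan_le _ (fun i => ?_) fun x hx r => ?_
        · rw [Subgroup.mem_comap, ProHall.trans_trunc]
          exact mem_hallSpan (fun i => ProHall.trunc c (h i)) i
        · rw [Subgroup.mem_comap, FreeHall.trans_hpow]
          exact hpow_mem_hallSpan _ hx r
      exact this x.2

theorem transHom_proj (c : ℕ) (x : GenProP p h) : transHom h c (proj h (c + 1) x) = proj h c x :=
  Subtype.ext (ProHall.trans_trunc c (incl h x))

/-- The projections onto the finite `p`-quotients of the groups `H_c`. -/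
noncomputable def quotHom
    (q : Σ c : ℕ, PPowSubgroup p (hallSpan p fun i => ProHall.trunc c (h i))) :
    GenProP p h →* (hallSpan p fun i => ProHall.trunc q.1 (h i)) ⧸ q.2.toSubgroup :=
  (QuotientGroup.mk' q.2.toSubgroup).comp (projHom h q.1)

theorem topology_eq : (inferInstance : TopologicalSpace (GenProP p h)) =
    ⨅ q, TopologicalSpace.induced (quotHom h q) ⊥ := by
  rw [iInf_sigma]
  refine iInf_congr fun c => ?_
  rw [induced_iInf]
  refine iInf_congr fun N => ?_
  rw [induced_compose]
  rfl

section Discriminated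

variable [IsDomain R] [Finite A]

/-- An inverse limit of compact Hausdorff groups; the transition maps are continuous since every
homomorphism is continuous for pro-`p` topologies. -/
theorem compactSpace
    (hR : ∀ C : Set R, C.Finite → ∃ φ : R →ₐ[ℤ_[p]] ℤ_[p], Set.InjOn φ C) :
    CompactSpace (GenProP p h) := by
  let top (c : ℕ) : TopologicalSpace (hallSpan p fun i => ProHall.trunc c (h i)) := proPTopology p _
  have hcomp (c : ℕ) : CompactSpace (hallSpan p fun i => ProHall.trunc c (h i)) :=
    compactSpace_hallSpan _
  have ht2 (c : ℕ) : T2Space (hallSpan p fun i => ProHall.trunc c (h i)) := t2Space_hallSpan _ hR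
  let coord : GenProP p h → ∀ c, hallSpan p fun i => ProHall.trunc c (h i) := fun x c => proj h c x
  have hind : IsInducing coord := by
    constructor
    rw [Pi.topologicalSpace, induced_iInf]
    simp only [induced_compose]
    rfl
  refine Topology.IsClosedEmbedding.compactSpace (f := coord)
    ⟨⟨hind, fun x y hxy => ext_proj h (congrFun hxy)⟩, ?_⟩
  have : Set.range coord = ⋂ c, {x | transHom h c (x (c + 1)) = x c} := by
    ext x
    simp only [Set.mem_range, Set.mem_iInter]
    constructor
    · rintro ⟨y, rfl⟩ c
      exact transHom_proj h c y
    · intro hx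
      exact ⟨⟨⟨fun c => (x c).1, fun c => congrArg Subtype.val (hx c)⟩, fun c => (x c).2⟩, rfl⟩
  rw [this]
  exact isClosed_iInter fun c => isClosed_eq
    ((continuous_proPTopology_hom (transHom h c)).comp (continuous_apply (c + 1)))
    (continuous_apply c)

theorem isProP
    (hR : ∀ C : Set R, C.Finite → ∃ φ : R →ₐ[ℤ_[p]] ℤ_[p], Set.InjOn φ C) :
    IsProP p (GenProP p h) := by
  have := compactSpace h hR
  refine isProP_of_eq_iInf_induced (quotHom h) (topology_eq h) (fun x hx => ?_)
    fun q => q.2.isPGroup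
  refine ext_proj h fun c => ?_
  exact eq_one_of_forall_ppow _ hR (proj h c x) fun N =>
    (QuotientGroup.eq_one_iff (proj h c x)).1 (hx ⟨c, N⟩)

/-- Stated for a general compact `E` to cover equations both without and with coefficients. -/
theorem surjective_of_mem_range
    (hR : ∀ C : Set R, C.Finite → ∃ φ : R →ₐ[ℤ_[p]] ℤ_[p], Set.InjOn φ C)
    {E : Type*} [Group E] [TopologicalSpace E] [CompactSpace E]
    (θ : E →ₜ* GenProP p h) (hθ : ∀ i, ∃ e, incl h (θ e) = h i) : Function.Surjective θ := by
  let top (c : ℕ) : TopologicalSpace (hallSpan p fun i => ProHall.trunc c (h i)) := proPTopology p _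
  have ht2 (c : ℕ) : T2Space (hallSpan p fun i => ProHall.trunc c (h i)) := t2Space_hallSpan _ hR
  have hcont (c : ℕ) : Continuous fun e => proj h c (θ e) :=
    (continuous_proj h c).comp θ.continuous_toFun
  have hsurj (c : ℕ) (x : hallSpan p fun i => ProHall.trunc c (h i)) : ∃ e, proj h c (θ e) = x := by
    let f : E →* hallSpan p fun i => ProHall.trunc c (h i) := (projHom h c).comp θ.toMonoidHom
    have hcl : IsClosed (f.range : Set (hallSpan p fun i => ProHall.trunc c (h i))) :=
      (isCompact_range (hcont c)).isClosed
    -- The image is closed and contains natural powers of its elements, hence by density their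
    -- `ℤ_p`-powers.
    have hle : (hallSpan p fun i => ProHall.trunc c (h i)) ≤
        f.range.map (hallSpan p fun i => ProHall.trunc c (h i)).subtype := by
      refine hallSpan_le _ (fun i => ?_) ?_
      · obtain ⟨e, he⟩ := hθ i
        exact ⟨f e, ⟨e, rfl⟩, congrArg (ProHall.trunc c) he⟩
      · rintro _ ⟨y, hy, rfl⟩ r
        refine ⟨spanPow _ y r, ?_, rfl⟩
        have hden : Dense (Set.range (Nat.cast : ℕ → ℤ_[p])) := PadicInt.denseRange_natCast
        have h2 : Set.univ ⊆ spanPow _ y ⁻¹' (f.range : Set _) := by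
          rw [← hden.closure_eq]
          refine closure_minimal ?_ (hcl.preimage (continuous_spanPow _ y))
          rintro _ ⟨n, rfl⟩
          rw [Set.mem_preimage, spanPow_natCast]
          exact pow_mem hy n
        exact h2 (Set.mem_univ r)
    obtain ⟨y, ⟨e, rfl⟩, hy⟩ := hle x.2
    exact ⟨e, Subtype.ext hy⟩
  intro x
  -- The fibres over the components of `x` form a decreasing sequence of nonempty compact sets.
  have hne : (⋂ c, {e | proj h c (θ e) = proj h c x}).Nonempty := by
    have hclosed (c : ℕ) : IsClosed {e | proj h c (θ e) = proj h c x} :=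
      isClosed_eq (hcont c) continuous_const
    refine IsCompact.nonempty_iInter_of_sequence_nonempty_isCompact_isClosed _ (fun c e he => ?_)
      (fun c => hsurj c _) (hclosed 0).isCompact hclosed
    change proj h c (θ e) = proj h c x
    rw [← transHom_proj, ← transHom_proj h c x]
    exact congrArg _ he
  obtain ⟨e, he⟩ := hne
  exact ⟨e, ext_proj h fun c => Set.mem_iInter.1 he c⟩

end Discriminated

/-- The restriction of a specialization to the pro-`p` group generated by a tuple. -/
noncomputable def toFreeProP (ψ : R →+* ℤ_[p]) : GenProP p h →ₜ* FreeProP p A where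
  toMonoidHom := (ProHall.toFreeProP ψ).comp (incl h)
  continuous_toFun := by
    refine FreeProP.continuous_rng fun N => ?_
    let c := Group.nilpotencyClass (FreeGroup A ⧸ N.toSubgroup)
    have h1 := continuous_proPTopology N.isPGroup
      ((FreeHall.toPGroup ψ N.isPGroup (ProHall.lowerCentralSeries_class N)
        fun a => (FreeGroup.of a : FreeGroup A)).comp
      (hallSpan p fun i => ProHall.trunc c (h i)).subtype)
    let : TopologicalSpace (hallSpan p fun i => ProHall.trunc c (h i)) := proPTopology p _
    let : TopologicalSpace (FreeGroup A ⧸ N.toSubgroup) := ⊥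
    exact h1.comp (continuous_proj h c)

theorem toFreeProP_apply (ψ : R →+* ℤ_[p]) (x : GenProP p h) :
    toFreeProP h ψ x = ProHall.toFreeProP ψ (incl h x) := rfl

end GenProP

/-! ### Coordinate groups of discriminated groups -/

section Coordinate

variable {P E F H : Type*} [Group E] [Group F] [Group H]

/-- Near a point, an open set contains one given by finitely many inequations `f ≠ 1`. -/
theorem exists_finite_of_isOpen_zariskiTopology (ev : P → E →* F) {u : Set P}
    (hu : @IsOpen P (zariskiTopology ev) u) {g : P} (hg : g ∈ u) :
    ∃ C : Set E, C.Finite ∧ (∀ f ∈ C, ev g f ≠ 1) ∧ ∀ g', (∀ f ∈ C, ev g' f ≠ 1) → g' ∈ u := by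
  induction hu with
  | basic s hs =>
    obtain ⟨S, rfl⟩ := hs
    obtain ⟨f, hf, hne⟩ : ∃ f ∈ S, ev g f ≠ 1 := by
      simpa [algebraicSet] using hg
    refine ⟨{f}, Set.finite_singleton f, fun f' hf' => ?_, fun g' hg' h => ?_⟩
    · rwa [Set.mem_singleton_iff.1 hf']
    · exact hg' f rfl (h f hf)
  | univ => exact ⟨∅, Set.finite_empty, fun f hf => hf.elim, fun g' _ => Set.mem_univ g'⟩
  | inter s t _ _ hs ht =>
    obtain ⟨C, hC, h1, h2⟩ := hs hg.1
    obtain ⟨D, hD, h3, h4⟩ := ht hg.2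
    exact ⟨C ∪ D, hC.union hD, fun f hf => hf.elim (h1 f) (h3 f), fun g' h =>
      ⟨h2 g' fun f hf => h f (Or.inl hf), h4 g' fun f hf => h f (Or.inr hf)⟩⟩
  | sUnion S _ ih =>
    obtain ⟨s, hs, hgs⟩ := hg
    obtain ⟨C, hC, h1, h2⟩ := ih s hs hgs
    exact ⟨C, hC, h1, fun g' h => ⟨s, hs, h2 g' h⟩⟩

variable (ev : P → E →* F) (θ : E →* H)

/-- Two open sets meeting `V(ker θ)` contain sets cut out by finite families `C`, `D` of inequations
outside `ker θ`. A point that discriminates `1` and the image of `C ∪ D` lies in both. -/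
theorem zariskiIrreducible_of_discriminated (hd : ∀ C : Set H, C.Finite →
    ∃ (g : P) (ψ : H →* F), Set.InjOn ψ C ∧ ∀ f, ev g f = ψ (θ f)) :
    ZariskiIrreducible ev (algebraicSet ev (θ.ker : Set E)) := by
  have hmem {g : P} {ψ : H →* F} (h : ∀ f, ev g f = ψ (θ f)) :
      g ∈ algebraicSet ev (θ.ker : Set E) := fun f hf => by
    rw [h, MonoidHom.mem_ker.1 hf, map_one]
  refine ⟨?_, fun u v hu hv ⟨g, hg, hgu⟩ ⟨g', hg', hgv⟩ => ?_⟩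
  · obtain ⟨g, ψ, -, h⟩ := hd ∅ Set.finite_empty
    exact ⟨g, hmem h⟩
  · obtain ⟨C, hC, hC1, hC2⟩ := exists_finite_of_isOpen_zariskiTopology ev hu hgu
    obtain ⟨D, hD, hD1, hD2⟩ := exists_finite_of_isOpen_zariskiTopology ev hv hgv
    obtain ⟨g'', ψ, hψ, h⟩ := hd (insert 1 (θ '' (C ∪ D))) (((hC.union hD).image θ).insert 1)
    have key (f : E) (hf : f ∈ C ∪ D) (hf1 : f ∉ θ.ker) : ev g'' f ≠ 1 := fun h1 =>
      hf1 (hψ (Or.inr ⟨f, hf, rfl⟩) (Or.inl rfl) (by rw [← h, h1, map_one]))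
    exact ⟨g'', hmem h, hC2 _ fun f hf => key f (Or.inl hf) fun hk => hC1 f hf (hg f hk),
      hD2 _ fun f hf => key f (Or.inr hf) fun hk => hD1 f hf (hg' f hk)⟩

/-- If `f` vanishes on `V(ker θ)`, a point separating `θ f` from `1` forces `θ f = 1`. -/
theorem radical_of_discriminated (hd : ∀ C : Set H, C.Finite →
    ∃ (g : P) (ψ : H →* F), Set.InjOn ψ C ∧ ∀ f, ev g f = ψ (θ f)) :
    radical ev (algebraicSet ev (θ.ker : Set E)) = θ.ker := by
  refine le_antisymm (fun f hf => ?_) fun f hf => ?_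
  · obtain ⟨g, ψ, hψ, h⟩ := hd {1, θ f} (by simp)
    have hg : g ∈ algebraicSet ev (θ.ker : Set E) := fun f hf => by
      rw [h, MonoidHom.mem_ker.1 hf, map_one]
    have h1 : ev g f = 1 := by
      simp only [radical, Subgroup.mem_iInf, MonoidHom.mem_ker] at hf
      exact hf g hg
    exact hψ (by simp) (by simp) (by rw [← h, h1, map_one])
  · simp only [radical, Subgroup.mem_iInf, MonoidHom.mem_ker]
    exact fun g hg => hg f hf

/-- A compact group onto a Hausdorff group discriminated by evaluations at points presents the
latter as a coordinate group. -/
theorem exists_coordinateGroup_equiv [TopologicalSpace E] [CompactSpace E] [TopologicalSpace H]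
    [T2Space H] (hθ : Continuous θ) (hs : Function.Surjective θ) (hd : ∀ C : Set H, C.Finite →
    ∃ (g : P) (ψ : H →* F), Set.InjOn ψ C ∧ ∀ f, ev g f = ψ (θ f)) :
    ∃ e : CoordinateGroup ev (θ.ker : Set E) ≃ₜ* H, ∀ f : E, e f = θ f := by
  let e₀ : CoordinateGroup ev (θ.ker : Set E) ≃* H :=
    (QuotientGroup.quotientMulEquivOfEq (radical_of_discriminated ev θ hd)).trans
      (QuotientGroup.quotientKerEquivOfSurjective θ hs)
  have he (f : E) : e₀ f = θ f := rfl
  have hc : Continuous e₀ := continuous_coinduced_dom.2 hθ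
  exact ⟨{ e₀ with
    continuous_toFun := hc
    continuous_invFun := (Continuous.homeoOfEquivCompactToT2 (f := e₀.toEquiv) hc).continuous_symm },
    he⟩

end Coordinate

/-! ### The main theorem. -/

section

variable {p : ℕ} [Fact p.Prime] {R : Type u} [CommRing R] [BinomialRing R] [Algebra ℤ_[p] R]

namespace GenProP

variable {A : Type} {m : ℕ} (h : Fin m → ProHall R A)

theorem exists_incl_eq (i : Fin m) : ∃ x : GenProP p h, incl h x = h i :=
  ⟨⟨h i, fun c => mem_hallSpan (fun i => ProHall.trunc c (h i)) i⟩, rfl⟩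

theorem exists_injOn_toFreeProP [Finite A]
    (hR : ∀ C : Set R, C.Finite → ∃ φ : R →ₐ[ℤ_[p]] ℤ_[p], Set.InjOn φ C)
    (C : Set (GenProP p h)) (hC : C.Finite) :
    ∃ φ : R →ₐ[ℤ_[p]] ℤ_[p], Set.InjOn (toFreeProP h (φ : R →+* ℤ_[p])) C := by
  obtain ⟨φ, hφ⟩ := ProHall.exists_injOn_toFreeProP hR (incl h '' C) (hC.image _)
  exact ⟨φ, fun x hx y hy hxy => incl_injective h (hφ ⟨x, hx, rfl⟩ ⟨y, hy, rfl⟩ hxy)⟩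

end GenProP

end

theorem mainTheorem2 (p : ℕ) [Fact p.Prime]
    (R : Type u) [CommRing R] [IsDomain R] [CharZero R] [BinomialRing R] [Algebra ℤ_[p] R]
    (hR : ∀ C : Set R, C.Finite → ∃ φ : R →ₐ[ℤ_[p]] ℤ_[p], Set.InjOn φ C)
    (n m : ℕ) (h : Fin m → ProHall R (Fin n)) :
    -- `H = ⟨h₁, …, h_m⟩_𝔽` is a pro-`p` group, the image of the substitution map `x_i ↦ h_i`
    IsProP p (GenProP p h) ∧
    (∃! θ : FreeProP p (Fin m) →ₜ* GenProP p h,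
      ∀ i, GenProP.incl h (θ (FreeProP.of i)) = h i) ∧
    (∀ θ : FreeProP p (Fin m) →ₜ* GenProP p h,
      (∀ i, GenProP.incl h (θ (FreeProP.of i)) = h i) → Function.Surjective θ) ∧
    -- `H` is fully residually `F` by continuous homomorphisms
    FullyResidually (GenProP p h) (FreeProP p (Fin n)) ∧
    -- `H` is the coordinate group of an irreducible algebraic set over `F`
    (∃ S : Set (FreeProP p (Fin m)),
      ZariskiIrreducible (evalPoint (A := Fin n) (X := Fin m))
        (algebraicSet (evalPoint (A := Fin n)) S) ∧
      ∃ e : CoordinateGroup (evalPoint (A := Fin n)) S ≃ₜ* GenProP p h,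
        ∀ i, GenProP.incl h (e (FreeProP.of i : FreeProP p (Fin m))) = h i) ∧
    -- the same in the category of `F`-groups when `H` contains the basis of `F`
    ((∀ j : Fin n, ∃ g : GenProP p h, GenProP.incl h g = ProHall.of j) →
      ∃ α : FreeProP p (Fin n) →ₜ* GenProP p h,
        (∀ j, GenProP.incl h (α (FreeProP.of j)) = ProHall.of j) ∧
        Function.Injective α ∧
        FullyResiduallyOver α ∧
        ∃ S : Set (FreeProP p (Fin n ⊕ Fin m)),
          ZariskiIrreducible (evalPointCoeff (A := Fin n) (X := Fin m))
            (algebraicSet evalPointCoeff S) ∧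
          ∃ e : CoordinateGroup evalPointCoeff S ≃ₜ* GenProP p h,
            (∀ f, e (coeffIncl (Fin n) (Fin m) f) = α f) ∧
            ∀ i, GenProP.incl h
              (e (FreeProP.of (Sum.inr i) : FreeProP p (Fin n ⊕ Fin m))) = h i) := by
  have hP := GenProP.isProP h hR
  have := hP.t2Space
  choose x hx using GenProP.exists_incl_eq (p := p) h
  obtain ⟨θ, hθ⟩ := FreeProP.exists_lift hP x
  have hθh (i : Fin m) : GenProP.incl h (θ (FreeProP.of i)) = h i := by rw [hθ, hx]
  have hsurj (θ : FreeProP p (Fin m) →ₜ* GenProP p h)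
      (hθ : ∀ i, GenProP.incl h (θ (FreeProP.of i)) = h i) : Function.Surjective θ :=
    GenProP.surjective_of_mem_range h hR θ fun i => ⟨_, hθ i⟩
  have hinj := GenProP.exists_injOn_toFreeProP h hR
  refine ⟨hP, ⟨θ, hθh, fun θ' hθ' => ?_⟩, hsurj, fun C hC => ?_, ?_, fun ha => ?_⟩
  · refine ContinuousMonoidHom.toMonoidHom_injective
      (FreeProP.hom_ext θ'.continuous_toFun θ.continuous_toFun fun i => ?_)
    exact GenProP.incl_injective h ((hθ' i).trans (hθh i).symm)
  · obtain ⟨φ, hφ⟩ := hinj C hC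
    exact ⟨GenProP.toFreeProP h φ, hφ⟩
  -- The point attached to a specialization `ψ` is the tuple `ψ (h_i)`; evaluation at it and `ψ ∘ θ`
  -- agree on the basis, hence everywhere by continuity.
  · have hd (C : Set (GenProP p h)) (hC : C.Finite) : ∃ (g : Fin m → FreeProP p (Fin n))
        (ψ : GenProP p h →* FreeProP p (Fin n)), Set.InjOn ψ C ∧
          ∀ f, evalPoint g f = ψ (θ.toMonoidHom f) := by
      obtain ⟨φ, hφ⟩ := hinj C hC
      let ψ := GenProP.toFreeProP h (φ : R →+* ℤ_[p])
      refine ⟨fun i => ψ (x i), ψ.toMonoidHom, hφ, DFunLike.congr_fun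
        (FreeProP.hom_ext (g := ψ.toMonoidHom.comp θ.toMonoidHom) (FreeProP.continuous_lift _)
          (ψ.continuous_toFun.comp θ.continuous_toFun) fun i => ?_)⟩
      exact (FreeProP.lift_of _ _).trans (congrArg ψ (hθ i).symm)
    obtain ⟨e, he⟩ := exists_coordinateGroup_equiv _ θ.toMonoidHom θ.continuous_toFun
      (hsurj θ hθh) hd
    exact ⟨_, zariskiIrreducible_of_discriminated _ _ hd, e, fun i => by rw [he]; exact hθh i⟩
  · choose a ha using ha
    obtain ⟨α, hα⟩ := FreeProP.exists_lift hP a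
    -- Specializations fix the basis `A`, so each is a retraction of `α`.
    have hψα (φ : R →ₐ[ℤ_[p]] ℤ_[p]) (f : FreeProP p (Fin n)) :
        GenProP.toFreeProP h (φ : R →+* ℤ_[p]) (α f) = f := by
      let ψ := GenProP.toFreeProP h (φ : R →+* ℤ_[p])
      refine DFunLike.congr_fun (FreeProP.hom_ext (f := ψ.toMonoidHom.comp α.toMonoidHom)
        (g := MonoidHom.id _) (ψ.continuous_toFun.comp α.continuous_toFun) continuous_id
        fun j => ?_) f
      change ψ (α (FreeProP.of j)) = FreeProP.of j
      rw [hα, GenProP.toFreeProP_apply, ha]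
      exact ProHall.toFreeProP_of _ j
    obtain ⟨θ', hθ'⟩ := FreeProP.exists_lift hP (Sum.elim a x)
    have hs : Function.Surjective θ' :=
      GenProP.surjective_of_mem_range h hR θ' fun i =>
        ⟨FreeProP.of (Sum.inr i), by rw [hθ']; exact hx i⟩
    have hd (C : Set (GenProP p h)) (hC : C.Finite) : ∃ (g : Fin m → FreeProP p (Fin n))
        (ψ : GenProP p h →* FreeProP p (Fin n)), Set.InjOn ψ C ∧
          ∀ f, evalPointCoeff g f = ψ (θ'.toMonoidHom f) := by
      obtain ⟨φ, hφ⟩ := hinj C hC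
      let ψ := GenProP.toFreeProP h (φ : R →+* ℤ_[p])
      refine ⟨fun i => ψ (x i), ψ.toMonoidHom, hφ, DFunLike.congr_fun
        (FreeProP.hom_ext (g := ψ.toMonoidHom.comp θ'.toMonoidHom) (FreeProP.continuous_lift _)
          (ψ.continuous_toFun.comp θ'.continuous_toFun) fun s => ?_)⟩
      refine (FreeProP.lift_of _ _).trans ?_
      change _ = ψ (θ' (FreeProP.of s))
      rw [hθ']
      cases s with
      | inl j => exact (hψα φ (FreeProP.of j)).symm.trans (congrArg ψ (hα j))
      | inr i => rfl
    obtain ⟨e, he⟩ := exists_coordinateGroup_equiv _ θ'.toMonoidHom θ'.continuous_toFun hs hd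
    refine ⟨α, fun j => by rw [hα, ha], fun f f' hff => ?_, fun C hC => ?_, _,
      zariskiIrreducible_of_discriminated _ _ hd, e, fun f => ?_, fun i => ?_⟩
    -- Discrimination of the empty set provides some `φ`, and a single retraction makes `α`
    -- injective.
    · obtain ⟨φ, -⟩ := hR ∅ Set.finite_empty
      rw [← hψα φ f, hff, hψα]
    · obtain ⟨φ, hφ⟩ := hinj C hC
      exact ⟨GenProP.toFreeProP h φ, hψα φ, hφ⟩
    · rw [he]
      refine DFunLike.congr_fun (FreeProP.hom_ext
        (f := θ'.toMonoidHom.comp (coeffIncl (Fin n) (Fin m))) (g := α.toMonoidHom)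
        (θ'.continuous_toFun.comp (FreeProP.continuous_lift _)) α.continuous_toFun fun j => ?_) f
      change θ' (FreeProP.lift _ (FreeProP.of j)) = α (FreeProP.of j)
      rw [FreeProP.lift_of, hθ', hα]
      rfl
    · rw [he]
      change GenProP.incl h (θ' _) = _
      rw [hθ']
      exact hx i
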